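/- Let $M$ be a smooth (Hausdorff, second countable, finite-dimensional, boundaryless) real manifold, $A\to M$ a smooth real vector bundle of finite rank, and $(A,\psi,\beta)$ an invertible hom-bundle: $\psi:M\to M$ is a diffeomorphism and $\beta:\Gamma A\to\Gamma A$ is a bijective $\mathbb R$-linear map with $\beta(fX)=\psi^*(f)\,\beta(X)$ for $f\in C^\infty(M)$, where $\psi^*(f)=f\circ\psi$. Let $(A^*,\psi,\beta^\dagger)$ be the dual hom-bundle, $\beta^\dagger(\xi)(X)=\psi^*\big(\xi(\beta^{-1}X)\big)$, and let $\mathfrak A=\bigoplus_{i\ge 0}\Gamma(\wedge^iA)$ with the wedge product $\wedge$ and $\mathfrak A_i=\Gamma(\wedge^iA)$. **Definitions.** *Hom-Gerstenhaber structures.* Given an endomorphism $\alpha$ of degree $0$ of the graded commutative algebra $(\mathfrak A,\wedge)$ and an $\mathbb R$-bilinear map $[-,-]$ of degree $-1$ on $\mathfrak A$, the tuple $(\mathfrak A,\wedge,[-,-],\alpha)$ is a hom-Gerstenhaber algebra if $\alpha[X,Y]=[\alpha X,\alpha Y]$ and, for $X\in\mathfrak A_i$, $Y\in\mathfrak A_j$,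 $Z\in\mathfrak A_k$, $$[X,Y]=-(-1)^{(i-1)(j-1)}[Y,X],$$ $$(-1)^{(i-1)(k-1)}[\alpha X,[Y,Z]]+(-1)^{(j-1)(i-1)}[\alpha Y,[Z,X]]+(-1)^{(k-1)(j-1)}[\alpha Z,[X,Y]]=0,$$ $$[X,Y\wedge Z]=[X,Y]\wedge\alpha(Z)+(-1)^{(i-1)j}\alpha(Y)\wedge[X,Z].$$ It is regular if $\alpha$ is bijective. It is differential if it carries an $\mathbb R$-linear map $d$ of degree $1$ with $d^2=0$, $d\alpha=\alpha d$ and $d(X\wedge Y)=dX\wedge\alpha(Y)+(-1)^{|X|}\alpha(X)\wedge dY$, and strong differential if moreover $$d[X,Y]=[dX,\alpha(Y)]+(-1)^{|X|-1}[\alpha(X),dY]$$ for homogeneous $X,Y$. We say that $\alpha$ extends $(\psi^*,\beta)$ if $\alpha=\psi^*$ on $C^\infty(M)$ and $\alpha=\beta$ on $\Gamma A$. *Hom-Lie algebroids.* A hom-Lie algebroid structure on an invertible hom-bundle $(A,\psi,\beta)$ is a pair $([-,-]_A,\rho)$ of an $\mathbb R$-bilinear skew-symmetric bracket on $\Gamma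 A$ and a smooth bundle map $\rho:\psi^!A\to\psi^!TM$ such that, writing $\rho(X)[f](m)=\langle d_{\psi(m)}f,\rho_m(X_{\psi(m)})\rangle$, $$\beta[X,Y]_A=[\beta X,\beta Y]_A,\qquad [\beta X,[Y,Z]_A]_A+[\beta Y,[Z,X]_A]_A+[\beta Z,[X,Y]_A]_A=0,$$ $$[X,fY]_A=\psi^*(f)[X,Y]_A+\rho(X)[f]\,\beta(Y),$$ $$\rho(\beta X)[\psi^*f]=\psi^*(\rho(X)[f]),\qquad \rho([X,Y]_A)[\psi^*f]=\rho(\beta X)[\rho(Y)[f]]-\rho(\beta Y)[\rho(X)[f]].$$ Its induced hom-Gerstenhaber bracket on $\mathfrak A$ is the unique one, with $\alpha$ extending $(\psi^*,\beta)$, such that $[X,Y]=[X,Y]_A$ and $[X,f]=\rho(X)[f]$ for $X,Y\in\Gamma A$, $f\in C^\infty(M)$. *Coboundary.* The coboundary operator $d_*:\mathfrak A_k\to\mathfrak A_{k+1}$ of a hom-Lie algebroid structure $([-,-]_{A^*},\rho_{A^*})$ on $(A^*,\psi,\beta^\dagger)$ is given, for $s\in\Gamma(\wedge^kA)$, $\xi_i\in\Gamma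 A^*$ and $\eta_i=(\beta^\dagger)^{-1}\xi_i$, by $$(d_*s)(\xi_1,\dots,\xi_{k+1})=\sum_i(-1)^{i+1}\rho_{A^*}(\eta_i)\big[s(\eta_1,\dots,\widehat{\eta_i},\dots,\eta_{k+1})\big]+\sum_{i<j}(-1)^{i+j}\psi^*\Big(s\big((\beta^\dagger)^{-2}[\xi_i,\xi_j]_{A^*},\eta_1,\dots,\widehat{\eta_i},\dots,\widehat{\eta_j},\dots,\eta_{k+1}\big)\Big),$$ where $(X_1\wedge\dots\wedge X_k)(\xi_1,\dots,\xi_k)=\det(\xi_j(X_i))$. *Bialgebroids.* A hom-Lie bialgebroid structure on $(A,A^*)$ consists of hom-Lie algebroid structures on $(A,\psi,\beta)$ and on $(A^*,\psi,\beta^\dagger)$ such that $$d_*[X,Y]_A=[d_*X,\beta(Y)]+[\beta(X),d_*Y]\quad\text{for all }X,Y\in\Gamma A,$$ where the brackets on the right are the induced hom-Gerstenhaber bracket on $\mathfrak A$. A tuple $(\mathfrak A,\wedge,[-,-],\alpha,d)$ is induced by it if $\alpha$ extends $(\psi^*,\beta)$, $[-,-]$ is the induced hom-Gerstenhaber bracket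 of the structure on $A$, and $d=d_*$. **Theorem.** 1. Suppose $\operatorname{rank}A\neq1$. A tuple $(\mathfrak A,\wedge,[-,-],\alpha,d)$ in which $\alpha$ extends $(\psi^*,\beta)$ is a strong differential regular hom-Gerstenhaber algebra if and only if it is induced by a hom-Lie bialgebroid structure on $(A,A^*)$. 2. In every rank, a strong differential regular hom-Gerstenhaber algebra $(\mathfrak A,\wedge,[-,-],\alpha,d)$ with $\alpha$ extending $(\psi^*,\beta)$ is induced by exactly one hom-Lie bialgebroid structure on $(A,A^*)$. 3. In every rank, each hom-Lie bialgebroid structure on $(A,A^*)$ induces exactly one tuple $(\mathfrak A,\wedge,[-,-],\alpha,d)$, and this tuple is a differential regular hom-Gerstenhaber algebra. In particular, for $\operatorname{rank}A\neq1$ the strong differential regular hom-Gerstenhaber algebra structures on $\mathfrak A$ with $\alpha$ extending $(\psi^*,\beta)$ correspond bijectively to the hom-Lie bialgebroid structures on $(A,A^*)$. -/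

import Mathlib

set_option linter.unusedSectionVars false

open scoped Manifold ContDiff Topology
open Bundle

namespace HomBundles

section Graded

variable {R B : Type*} [CommRing R] [Ring B] [Algebra R B]

/-- `B` is the direct sum of the `𝒜 i`, the product is graded and graded commutative. -/
structure IsGradedCommutativeAlgebra (𝒜 : ℕ → Submodule R B) : Prop where
  gradedMonoid : SetLike.GradedMonoid 𝒜
  isInternal : DirectSum.IsInternal 𝒜
  mul_comm : ∀ (i j : ℕ), ∀ a ∈ 𝒜 i, ∀ b ∈ 𝒜 j, a * b = (-1 : R) ^ (i * j) • (b * a)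

/-- Hom-Gerstenhaber algebra `(B = ⊕ 𝒜 i, *, [-,-], α)`.
In the exponents `i + 1` is used instead of `i - 1`; the two have the same parity. -/
structure IsHomGerstenhaber (𝒜 : ℕ → Submodule R B) (br : B →ₗ[R] B →ₗ[R] B) (α : B →ₐ[R] B) :
    Prop extends IsGradedCommutativeAlgebra 𝒜 where
  map_mem : ∀ (i : ℕ), ∀ a ∈ 𝒜 i, α a ∈ 𝒜 i
  bracket_mem : ∀ (i j k : ℕ), i + j = k + 1 → ∀ a ∈ 𝒜 i, ∀ b ∈ 𝒜 j, br a b ∈ 𝒜 k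
  bracket_zero_zero : ∀ a ∈ 𝒜 0, ∀ b ∈ 𝒜 0, br a b = 0
  bracket_skew : ∀ (i j : ℕ), ∀ a ∈ 𝒜 i, ∀ b ∈ 𝒜 j,
    br a b = -((-1 : R) ^ ((i + 1) * (j + 1)) • br b a)
  map_bracket : ∀ a b, α (br a b) = br (α a) (α b)
  jacobi : ∀ (i j k : ℕ), ∀ a ∈ 𝒜 i, ∀ b ∈ 𝒜 j, ∀ c ∈ 𝒜 k,
    (-1 : R) ^ ((i + 1) * (k + 1)) • br (α a) (br b c)
      + (-1 : R) ^ ((j + 1) * (i + 1)) • br (α b) (br c a)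
      + (-1 : R) ^ ((k + 1) * (j + 1)) • br (α c) (br a b) = 0
  leibniz : ∀ (i j k : ℕ), ∀ a ∈ 𝒜 i, ∀ b ∈ 𝒜 j, ∀ c ∈ 𝒜 k,
    br a (b * c) = br a b * α c + (-1 : R) ^ ((i + 1) * j) • (α b * br a c)

/-- Differential hom-Gerstenhaber algebra: `d` has degree `1`, squares to zero, commutes with `α`
and is an `(α, α)`-derivation of the product. -/
structure IsDifferentialHomGerstenhaber (𝒜 : ℕ → Submodule R B) (br : B →ₗ[R] B →ₗ[R] B)
    (α : B →ₐ[R] B) (d : B →ₗ[R] B) : Prop extends IsHomGerstenhaber 𝒜 br α where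
  d_mem : ∀ (i : ℕ), ∀ a ∈ 𝒜 i, d a ∈ 𝒜 (i + 1)
  d_mul : ∀ (i j : ℕ), ∀ a ∈ 𝒜 i, ∀ b ∈ 𝒜 j, d (a * b) = d a * α b + (-1 : R) ^ i • (α a * d b)
  d_d : ∀ a, d (d a) = 0
  d_map : ∀ a, d (α a) = α (d a)

/-- Strong differential hom-Gerstenhaber algebra: `d` is moreover a degree `1` derivation of the
graded bracket, `d[a, b] = [da, α b] + (-1) ^ (|a| - 1) [α a, db]`. -/
structure IsStrongDifferentialHomGerstenhaber (𝒜 : ℕ → Submodule R B) (br : B →ₗ[R] B →ₗ[R] B)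
    (α : B →ₐ[R] B) (d : B →ₗ[R] B) : Prop extends IsDifferentialHomGerstenhaber 𝒜 br α d where
  d_bracket : ∀ (i j : ℕ), ∀ a ∈ 𝒜 i, ∀ b ∈ 𝒜 j,
    d (br a b) = br (d a) (α b) + (-1 : R) ^ (i + 1) • br (α a) (d b)

end Graded

noncomputable section Bundles

variable (E : Type*) [NormedAddCommGroup E] [NormedSpace ℝ E]
  {M : Type*} [TopologicalSpace M] [ChartedSpace E M]
  (F : Type*) [NormedAddCommGroup F] [NormedSpace ℝ F]
  (A : M → Type*) [TopologicalSpace (TotalSpace F A)]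
  [∀ x, AddCommGroup (A x)] [∀ x, Module ℝ (A x)] [∀ x, TopologicalSpace (A x)]
  [FiberBundle F A] [VectorBundle ℝ F A]

/-- A field of multivectors `x ↦ s x ∈ Λ (A x)` is smooth if, in every trivialization of the
vector bundle, all its coordinates are smooth functions. -/
def IsSmoothMultisection (s : ∀ x, ExteriorAlgebra ℝ (A x)) : Prop :=
  ∀ (e : Trivialization F (π F A)) [MemTrivializationAtlas e] (l : ExteriorAlgebra ℝ F →ₗ[ℝ] ℝ),
    ContMDiffOn 𝓘(ℝ, E) 𝓘(ℝ, ℝ) ∞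
      (fun x => l (ExteriorAlgebra.map (e.linearMapAt ℝ x) (s x))) e.baseSet

variable {E F A}

theorem IsSmoothMultisection.add {s t : ∀ x, ExteriorAlgebra ℝ (A x)}
    (hs : IsSmoothMultisection E F A s) (ht : IsSmoothMultisection E F A t) :
    IsSmoothMultisection E F A (s + t) := by
  intro e _ l
  simp only [Pi.add_apply, map_add]
  exact (hs e l).add (ht e l)

theorem isSmoothMultisection_const (r : ℝ) :
    IsSmoothMultisection E F A (fun _ => algebraMap ℝ _ r) := by
  intro e _ l
  simp only [AlgHom.commutes]
  exact contMDiffOn_const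

theorem IsSmoothMultisection.mul [FiniteDimensional ℝ F] {s t : ∀ x, ExteriorAlgebra ℝ (A x)}
    (hs : IsSmoothMultisection E F A s) (ht : IsSmoothMultisection E F A t) :
    IsSmoothMultisection E F A (s * t) := by
  intro e _ l
  let b := (Module.finBasis ℝ F).ExteriorAlgebra
  have key : ∀ u v : ExteriorAlgebra ℝ F,
      l (u * v) = ∑ i, ∑ j, b.coord i u * b.coord j v * l (b i * b j) := by
    intro u v
    conv_lhs => rw [← b.sum_repr u, ← b.sum_repr v]
    simp only [Finset.sum_mul_sum, map_sum, smul_mul_smul_comm, map_smul, smul_eq_mul,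
      Module.Basis.coord_apply]
  have : (fun x => l (ExteriorAlgebra.map (e.linearMapAt ℝ x) ((s * t) x))) = fun x =>
      ∑ i, ∑ j, b.coord i (ExteriorAlgebra.map (e.linearMapAt ℝ x) (s x))
        * b.coord j (ExteriorAlgebra.map (e.linearMapAt ℝ x) (t x)) * l (b i * b j) := by
    funext x
    rw [Pi.mul_apply, map_mul, key]
  rw [this]
  refine contMDiffOn_finsetSum fun i _ => contMDiffOn_finsetSum fun j _ => ?_
  exact ((hs e (b.coord i)).mul (ht e (b.coord j))).mul contMDiffOn_const

variable (E F A) in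
/-- The algebra `⨁ i, Γ(Λ^i A) = Γ(Λ A)` of smooth multisections with the pointwise wedge product. -/
def Multisection [FiniteDimensional ℝ F] : Subalgebra ℝ (∀ x, ExteriorAlgebra ℝ (A x)) where
  carrier := {s | IsSmoothMultisection E F A s}
  mul_mem' := IsSmoothMultisection.mul
  add_mem' := IsSmoothMultisection.add
  algebraMap_mem' := isSmoothMultisection_const

variable (E F A) in
/-- The subspace `Γ(Λ^i A)`. -/
def Multisection.degree [FiniteDimensional ℝ F] (i : ℕ) : Submodule ℝ (Multisection E F A) where
  carrier := {s | ∀ x, s.1 x ∈ ⋀[ℝ]^i (A x)}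
  add_mem' hs ht x := add_mem (hs x) (ht x)
  zero_mem' _ := zero_mem _
  smul_mem' r _ hs x := Submodule.smul_mem _ r (hs x)

/-- Smooth functions as multisections of degree `0`. -/
def Multisection.ofFun [FiniteDimensional ℝ F] (f : C^∞⟮𝓘(ℝ, E), M; ℝ⟯) : Multisection E F A :=
  ⟨fun x => algebraMap ℝ _ (f x), by
    intro e _ l
    have : (fun x => l (ExteriorAlgebra.map (e.linearMapAt ℝ x) (algebraMap ℝ _ (f x)))) =
        fun x => f x * l 1 := by
      funext x
      rw [AlgHom.commutes, Algebra.algebraMap_eq_smul_one, map_smul, smul_eq_mul]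
    rw [this]
    exact f.contMDiff.contMDiffOn.mul contMDiffOn_const⟩

/-- Sections of the bundle as multisections of degree `1`. -/
def Multisection.ofSection [FiniteDimensional ℝ F] [IsManifold 𝓘(ℝ, E) ∞ M]
    [ContMDiffVectorBundle ∞ F A 𝓘(ℝ, E)] (X : Cₛ^∞⟮𝓘(ℝ, E); F, A⟯) : Multisection E F A :=
  ⟨fun x => ExteriorAlgebra.ι ℝ (X x), by
    intro e _ l
    have h := (e.contMDiffOn_section_baseSet_iff (IB := 𝓘(ℝ, E)) (n := ∞)).1
      X.contMDiff.contMDiffOn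
    let l' : F →L[ℝ] ℝ := LinearMap.toContinuousLinearMap (l ∘ₗ ExteriorAlgebra.ι ℝ)
    have h2 : ContMDiffOn 𝓘(ℝ, E) 𝓘(ℝ, ℝ) ∞ (fun x => l' (e (TotalSpace.mk' F x (X x))).2)
        e.baseSet := l'.contMDiff.comp_contMDiffOn h
    refine h2.congr fun x hx => ?_
    simp only [ExteriorAlgebra.map_apply_ι]
    rw [e.linearMapAt_apply, if_pos hx]
    rfl⟩


variable [IsManifold 𝓘(ℝ, E) ∞ M] [ContMDiffVectorBundle ∞ F A 𝓘(ℝ, E)]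

/-- The section `f X`. -/
def fsmul (f : C^∞⟮𝓘(ℝ, E), M; ℝ⟯) (X : Cₛ^∞⟮𝓘(ℝ, E); F, A⟯) : Cₛ^∞⟮𝓘(ℝ, E); F, A⟯ :=
  ⟨fun x => f x • X x, f.contMDiff.smul_section X.contMDiff⟩

variable (E F A) in
/-- An invertible hom-bundle `(A, ψ, β)`. -/
structure InvertibleHomBundle where
  /-- the diffeomorphism of the base -/
  ψ : M ≃ₘ⟮𝓘(ℝ, E), 𝓘(ℝ, E)⟯ M
  /-- the bijective linear map of sections -/
  β : Cₛ^∞⟮𝓘(ℝ, E); F, A⟯ ≃ₗ[ℝ] Cₛ^∞⟮𝓘(ℝ, E); F, A⟯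
  map_fsmul : ∀ (f : C^∞⟮𝓘(ℝ, E), M; ℝ⟯) (X : Cₛ^∞⟮𝓘(ℝ, E); F, A⟯),
    β (fsmul f X) = fsmul (f.comp (ψ : C^∞⟮𝓘(ℝ, E), M; 𝓘(ℝ, E), M⟯)) (β X)

section Transpose

variable [FiniteDimensional ℝ E] [T2Space M] [FiniteDimensional ℝ F]

/-- Near any point there is a local frame made of global sections. -/
theorem exists_global_frame (x₀ : M) :
    ∃ S : Fin (Module.finrank ℝ F) → Cₛ^∞⟮𝓘(ℝ, E); F, A⟯,
      (∀ᶠ x in 𝓝 x₀, ∀ i, S i x =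
        (trivializationAt F A x₀).localFrame (Module.finBasis ℝ F) i x) ∧
      ∀ X : Cₛ^∞⟮𝓘(ℝ, E); F, A⟯, ∃ (h : C^∞⟮𝓘(ℝ, E), M; ℝ⟯)
        (c : Fin (Module.finrank ℝ F) → C^∞⟮𝓘(ℝ, E), M; ℝ⟯),
        h x₀ = 1 ∧ fsmul h X = ∑ i, fsmul (c i) (S i) ∧ (X x₀ = 0 → ∀ i, c i x₀ = 0) := by
  classical
  set e := trivializationAt F A x₀ with he
  set b := Module.finBasis ℝ F
  have hx₀ : x₀ ∈ e.baseSet := FiberBundle.mem_baseSet_trivializationAt F A x₀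
  obtain ⟨χ, -, hχ⟩ := (SmoothBumpFunction.nhds_basis_tsupport (I := 𝓘(ℝ, E)) x₀).mem_iff.1
    (e.open_baseSet.mem_nhds hx₀)
  have hχs : ContMDiff 𝓘(ℝ, E) 𝓘(ℝ, ℝ) ∞ χ := χ.contMDiff
  let S : Fin (Module.finrank ℝ F) → Cₛ^∞⟮𝓘(ℝ, E); F, A⟯ := fun i =>
    ⟨fun x => χ x • e.localFrame b i x,
      ContMDiffOn.smul_section_of_tsupport hχs.contMDiffOn e.open_baseSet hχ
        (e.contMDiffOn_localFrame_baseSet ∞ b i)⟩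
  refine ⟨S, ?_, fun X => ?_⟩
  · filter_upwards [χ.eventuallyEq_one] with x hx i
    change χ x • e.localFrame b i x = e.localFrame b i x
    rw [hx, Pi.one_apply, one_smul]
  · let c : Fin (Module.finrank ℝ F) → C^∞⟮𝓘(ℝ, E), M; ℝ⟯ := fun i =>
      ⟨fun x => χ x • e.localFrameCoeff 𝓘(ℝ, E) b i x (X x), by
        refine contMDiff_of_tsupport fun x hx => ?_
        have hx' : x ∈ e.baseSet := hχ (closure_mono (Function.support_smul_subset_left _ _) hx)
        exact hχs.contMDiffAt.smul
          (contMDiffAt_localFrameCoeff b hx' X.contMDiff.contMDiffAt i)⟩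
    refine ⟨⟨fun x => χ x * χ x, hχs.mul hχs⟩, c, ?_, ?_, ?_⟩
    · change χ x₀ * χ x₀ = 1
      simp
    · ext x
      have hsum : ∀ (T : Fin (Module.finrank ℝ F) → Cₛ^∞⟮𝓘(ℝ, E); F, A⟯),
          (∑ i, T i) x = ∑ i, T i x := by
        intro T
        have := congrFun (map_sum (ContMDiffSection.coeAddHom 𝓘(ℝ, E) F ∞ A) T Finset.univ) x
        simpa only [Finset.sum_apply, ContMDiffSection.coeAddHom_apply] using this
      rw [hsum]
      change (χ x * χ x) • X x = ∑ i, (χ x • e.localFrameCoeff 𝓘(ℝ, E) b i x (X x)) •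
        χ x • e.localFrame b i x
      by_cases hx : x ∈ e.baseSet
      · conv_lhs => rw [Bundle.Trivialization.eq_sum_localFrameCoeff_smul (I := 𝓘(ℝ, E)) (b := b)
          (s := fun x => X x) hx]
        rw [Finset.smul_sum]
        refine Finset.sum_congr rfl fun i _ => ?_
        rw [smul_smul, smul_smul, smul_eq_mul]
        congr 1
        ring
      · have : χ x = 0 := image_eq_zero_of_notMem_tsupport fun h => hx (hχ h)
        simp [this]
    · intro h0 i
      change χ x₀ • e.localFrameCoeff 𝓘(ℝ, E) b i x₀ (X x₀) = 0
      rw [h0, map_zero, smul_zero]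

/-- A semilinear map of sections is pointwise. -/
theorem eq_zero_of_semilinear (ψ : M ≃ₘ⟮𝓘(ℝ, E), 𝓘(ℝ, E)⟯ M)
    (γ : Cₛ^∞⟮𝓘(ℝ, E); F, A⟯ →ₗ[ℝ] Cₛ^∞⟮𝓘(ℝ, E); F, A⟯)
    (hγ : ∀ (f : C^∞⟮𝓘(ℝ, E), M; ℝ⟯) (X : Cₛ^∞⟮𝓘(ℝ, E); F, A⟯) (x : M),
      γ (fsmul f X) (ψ x) = f x • γ X (ψ x))
    (X : Cₛ^∞⟮𝓘(ℝ, E); F, A⟯) (x : M) (hX : X x = 0) : γ X (ψ x) = 0 := by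
  obtain ⟨S, -, hS⟩ := exists_global_frame (F := F) (A := A) (E := E) x
  obtain ⟨h, c, h1, hc, h0⟩ := hS X
  have hsum : ∀ (T : Fin (Module.finrank ℝ F) → Cₛ^∞⟮𝓘(ℝ, E); F, A⟯) (y : M),
      (∑ i, T i) y = ∑ i, T i y := by
    intro T y
    have := congrFun (map_sum (ContMDiffSection.coeAddHom 𝓘(ℝ, E) F ∞ A) T Finset.univ) y
    simpa only [Finset.sum_apply, ContMDiffSection.coeAddHom_apply] using this
  have := congrArg (fun Y => γ Y (ψ x)) hc
  simp only [map_sum, hsum, hγ, h1, one_smul, h0 hX, zero_smul, Finset.sum_const_zero] at this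
  exact this

/-- Every vector is the value of a section. -/
theorem exists_section (x : M) (v : A x) : ∃ X : Cₛ^∞⟮𝓘(ℝ, E); F, A⟯, X x = v := by
  obtain ⟨S, hS, -⟩ := exists_global_frame (F := F) (A := A) (E := E) x
  have hx : x ∈ (trivializationAt F A x).baseSet :=
    FiberBundle.mem_baseSet_trivializationAt F A x
  refine ⟨∑ i, ((trivializationAt F A x).basisAt (Module.finBasis ℝ F) hx).repr v i • S i, ?_⟩
  have := congrFun (map_sum (ContMDiffSection.coeAddHom 𝓘(ℝ, E) F ∞ A)
    (fun i => ((trivializationAt F A x).basisAt (Module.finBasis ℝ F) hx).repr v i • S i)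
    Finset.univ) x
  simp only [ContMDiffSection.coeAddHom_apply, Finset.sum_apply, ContMDiffSection.coe_smul,
    Pi.smul_apply] at this
  rw [this]
  simp only [hS.self_of_nhds, Bundle.Trivialization.localFrame_apply_of_mem_baseSet _ _ hx]
  exact Module.Basis.sum_repr _ v

variable [∀ x, IsTopologicalAddGroup (A x)] [∀ x, ContinuousSMul ℝ (A x)]

/-- The transpose `(Tξ)(X) (x) = ξ(γ X) (ψ x)` of a semilinear map `γ` of sections. -/
theorem exists_transpose (ψ : M ≃ₘ⟮𝓘(ℝ, E), 𝓘(ℝ, E)⟯ M)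
    (γ : Cₛ^∞⟮𝓘(ℝ, E); F, A⟯ →ₗ[ℝ] Cₛ^∞⟮𝓘(ℝ, E); F, A⟯)
    (hγ : ∀ (f : C^∞⟮𝓘(ℝ, E), M; ℝ⟯) (X : Cₛ^∞⟮𝓘(ℝ, E); F, A⟯) (x : M),
      γ (fsmul f X) (ψ x) = f x • γ X (ψ x))
    (ξ : Cₛ^∞⟮𝓘(ℝ, E); F →L[ℝ] ℝ, (fun x => A x →L[ℝ] ℝ)⟯) :
    ∃ η : Cₛ^∞⟮𝓘(ℝ, E); F →L[ℝ] ℝ, (fun x => A x →L[ℝ] ℝ)⟯,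
      ∀ (X : Cₛ^∞⟮𝓘(ℝ, E); F, A⟯) (x : M), η x (X x) = ξ (ψ x) (γ X (ψ x)) := by
  have hval : ∀ (X Y : Cₛ^∞⟮𝓘(ℝ, E); F, A⟯) (x : M), X x = Y x → γ X (ψ x) = γ Y (ψ x) := by
    intro X Y x h
    have := eq_zero_of_semilinear ψ γ hγ (X - Y) x (by simp [h])
    rwa [map_sub, ContMDiffSection.coe_sub, Pi.sub_apply, sub_eq_zero] at this
  choose s hs using fun (x : M) (v : A x) => exists_section (E := E) (F := F) x v
  let G : ∀ x, A x →ₗ[ℝ] ℝ := fun x =>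
    { toFun := fun v => ξ (ψ x) (γ (s x v) (ψ x))
      map_add' := fun v w => by
        have : γ (s x (v + w)) (ψ x) = γ (s x v + s x w) (ψ x) :=
          hval _ _ _ (by simp [hs])
        rw [this, map_add, ContMDiffSection.coe_add, Pi.add_apply, map_add]
      map_smul' := fun r v => by
        have : γ (s x (r • v)) (ψ x) = γ (r • s x v) (ψ x) := hval _ _ _ (by simp [hs])
        rw [this, map_smul, ContMDiffSection.coe_smul, Pi.smul_apply, map_smul]
        rfl }
  have hfin : ∀ x, FiniteDimensional ℝ (A x) := fun x =>
    VectorBundle.finiteDimensional ℝ F A x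
  have hT2 : ∀ x, T2Space (A x) := FiberBundle.t2Space F A
  let η : ∀ x, A x →L[ℝ] ℝ := fun x => LinearMap.toContinuousLinearMap (G x)
  have hη : ∀ (X : Cₛ^∞⟮𝓘(ℝ, E); F, A⟯) (x : M), η x (X x) = ξ (ψ x) (γ X (ψ x)) := by
    intro X x
    change ξ (ψ x) (γ (s x (X x)) (ψ x)) = _
    rw [hval (s x (X x)) X x (hs x _)]
  refine ⟨⟨η, fun x₀ => ?_⟩, hη⟩
  rw [contMDiffAt_hom_bundle]
  refine ⟨contMDiffAt_id, ?_⟩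
  obtain ⟨S, hS, -⟩ := exists_global_frame (F := F) (A := A) (E := E) x₀
  set e := trivializationAt F A x₀ with he
  let b := Module.finBasis ℝ F
  have hx₀ : x₀ ∈ e.baseSet := FiberBundle.mem_baseSet_trivializationAt F A x₀
  have hsm : ∀ i, ContMDiff 𝓘(ℝ, E) 𝓘(ℝ, ℝ) ∞ (fun x => ξ (ψ x) (γ (S i) (ψ x))) := by
    intro i x
    have h1 : ContMDiff 𝓘(ℝ, E) (𝓘(ℝ, E).prod 𝓘(ℝ, ℝ)) ∞
        (fun x => TotalSpace.mk' ℝ (E := fun _ : M => ℝ) x (ξ x (γ (S i) x))) :=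
      ContMDiff.clm_bundle_apply ξ.contMDiff (γ (S i)).contMDiff
    have h2 : ContMDiff 𝓘(ℝ, E) 𝓘(ℝ, ℝ) ∞ (fun x => ξ x (γ (S i) x)) := by
      intro x
      exact (contMDiffAt_section (F := ℝ) (E := fun _ : M => ℝ) x).1 (h1 x)
    exact (h2.comp ψ.contMDiff) x
  have hcoord : ∀ i, ContMDiff 𝓘(ℝ, E) 𝓘(ℝ, F →L[ℝ] ℝ) ∞ (fun x =>
      ξ (ψ x) (γ (S i) (ψ x)) • LinearMap.toContinuousLinearMap (b.coord i)) := fun i =>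
    (hsm i).smul contMDiff_const
  have hsum : ContMDiff 𝓘(ℝ, E) 𝓘(ℝ, F →L[ℝ] ℝ) ∞ (fun x => ∑ i,
      ξ (ψ x) (γ (S i) (ψ x)) • LinearMap.toContinuousLinearMap (b.coord i)) :=
    contMDiff_finsetSum fun i _ => hcoord i
  refine hsum.contMDiffAt.congr_of_eventuallyEq ?_
  filter_upwards [hS, e.open_baseSet.mem_nhds hx₀] with x hx hxe
  refine ContinuousLinearMap.coe_inj.1 (b.ext fun j => ?_)
  have hSj : S j x = (e.continuousLinearEquivAt ℝ x hxe).symm (b j) := by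
    rw [hx j, Bundle.Trivialization.localFrame_apply_of_mem_baseSet _ _ hxe]
    simp [Bundle.Trivialization.basisAt]
    rfl
  have hL : (ContinuousLinearMap.inCoordinates F A ℝ (fun _ : M => ℝ) x₀ x x₀ x (η x)) (b j) =
      η x (S j x) := by
    rw [ContinuousLinearMap.inCoordinates_eq (by exact hxe) (by exact Set.mem_univ _), hSj]
    rfl
  have hR : (∑ i, ξ (ψ x) (γ (S i) (ψ x)) • LinearMap.toContinuousLinearMap (b.coord i)) (b j) =
      ξ (ψ x) (γ (S j) (ψ x)) := by
    simp [Finsupp.single_apply]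
  exact hL.trans ((hη (S j) x).trans hR.symm)

variable (ψ : M ≃ₘ⟮𝓘(ℝ, E), 𝓘(ℝ, E)⟯ M)
  (γ : Cₛ^∞⟮𝓘(ℝ, E); F, A⟯ →ₗ[ℝ] Cₛ^∞⟮𝓘(ℝ, E); F, A⟯)
  (hγ : ∀ (f : C^∞⟮𝓘(ℝ, E), M; ℝ⟯) (X : Cₛ^∞⟮𝓘(ℝ, E); F, A⟯) (x : M),
    γ (fsmul f X) (ψ x) = f x • γ X (ψ x))

/-- A section of the dual bundle is determined by its values on sections. -/
theorem dualSection_ext {ξ η : Cₛ^∞⟮𝓘(ℝ, E); F →L[ℝ] ℝ, (fun x => A x →L[ℝ] ℝ)⟯}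
    (h : ∀ (X : Cₛ^∞⟮𝓘(ℝ, E); F, A⟯) (x : M), ξ x (X x) = η x (X x)) : ξ = η := by
  ext x v
  obtain ⟨X, rfl⟩ := exists_section (E := E) (F := F) x v
  exact h X x

/-- The map `T` of sections of the dual bundle with `(T ξ)(X) = (ξ(γ X)) ∘ ψ`. -/
def transpose : Cₛ^∞⟮𝓘(ℝ, E); F →L[ℝ] ℝ, (fun x => A x →L[ℝ] ℝ)⟯ →ₗ[ℝ]
    Cₛ^∞⟮𝓘(ℝ, E); F →L[ℝ] ℝ, (fun x => A x →L[ℝ] ℝ)⟯ where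
  toFun ξ := (exists_transpose ψ γ hγ ξ).choose
  map_add' ξ η := by
    refine dualSection_ext fun X x => ?_
    have h1 := (exists_transpose ψ γ hγ ξ).choose_spec X x
    have h2 := (exists_transpose ψ γ hγ η).choose_spec X x
    exact ((exists_transpose ψ γ hγ (ξ + η)).choose_spec X x).trans
      (congrArg₂ (· + ·) h1.symm h2.symm)
  map_smul' r ξ := by
    refine dualSection_ext fun X x => ?_
    have h1 := (exists_transpose ψ γ hγ ξ).choose_spec X x
    exact ((exists_transpose ψ γ hγ (r • ξ)).choose_spec X x).trans
      (congrArg (r * ·) h1.symm)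

theorem transpose_apply (ξ : Cₛ^∞⟮𝓘(ℝ, E); F →L[ℝ] ℝ, (fun x => A x →L[ℝ] ℝ)⟯)
    (X : Cₛ^∞⟮𝓘(ℝ, E); F, A⟯) (x : M) :
    transpose ψ γ hγ ξ x (X x) = ξ (ψ x) (γ X (ψ x)) :=
  (exists_transpose ψ γ hγ ξ).choose_spec X x

theorem InvertibleHomBundle.symm_fsmul (B : InvertibleHomBundle E F A)
    (f : C^∞⟮𝓘(ℝ, E), M; ℝ⟯) (X : Cₛ^∞⟮𝓘(ℝ, E); F, A⟯) (x : M) :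
    B.β.symm (fsmul f X) (B.ψ x) = f x • B.β.symm X (B.ψ x) := by
  have h : fsmul f X = B.β (fsmul (f.comp (B.ψ.symm : C^∞⟮𝓘(ℝ, E), M; 𝓘(ℝ, E), M⟯))
      (B.β.symm X)) := by
    rw [B.map_fsmul, LinearEquiv.apply_symm_apply]
    congr 1
    ext y
    exact congrArg f (B.ψ.symm_apply_apply y).symm
  rw [h, LinearEquiv.symm_apply_apply]
  change f (B.ψ.symm (B.ψ x)) • B.β.symm X (B.ψ x) = _
  rw [B.ψ.symm_apply_apply]

theorem InvertibleHomBundle.fsmul_symm (B : InvertibleHomBundle E F A)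
    (f : C^∞⟮𝓘(ℝ, E), M; ℝ⟯) (X : Cₛ^∞⟮𝓘(ℝ, E); F, A⟯) (x : M) :
    B.β (fsmul f X) (B.ψ.symm x) = f x • B.β X (B.ψ.symm x) := by
  rw [B.map_fsmul]
  change f (B.ψ (B.ψ.symm x)) • B.β X (B.ψ.symm x) = _
  rw [B.ψ.apply_symm_apply]

/-- The dual hom-bundle `(A*, ψ, β†)`, where `β†(ξ)(X) = ψ*(ξ(β⁻¹ X))`. -/
def InvertibleHomBundle.dual (B : InvertibleHomBundle E F A) :
    InvertibleHomBundle E (F →L[ℝ] ℝ) (fun x => A x →L[ℝ] ℝ) where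
  ψ := B.ψ
  β := LinearEquiv.ofLinearMap
    (transpose B.ψ B.β.symm.toLinearMap B.symm_fsmul)
    (transpose B.ψ.symm B.β.toLinearMap B.fsmul_symm)
    (by
      ext1 ξ
      refine dualSection_ext fun X x => ?_
      rw [LinearMap.comp_apply, LinearMap.id_apply, transpose_apply, LinearEquiv.coe_coe,
        transpose_apply, LinearEquiv.coe_coe, LinearEquiv.apply_symm_apply]
      exact congrArg (fun y => ξ y (X y)) (B.ψ.symm_apply_apply x))
    (by
      ext1 ξ
      refine dualSection_ext fun X x => ?_
      rw [LinearMap.comp_apply, LinearMap.id_apply, transpose_apply, LinearEquiv.coe_coe,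
        transpose_apply, LinearEquiv.coe_coe, LinearEquiv.symm_apply_apply]
      exact congrArg (fun y => ξ y (X y)) (B.ψ.apply_symm_apply x))
  map_fsmul f ξ := by
    refine dualSection_ext fun X x => ?_
    have h := transpose_apply B.ψ B.β.symm.toLinearMap B.symm_fsmul (fsmul f ξ) X x
    have h' := transpose_apply B.ψ B.β.symm.toLinearMap B.symm_fsmul ξ X x
    refine h.trans ?_
    exact congrArg (f (B.ψ x) * ·) h'.symm

theorem InvertibleHomBundle.dual_apply (B : InvertibleHomBundle E F A)
    (ξ : Cₛ^∞⟮𝓘(ℝ, E); F →L[ℝ] ℝ, (fun x => A x →L[ℝ] ℝ)⟯) (X : Cₛ^∞⟮𝓘(ℝ, E); F, A⟯) (x : M) :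
    B.dual.β ξ x (X x) = ξ (B.ψ x) (B.β.symm X (B.ψ x)) :=
  transpose_apply B.ψ B.β.symm.toLinearMap B.symm_fsmul ξ X x

end Transpose

variable [∀ x, IsTopologicalAddGroup (A x)] [∀ x, ContinuousSMul ℝ (A x)]

/-- `ρ(X)[f] (x) = ⟨d f (ψ x), ρ_x (X (ψ x))⟩` for `ρ_x : (ψ^! A)_x = A (ψ x) → (ψ^! TM)_x`. -/
def anchorDeriv {ψ : M → M} (ρ : ∀ x, A (ψ x) →L[ℝ] TangentSpace 𝓘(ℝ, E) (ψ x))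
    (X : Cₛ^∞⟮𝓘(ℝ, E); F, A⟯) (f : M → ℝ) : M → ℝ :=
  fun x => mfderiv 𝓘(ℝ, E) 𝓘(ℝ, ℝ) f (ψ x) (ρ x (X (ψ x)))

/-- A (regular) hom-Lie algebroid structure on the invertible hom-bundle `(A, ψ, β)`. -/
@[ext]
structure HomLieAlgebroid (B : InvertibleHomBundle E F A) where
  /-- the bracket of sections -/
  bracket : Cₛ^∞⟮𝓘(ℝ, E); F, A⟯ →ₗ[ℝ] Cₛ^∞⟮𝓘(ℝ, E); F, A⟯ →ₗ[ℝ] Cₛ^∞⟮𝓘(ℝ, E); F, A⟯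
  /-- the anchor `ψ^! A → ψ^! TM` -/
  anchor : ∀ x, A (B.ψ x) →L[ℝ] TangentSpace 𝓘(ℝ, E) (B.ψ x)
  anchor_smooth : ContMDiff 𝓘(ℝ, E) (𝓘(ℝ, E).prod 𝓘(ℝ, F →L[ℝ] E)) ∞
    (fun x => TotalSpace.mk' (F →L[ℝ] E)
      (E := fun y : M => A y →L[ℝ] TangentSpace 𝓘(ℝ, E) y) (B.ψ x) (anchor x))
  bracket_skew : ∀ X Y, bracket X Y = -bracket Y X
  map_bracket : ∀ X Y, B.β (bracket X Y) = bracket (B.β X) (B.β Y)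
  jacobi : ∀ X Y Z, bracket (B.β X) (bracket Y Z) + bracket (B.β Y) (bracket Z X)
    + bracket (B.β Z) (bracket X Y) = 0
  leibniz : ∀ X (f : C^∞⟮𝓘(ℝ, E), M; ℝ⟯) Y x,
    bracket X (fsmul f Y) x = f (B.ψ x) • bracket X Y x + anchorDeriv anchor X f x • B.β Y x
  anchor_map : ∀ X (f : C^∞⟮𝓘(ℝ, E), M; ℝ⟯),
    anchorDeriv anchor (B.β X) (f ∘ B.ψ) = anchorDeriv anchor X f ∘ B.ψ
  anchor_bracket : ∀ X Y (f : C^∞⟮𝓘(ℝ, E), M; ℝ⟯),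
    anchorDeriv anchor (bracket X Y) (f ∘ B.ψ) =
      anchorDeriv anchor (B.β X) (anchorDeriv anchor Y f)
        - anchorDeriv anchor (B.β Y) (anchorDeriv anchor X f)

variable [FiniteDimensional ℝ F]

/-- `α` extends `ψ*` on functions and `β` on sections. -/
def InvertibleHomBundle.IsExtension (B : InvertibleHomBundle E F A)
    (α : Multisection E F A →ₐ[ℝ] Multisection E F A) : Prop :=
  (∀ f : C^∞⟮𝓘(ℝ, E), M; ℝ⟯, α (Multisection.ofFun f) =
    Multisection.ofFun (f.comp (B.ψ : C^∞⟮𝓘(ℝ, E), M; 𝓘(ℝ, E), M⟯))) ∧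
  (∀ X : Cₛ^∞⟮𝓘(ℝ, E); F, A⟯, α (Multisection.ofSection X) = Multisection.ofSection (B.β X))

/-- `(Γ(Λ A), br, α)` is the hom-Gerstenhaber algebra of the hom-Lie algebroid: `br` restricts to
the bracket on sections and to the anchor on sections and functions. -/
structure HomLieAlgebroid.IsInducedBracket {B : InvertibleHomBundle E F A} (L : HomLieAlgebroid B)
    (br : Multisection E F A →ₗ[ℝ] Multisection E F A →ₗ[ℝ] Multisection E F A)
    (α : Multisection E F A →ₐ[ℝ] Multisection E F A) : Prop where
  isExtension : B.IsExtension α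
  isHomGerstenhaber : IsHomGerstenhaber (Multisection.degree E F A) br α
  section_section : ∀ X Y, br (Multisection.ofSection X) (Multisection.ofSection Y) =
    Multisection.ofSection (L.bracket X Y)
  section_fun : ∀ X (f : C^∞⟮𝓘(ℝ, E), M; ℝ⟯) x,
    (br (Multisection.ofSection X) (Multisection.ofFun f)).1 x =
      algebraMap ℝ _ (anchorDeriv L.anchor X f x)

/-- The hom-Gerstenhaber bracket on multisections induced by a hom-Lie algebroid, i.e. the unique
one which extends its bracket and its anchor. -/
def HomLieAlgebroid.gerstenhaberBracket {B : InvertibleHomBundle E F A} (L : HomLieAlgebroid B) :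
    Multisection E F A →ₗ[ℝ] Multisection E F A →ₗ[ℝ] Multisection E F A :=
  Classical.epsilon fun br => ∃ α, L.IsInducedBracket br α

/-- The evaluation of (the degree `k` part of) a multivector on `k` covectors; it sends
`v₁ ∧ ⋯ ∧ v_k` to `det (ξ_j (v_i))`. -/
def evalMultivector {V : Type*} [AddCommGroup V] [Module ℝ V] {k : ℕ}
    (ξ : Fin k → Module.Dual ℝ V) : ExteriorAlgebra ℝ V →ₗ[ℝ] ℝ :=
  ExteriorAlgebra.liftAlternating (Pi.single k
    ((exteriorPower.alternatingMapToDual ℝ V k ξ).compAlternatingMap (exteriorPower.ιMulti ℝ k)))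

/-- The function `s(ξ₁, …, ξ_k)` for a multisection `s` of `A` and sections `ξ_i` of `A*`. -/
def evalSections (s : Multisection E F A) {k : ℕ}
    (ξ : Fin k → Cₛ^∞⟮𝓘(ℝ, E); F →L[ℝ] ℝ, (fun x => A x →L[ℝ] ℝ)⟯) : M → ℝ :=
  fun x => evalMultivector (fun i => (ξ i x : A x →ₗ[ℝ] ℝ)) (s.1 x)

variable [FiniteDimensional ℝ E] [T2Space M]

/-- `d` is the coboundary operator, with trivial coefficients, of a hom-Lie algebroid structure on
`(A*, ψ, β†)`, acting on `⨁ k, Γ(Λ^k A) = ⨁ k, Γ(Λ^k (A*)*)`: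
`(d s)(ξ₁, …, ξ_{k+1}) = ∑ i, (-1)^{i+1} ρ(η_i)[s(η₁, …, η̂_i, …, η_{k+1})]
  + ∑ i < j, (-1)^{i+j} ψ*(s(β†⁻²[ξ_i, ξ_j], η₁, …, η̂_i, …, η̂_j, …, η_{k+1}))`
with `η_i = β†⁻¹ ξ_i`. The second sum is empty for `k = 0`. -/
structure HomLieAlgebroid.IsCoboundary {B : InvertibleHomBundle E F A}
    (L : HomLieAlgebroid B.dual) (d : Multisection E F A →ₗ[ℝ] Multisection E F A) : Prop where
  map_mem : ∀ (k : ℕ), ∀ s ∈ Multisection.degree E F A k, d s ∈ Multisection.degree E F A (k + 1)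
  eval_zero : ∀ s ∈ Multisection.degree E F A 0,
    ∀ ξ : Fin 1 → Cₛ^∞⟮𝓘(ℝ, E); F →L[ℝ] ℝ, (fun x => A x →L[ℝ] ℝ)⟯,
    evalSections (d s) ξ = anchorDeriv L.anchor (B.dual.β.symm (ξ 0)) (evalSections s Fin.elim0)
  eval_succ : ∀ (k : ℕ), ∀ s ∈ Multisection.degree E F A (k + 1),
    ∀ (ξ η : Fin (k + 2) → Cₛ^∞⟮𝓘(ℝ, E); F →L[ℝ] ℝ, (fun x => A x →L[ℝ] ℝ)⟯),
    (∀ i, η i = B.dual.β.symm (ξ i)) → ∀ x,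
    evalSections (d s) ξ x =
      ∑ i : Fin (k + 2), (-1 : ℝ) ^ (i : ℕ) *
        anchorDeriv L.anchor (η i) (evalSections s (i.removeNth η)) x
      + ∑ j : Fin (k + 2), ∑ i : Fin (k + 1), if i.castSucc < j then
          (-1 : ℝ) ^ ((i : ℕ) + (j : ℕ)) *
            evalSections s (Fin.cons (B.dual.β.symm (B.dual.β.symm (L.bracket (ξ i.castSucc) (ξ j))))
              (i.removeNth (j.removeNth η))) (B.ψ x)
        else 0

/-- The coboundary operator `d_*` on multisections of `A` of a hom-Lie algebroid structure on `A*`,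
i.e. the unique linear map given by the formula in `IsCoboundary`. -/
def HomLieAlgebroid.coboundary {B : InvertibleHomBundle E F A} (L : HomLieAlgebroid B.dual) :
    Multisection E F A →ₗ[ℝ] Multisection E F A :=
  Classical.epsilon fun d => L.IsCoboundary d

/-- A hom-Lie bialgebroid structure on `(A, A*)` over the invertible hom-bundle `(A, ψ, β)`. -/
@[ext]
structure HomLieBialgebroid (B : InvertibleHomBundle E F A) where
  /-- the hom-Lie algebroid `(A, ψ, [-,-], ρ, β)` -/
  primal : HomLieAlgebroid B
  /-- the hom-Lie algebroid `(A*, ψ, [-,-]_*, ρ_*, β†)` -/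
  dual : HomLieAlgebroid B.dual
  compat : ∀ X Y, dual.coboundary (Multisection.ofSection (primal.bracket X Y)) =
    primal.gerstenhaberBracket (dual.coboundary (Multisection.ofSection X))
      (Multisection.ofSection (B.β Y))
    + primal.gerstenhaberBracket (Multisection.ofSection (B.β X))
      (dual.coboundary (Multisection.ofSection Y))

variable (E F A) in
/-- The operations `([-,-], α, d)` of a tuple `(⨁ i, Γ(Λ^i A), ∧, [-,-], α, d)`. -/
@[ext]
structure Tuple where
  /-- the bracket -/
  bracket : Multisection E F A →ₗ[ℝ] Multisection E F A →ₗ[ℝ] Multisection E F A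
  /-- the twist -/
  α : Multisection E F A →ₐ[ℝ] Multisection E F A
  /-- the differential -/
  d : Multisection E F A →ₗ[ℝ] Multisection E F A

/-- The tuple is a differential regular hom-Gerstenhaber algebra. -/
def Tuple.IsDifferentialRegular (T : Tuple E F A) : Prop :=
  IsDifferentialHomGerstenhaber (Multisection.degree E F A) T.bracket T.α T.d ∧
    Function.Bijective T.α

/-- The tuple is a strong differential regular hom-Gerstenhaber algebra. -/
def Tuple.IsStrongDifferentialRegular (T : Tuple E F A) : Prop :=
  IsStrongDifferentialHomGerstenhaber (Multisection.degree E F A) T.bracket T.α T.d ∧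
    Function.Bijective T.α

/-- The tuple is the one of the hom-Lie bialgebroid: its bracket is induced by the hom-Lie
algebroid on `A` and its differential is the coboundary operator of the one on `A*`. -/
def Tuple.IsInducedBy {B : InvertibleHomBundle E F A} (T : Tuple E F A)
    (L : HomLieBialgebroid B) : Prop :=
  L.primal.IsInducedBracket T.bracket T.α ∧ L.dual.IsCoboundary T.d

end Bundles

end HomBundles

/-! Regularity reduces the theorem to the untwisted case α = id. The pair (ψ*, β) extends to exactly
one automorphism `B.ext` of Γ(ΛA). Composing with its inverse turns a regular hom-Gerstenhaber
algebra into an ordinary Gerstenhaber algebra with bracket α⁻¹[-,-] and differential α⁻¹d, both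
commuting with α; composing with α goes back (`IsStrongDifferentialHomGerstenhaber.twist`). In the
same way a hom-Lie algebroid on (A, ψ, β) amounts to a Lie-Rinehart structure on (C^∞(M), ΓA), with
bracket β⁻¹[-,-]_A and action (ψ*)⁻¹ρ(X), invariant under (ψ*, β) (`HomLieAlgebroid.lieRinehart`,
`HomLieAlgebroid.exists_of_lieRinehart`). The same applies to A* with β†.

What remains is classical. Gerstenhaber brackets on Γ(ΛA) correspond to Lie-Rinehart structures on
ΓA through the Schouten bracket (`exists_isSchouten`, `exists_lieRinehart`). Derivations of degree 1
and square zero correspond to Lie-Rinehart structures on ΓA* through Cartan calculus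
(`exists_isDifferential`, `exists_lieRinehart_dual`), and the Chevalley-Eilenberg formula `contr_d`,
twisted by α, is the formula for d_*. Both rest on one principle: a graded derivation of Γ(ΛA) is
determined by its values on functions and sections, and these may be prescribed subject to the
Leibniz rule. `ExteriorCalculus` collects this principle with the properties of contractions, and
the algebra is carried out there.

For the bialgebroid condition, put Δ_a = [d, ad a] - ad(da). It is a graded derivation, and Δ_a b is
graded skew in a and b. The condition says Δ_X Y = 0 for sections. Applied to fY it yields Δ_X(f) ∧
Y = 0 for every Y, hence Δ_X(f) = 0 in rank at least two. By skewness Δ_f(X) = 0, and the same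
device gives Δ_f(g) = 0; so Δ vanishes on generators and therefore identically
(`strongDefect_eq_zero`). In rank zero there is nothing in degree one. In rank one the product of
two sections is always zero and the argument gives no information, so this implication excludes that
rank; the converse, the two uniqueness statements and the weaker differential structure need no
restriction.

The geometric input is small. Bump functions give global sections S_i of A and T_i of A* with ∑ ⟨X,
T_i⟩ S_i = hX and h = 1 at a given point. Euler's formula ∑ S_i ∧ ι_{T_i} s = k h s, in degree k,
then permits induction on the degree, and it yields the uniqueness and existence of derivations, the
gluing of multivectors from their contractions, and the extension of (ψ*, β). The anchor is
recovered from its action on functions because derivations at a point are tangent vectors, by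
Hadamard's lemma. -/

namespace HomBundles

/-! ### Graded derivations and their commutators -/

section GradedDerivations

theorem neg_one_pow_eq_ite (n : ℕ) : (-1 : ℝ) ^ n = if Even n then 1 else -1 := by
  split_ifs with h
  · exact h.neg_one_pow
  · exact (Nat.not_even_iff_odd.1 h).neg_one_pow

variable {B : Type*} [Ring B] [Algebra ℝ B] {𝒜 : ℕ → Submodule ℝ B}

/-- Graded derivations of degree `n - 1`. -/
structure IsGradedDerivation (𝒜 : ℕ → Submodule ℝ B) (n : ℕ) (δ : B →ₗ[ℝ] B) : Prop where
  mem : ∀ i k, i + n = k + 1 → ∀ a ∈ 𝒜 i, δ a ∈ 𝒜 k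
  zero : n = 0 → ∀ a ∈ 𝒜 0, δ a = 0
  leibniz : ∀ i, ∀ a ∈ 𝒜 i, ∀ b, δ (a * b) = δ a * b + (-1 : ℝ) ^ ((n + 1) * i) • (a * δ b)

theorem IsGradedCommutativeAlgebra.linearMap_ext (h𝒜 : IsGradedCommutativeAlgebra 𝒜) {V : Type*}
    [AddCommGroup V] [Module ℝ V] {f g : B →ₗ[ℝ] V} (h : ∀ i, ∀ a ∈ 𝒜 i, f a = g a) : f = g := by
  ext a
  have ha : a ∈ ⨆ i, 𝒜 i := by
    rw [h𝒜.isInternal.submodule_iSup_eq_top]; trivial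
  induction ha using Submodule.iSup_induction' with
  | mem i x hx => exact h i x hx
  | zero => simp
  | add x y _ _ hx hy => rw [map_add, map_add, hx, hy]

theorem IsGradedCommutativeAlgebra.mul_mem (h𝒜 : IsGradedCommutativeAlgebra 𝒜) {i j : ℕ} {a b : B}
    (ha : a ∈ 𝒜 i) (hb : b ∈ 𝒜 j) : a * b ∈ 𝒜 (i + j) :=
  h𝒜.gradedMonoid.mul_mem ha hb

theorem IsGradedCommutativeAlgebra.zero_comm (h𝒜 : IsGradedCommutativeAlgebra 𝒜) {a : B}
    (ha : a ∈ 𝒜 0) (b : B) : a * b = b * a := by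
  refine LinearMap.congr_fun (f := LinearMap.mulLeft ℝ a) (g := LinearMap.mulRight ℝ a)
    (h𝒜.linearMap_ext fun i b hb => ?_) b
  simpa using h𝒜.mul_comm 0 i a ha b hb

namespace IsGradedDerivation

variable {n : ℕ} {δ δ' : B →ₗ[ℝ] B}

/-- The target degree i + n - 1 is not a natural number when i = n = 0. This case is split off
wherever a derivation is applied twice. -/
theorem mem_deg_zero (h : IsGradedDerivation 𝒜 n δ) {i : ℕ} (hi : i + n = 0) {a : B}
    (ha : a ∈ 𝒜 i) : δ a = 0 := by
  obtain ⟨rfl, rfl⟩ : i = 0 ∧ n = 0 := by omega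
  exact h.zero rfl a ha

theorem add (h : IsGradedDerivation 𝒜 n δ) (h' : IsGradedDerivation 𝒜 n δ') :
    IsGradedDerivation 𝒜 n (δ + δ') where
  mem i k hk a ha := add_mem (h.mem i k hk a ha) (h'.mem i k hk a ha)
  zero hn a ha := by simp [h.zero hn a ha, h'.zero hn a ha]
  leibniz i a ha b := by
    simp only [LinearMap.add_apply, h.leibniz i a ha, h'.leibniz i a ha, add_mul, mul_add, smul_add]
    abel

theorem smul (h : IsGradedDerivation 𝒜 n δ) (r : ℝ) : IsGradedDerivation 𝒜 n (r • δ) where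
  mem i k hk a ha := Submodule.smul_mem _ _ (h.mem i k hk a ha)
  zero hn a ha := by simp [h.zero hn a ha]
  leibniz i a ha b := by
    simp only [LinearMap.smul_apply, h.leibniz i a ha, smul_add, smul_mul_assoc, mul_smul_comm]
    rw [smul_comm r]

theorem neg (h : IsGradedDerivation 𝒜 n δ) : IsGradedDerivation 𝒜 n (-δ) := by
  have h1 : (-1 : ℝ) • δ = -δ := by ext; simp
  exact h1 ▸ h.smul (-1)

theorem sub (h : IsGradedDerivation 𝒜 n δ) (h' : IsGradedDerivation 𝒜 n δ') :
    IsGradedDerivation 𝒜 n (δ - δ') := by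
  rw [sub_eq_add_neg]; exact h.add h'.neg

/-- The Leibniz rule for the graded commutator of graded derivations. -/
theorem commutator_leibniz {n₁ n₂ : ℕ} (h : IsGradedDerivation 𝒜 n₁ δ)
    (h' : IsGradedDerivation 𝒜 n₂ δ') (i : ℕ) (a : B) (ha : a ∈ 𝒜 i) (b : B) :
    (δ ∘ₗ δ' - (-1 : ℝ) ^ ((n₁ + 1) * (n₂ + 1)) • (δ' ∘ₗ δ)) (a * b) =
      (δ ∘ₗ δ' - (-1 : ℝ) ^ ((n₁ + 1) * (n₂ + 1)) • (δ' ∘ₗ δ)) a * b + (-1 : ℝ) ^ ((n₁ + n₂) * i) •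
        (a * (δ ∘ₗ δ' - (-1 : ℝ) ^ ((n₁ + 1) * (n₂ + 1)) • (δ' ∘ₗ δ)) b) := by
  -- Four terms of a composite on a product. In the graded commutator the two mixed ones cancel
  -- against those of the reversed composite.
  have hl : ∀ {m₁ m₂ : ℕ} {ε ε' : B →ₗ[ℝ] B}, IsGradedDerivation 𝒜 m₁ ε →
      IsGradedDerivation 𝒜 m₂ ε' → ε (ε' (a * b)) = ε (ε' a) * b +
        (-1 : ℝ) ^ ((m₁ + 1) * (i + m₂ + 1)) • (ε' a * ε b)
        + (-1 : ℝ) ^ ((m₂ + 1) * i) • (ε a * ε' b)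
        + (-1 : ℝ) ^ ((m₁ + m₂) * i) • (a * ε (ε' b)) := by
    intro m₁ m₂ ε ε' e e'
    have h1 : ε (ε' a * b) = ε (ε' a) * b +
        (-1 : ℝ) ^ ((m₁ + 1) * (i + m₂ + 1)) • (ε' a * ε b) := by
      -- Either ε' a = 0, or ε' a has degree i + m₂ - 1, of the same parity as i + m₂ + 1.
      rcases Nat.eq_zero_or_pos (i + m₂) with h0 | h0
      · simp [e'.mem_deg_zero h0 ha]
      · obtain ⟨k, hk⟩ : ∃ k, i + m₂ = k + 1 := ⟨i + m₂ - 1, by omega⟩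
        rw [e.leibniz k _ (e'.mem i k hk a ha), hk]
        congr 2
        simp only [neg_one_pow_eq_ite]
        simp [Nat.even_add, Nat.even_mul, parity_simps]
    rw [e'.leibniz i a ha, map_add, map_smul, h1, e.leibniz i a ha, smul_add, smul_smul, ← pow_add]
    have h3 : (-1 : ℝ) ^ ((m₁ + m₂) * i) = (-1) ^ ((m₂ + 1) * i + (m₁ + 1) * i) := by
      simp only [neg_one_pow_eq_ite, parity_simps]
      congr 1
      by_cases h1 : Even m₁ <;> by_cases h2 : Even m₂ <;> by_cases h3 : Even i <;> simp [*]
    rw [h3]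
    abel
  simp only [LinearMap.sub_apply, LinearMap.comp_apply, LinearMap.smul_apply, hl h h',
    hl h' h, sub_mul, mul_sub, smul_add, smul_sub, smul_mul_assoc,
    mul_smul_comm, smul_smul]
  simp only [neg_one_pow_eq_ite, parity_simps]
  by_cases h1 : Even n₁ <;> by_cases h2 : Even n₂ <;>
    by_cases h4 : Even i <;> simp [*] <;> abel

/-- The graded commutator of graded derivations. -/
theorem commutator {n₁ n₂ : ℕ} (hn : n₁ + n₂ = n + 1)
    (h : IsGradedDerivation 𝒜 n₁ δ) (h' : IsGradedDerivation 𝒜 n₂ δ') :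
    IsGradedDerivation 𝒜 n (δ ∘ₗ δ' - (-1 : ℝ) ^ ((n₁ + 1) * (n₂ + 1)) • (δ' ∘ₗ δ)) := by
  have hmem : ∀ {m₁ m₂ : ℕ} {ε ε' : B →ₗ[ℝ] B}, m₁ + m₂ = n + 1 → IsGradedDerivation 𝒜 m₁ ε →
      IsGradedDerivation 𝒜 m₂ ε' → ∀ i k, i + n = k + 1 → ∀ a ∈ 𝒜 i, ε (ε' a) ∈ 𝒜 k := by
    intro m₁ m₂ ε ε' hm e e' i k hk a ha
    rcases Nat.eq_zero_or_pos (i + m₂) with h0 | h0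
    · rw [e'.mem_deg_zero h0 ha, map_zero]; exact zero_mem _
    · exact e.mem (i + m₂ - 1) k (by omega) _ (e'.mem i (i + m₂ - 1) (by omega) a ha)
  have hzero : ∀ {m₁ m₂ : ℕ} {ε ε' : B →ₗ[ℝ] B}, m₁ + m₂ = n + 1 → IsGradedDerivation 𝒜 m₁ ε →
      IsGradedDerivation 𝒜 m₂ ε' → n = 0 → ∀ a ∈ 𝒜 0, ε (ε' a) = 0 := by
    intro m₁ m₂ ε ε' hm e e' h0 a ha
    rcases Nat.eq_zero_or_pos m₂ with h2 | h2
    · rw [e'.mem_deg_zero (by omega) ha, map_zero]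
    · exact e.mem_deg_zero (i := 0) (by omega) (e'.mem 0 0 (by omega) a ha)
  refine ⟨fun i k hk a ha => sub_mem (hmem hn h h' i k hk a ha)
      (Submodule.smul_mem _ _ (hmem (by omega) h' h i k hk a ha)), fun h0 a ha => ?_,
    fun i a ha b => ?_⟩
  · simp [hzero hn h h' h0 a ha, hzero (by omega) h' h h0 a ha]
  · rw [← hn]
    exact commutator_leibniz h h' i a ha b

/-- The product of a homogeneous element and a graded derivation. -/
theorem mul_left (h𝒜 : IsGradedCommutativeAlgebra 𝒜) {p m : ℕ} (hn : p + m = n) {a : B}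
    (ha : a ∈ 𝒜 p) (h : IsGradedDerivation 𝒜 m δ) :
    IsGradedDerivation 𝒜 n (LinearMap.mulLeft ℝ a ∘ₗ δ) where
  mem i k hk b hb := by
    rw [LinearMap.comp_apply, LinearMap.mulLeft_apply]
    rcases Nat.eq_zero_or_pos (i + m) with h0 | h0
    · rw [h.mem_deg_zero h0 hb, mul_zero]; exact zero_mem _
    · have := h𝒜.mul_mem ha (h.mem i (i + m - 1) (by omega) b hb)
      rwa [show p + (i + m - 1) = k by omega] at this
  zero h0 b hb := by simp [h.zero (by omega) b hb]
  leibniz i b hb c := by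
    have hs : (-1 : ℝ) ^ ((n + 1) * i) * (-1) ^ (i * p) = (-1) ^ ((m + 1) * i) := by
      subst hn
      simp only [neg_one_pow_eq_ite, parity_simps]
      by_cases h1 : Even p <;> by_cases h2 : Even m <;> by_cases h3 : Even i <;> simp [*]
    simp only [LinearMap.comp_apply, LinearMap.mulLeft_apply, h.leibniz i b hb, mul_add,
      mul_smul_comm]
    rw [← mul_assoc, ← mul_assoc b a, h𝒜.mul_comm i p b hb a ha, smul_mul_assoc, smul_smul, hs,
      mul_assoc, mul_assoc]

/-- The product of a graded derivation and a homogeneous element. -/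
theorem mul_right (h𝒜 : IsGradedCommutativeAlgebra 𝒜) {p : ℕ} {a : B}
    (ha : a ∈ 𝒜 p) (h : IsGradedDerivation 𝒜 n δ) {i k : ℕ} (hk : i + n = k + 1) {b : B}
    (hb : b ∈ 𝒜 i) : δ b * a = (-1 : ℝ) ^ (k * p) • (a * δ b) :=
  h𝒜.mul_comm k p _ (h.mem i k hk b hb) a ha

/-- Conjugation by an automorphism of the graded algebra. -/
theorem conj (h : IsGradedDerivation 𝒜 n δ) (α : B ≃ₐ[ℝ] B) (hα : ∀ i, ∀ a ∈ 𝒜 i, α a ∈ 𝒜 i)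
    (hα' : ∀ i, ∀ a ∈ 𝒜 i, α.symm a ∈ 𝒜 i) :
    IsGradedDerivation 𝒜 n (α.symm.toLinearMap ∘ₗ δ ∘ₗ α.toLinearMap) where
  mem i k hk a ha := hα' _ _ (h.mem i k hk _ (hα _ _ ha))
  zero h0 a ha := by simp [h.zero h0 _ (hα _ _ ha)]
  leibniz i a ha b := by simp [h.leibniz i _ (hα _ _ ha)]

end IsGradedDerivation

end GradedDerivations

end HomBundles

namespace HomBundles

/-! ### Lie-Rinehart structures and the abstract exterior calculus -/

section Abstract

variable (C Γ Γ' B : Type*) [CommRing C] [Algebra ℝ C]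
  [AddCommGroup Γ] [Module ℝ Γ] [Module C Γ] [AddCommGroup Γ'] [Module ℝ Γ'] [Module C Γ']
  [Ring B] [Algebra ℝ B]

/-- A Lie-Rinehart structure on the `C`-module `Γ`. -/
@[ext]
structure LieRinehart where
  /-- the bracket -/
  br : Γ →ₗ[ℝ] Γ →ₗ[ℝ] Γ
  /-- the action on `C` by derivations -/
  D : Γ →ₗ[ℝ] C →ₗ[ℝ] C
  skew : ∀ X Y, br X Y = -br Y X
  jacobi : ∀ X Y Z, br X (br Y Z) + br Y (br Z X) + br Z (br X Y) = 0
  leibniz : ∀ X (f : C) Y, br X (f • Y) = f • br X Y + D X f • Y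
  D_mul : ∀ X f g, D X (f * g) = D X f * g + f * D X g
  D_smul : ∀ (f : C) X g, D (f • X) g = f * D X g
  D_br : ∀ X Y f, D (br X Y) f = D X (D Y f) - D Y (D X f)

/-- The calculus of the exterior algebra `B` of the `C`-module `Γ` with dual module `Γ'`. -/
structure ExteriorCalculus where
  /-- the homogeneous elements -/
  deg : ℕ → Submodule ℝ B
  /-- the inclusion of degree `0` -/
  j : C →ₐ[ℝ] B
  /-- the inclusion of degree `1` -/
  ι : Γ →ₗ[ℝ] B
  /-- the duality -/
  pair : Γ →ₗ[ℝ] Γ' →ₗ[ℝ] C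
  /-- the contractions -/
  I : Γ' →ₗ[ℝ] B →ₗ[ℝ] B
  gca : IsGradedCommutativeAlgebra deg
  j_injective : Function.Injective j
  ι_injective : Function.Injective ι
  mem_zero : ∀ a, a ∈ deg 0 ↔ ∃ f, j f = a
  mem_one : ∀ a, a ∈ deg 1 ↔ ∃ X, ι X = a
  ι_smul : ∀ (f : C) X, ι (f • X) = j f * ι X
  pair_smul_left : ∀ (f : C) X ξ, pair (f • X) ξ = f * pair X ξ
  pair_smul_right : ∀ (f : C) X ξ, pair X (f • ξ) = f * pair X ξ
  pair_ext : ∀ ξ η, (∀ X, pair X ξ = pair X η) → ξ = η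
  pair_rep : ∀ Φ : Γ →ₗ[ℝ] C, (∀ (f : C) X, Φ (f • X) = f * Φ X) → ∃ ξ, ∀ X, pair X ξ = Φ X
  I_der : ∀ ξ, IsGradedDerivation deg 0 (I ξ)
  I_ι : ∀ ξ X, I ξ (ι X) = j (pair X ξ)
  I_smul : ∀ (f : C) ξ s, I (f • ξ) s = j f * I ξ s
  I_I : ∀ ξ η s, I ξ (I η s) = -I η (I ξ s)
  sep : ∀ k, ∀ s ∈ deg (k + 1), (∀ ξ, I ξ s = 0) → s = 0
  -- Only the parity of p enters and δ need not be homogeneous. Thus the field applies to defects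
  -- such as `adDefect` when i = j = 0, where the degree would be negative.
  uniq : ∀ (p : ℕ) (δ : B →ₗ[ℝ] B),
    (∀ i, ∀ a ∈ deg i, ∀ b, δ (a * b) = δ a * b + (-1 : ℝ) ^ (p * i) • (a * δ b)) →
    (∀ f, δ (j f) = 0) → (∀ X, δ (ι X) = 0) → δ = 0
  exists_ext : ∀ (n : ℕ) (δ₀ : C →ₗ[ℝ] B) (δ₁ : Γ →ₗ[ℝ] B), (∀ k, n = k + 1 → ∀ f, δ₀ f ∈ deg k) →
    (n = 0 → δ₀ = 0) → (∀ X, δ₁ X ∈ deg n) →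
    (∀ f g, δ₀ (f * g) = δ₀ f * j g + j f * δ₀ g) →
    (∀ (f : C) X, δ₁ (f • X) = δ₀ f * ι X + j f * δ₁ X) →
    ∃ δ, IsGradedDerivation deg n δ ∧ (∀ f, δ (j f) = δ₀ f) ∧ (∀ X, δ (ι X) = δ₁ X)
  -- The last hypothesis polarizes to skew-symmetry of I ξ (Ω η), which is what contractions of a
  -- multivector satisfy.
  exists_rep : ∀ (k : ℕ) (Ω : Γ' →ₗ[ℝ] B), (∀ ξ, Ω ξ ∈ deg k) →
    (∀ (f : C) ξ, Ω (f • ξ) = j f * Ω ξ) → (∀ ξ, I ξ (Ω ξ) = 0) →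
    ∃ w ∈ deg (k + 1), ∀ ξ, I ξ w = Ω ξ

end Abstract

/-! ### Twisting Gerstenhaber algebras by a commuting endomorphism -/

section Twist

variable {R B : Type*} [CommRing R] [Ring B] [Algebra R B] {𝒜 : ℕ → Submodule R B}
  {br : B →ₗ[R] B →ₗ[R] B} {γ : B →ₐ[R] B} {d : B →ₗ[R] B}

/-- The bracket `α [a, b]`. -/
def twistBracket (br : B →ₗ[R] B →ₗ[R] B) (α : B →ₐ[R] B) : B →ₗ[R] B →ₗ[R] B :=
  br.compr₂ α.toLinearMap

@[simp]
theorem twistBracket_apply (br : B →ₗ[R] B →ₗ[R] B) (α : B →ₐ[R] B) (a b : B) :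
    twistBracket br α a b = α (br a b) := rfl

/-- Composing a hom-Gerstenhaber algebra with a commuting endomorphism. -/
theorem IsHomGerstenhaber.twist (h : IsHomGerstenhaber 𝒜 br γ) {α : B →ₐ[R] B}
    (hα : ∀ i, ∀ a ∈ 𝒜 i, α a ∈ 𝒜 i) (hαγ : ∀ a, α (γ a) = γ (α a))
    (hbr : ∀ a b, α (br a b) = br (α a) (α b)) :
    IsHomGerstenhaber 𝒜 (twistBracket br α) (α.comp γ) where
  toIsGradedCommutativeAlgebra := h.toIsGradedCommutativeAlgebra
  map_mem i a ha := hα i _ (h.map_mem i a ha)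
  bracket_mem i j k hk a ha b hb := hα k _ (h.bracket_mem i j k hk a ha b hb)
  bracket_zero_zero a ha b hb := by simp [h.bracket_zero_zero a ha b hb]
  bracket_skew i j a ha b hb := by
    rw [twistBracket_apply, h.bracket_skew i j a ha b hb]; simp
  map_bracket a b := by simp [hαγ, h.map_bracket, hbr]
  jacobi i j k a ha b hb c hc := by
    -- Each of the two nested twisted brackets contributes one α, and multiplicativity moves both to
    -- the front.
    have := congrArg (fun x => α (α x)) (h.jacobi i j k a ha b hb c hc)
    simpa [hbr, hαγ] using this
  leibniz i j k a ha b hb c hc := by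
    rw [twistBracket_apply, h.leibniz i j k a ha b hb c hc]; simp

theorem IsDifferentialHomGerstenhaber.twist (h : IsDifferentialHomGerstenhaber 𝒜 br γ d)
    {α : B →ₐ[R] B} (hα : ∀ i, ∀ a ∈ 𝒜 i, α a ∈ 𝒜 i) (hαγ : ∀ a, α (γ a) = γ (α a))
    (hbr : ∀ a b, α (br a b) = br (α a) (α b)) (hd : ∀ a, α (d a) = d (α a)) :
    IsDifferentialHomGerstenhaber 𝒜 (twistBracket br α) (α.comp γ) (α.toLinearMap ∘ₗ d) where
  toIsHomGerstenhaber := h.toIsHomGerstenhaber.twist hα hαγ hbr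
  d_mem i a ha := hα _ _ (h.d_mem i a ha)
  d_mul i j a ha b hb := by
    simp [h.d_mul i j a ha b hb]
  d_d a := by simp [← hd, h.d_d]
  d_map a := by simp [← hd, h.d_map, hαγ]

theorem IsStrongDifferentialHomGerstenhaber.twist
    (h : IsStrongDifferentialHomGerstenhaber 𝒜 br γ d)
    {α : B →ₐ[R] B} (hα : ∀ i, ∀ a ∈ 𝒜 i, α a ∈ 𝒜 i) (hαγ : ∀ a, α (γ a) = γ (α a))
    (hbr : ∀ a b, α (br a b) = br (α a) (α b)) (hd : ∀ a, α (d a) = d (α a)) :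
    IsStrongDifferentialHomGerstenhaber 𝒜 (twistBracket br α) (α.comp γ) (α.toLinearMap ∘ₗ d) where
  toIsDifferentialHomGerstenhaber := h.toIsDifferentialHomGerstenhaber.twist hα hαγ hbr hd
  d_bracket i j a ha b hb := by
    simp only [LinearMap.comp_apply, twistBracket_apply, AlgHom.toLinearMap_apply,
      AlgHom.comp_apply, ← hd]
    rw [h.d_bracket i j a ha b hb]
    simp [hbr]

end Twist

/-! ### The Schouten bracket of a Lie-Rinehart structure -/

section Schouten

variable {C Γ Γ' B : Type*} [CommRing C] [Algebra ℝ C]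
  [AddCommGroup Γ] [Module ℝ Γ] [Module C Γ] [AddCommGroup Γ'] [Module ℝ Γ'] [Module C Γ']
  [Ring B] [Algebra ℝ B] (S : ExteriorCalculus C Γ Γ' B)

namespace ExteriorCalculus

theorem j_mem (f : C) : S.j f ∈ S.deg 0 := (S.mem_zero _).2 ⟨f, rfl⟩

theorem ι_mem (X : Γ) : S.ι X ∈ S.deg 1 := (S.mem_one _).2 ⟨X, rfl⟩

theorem j_comm (f : C) (b : B) : S.j f * b = b * S.j f := S.gca.zero_comm (S.j_mem f) b

theorem derivation_ext {n : ℕ} {δ δ' : B →ₗ[ℝ] B} (h : IsGradedDerivation S.deg n δ)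
    (h' : IsGradedDerivation S.deg n δ') (h₀ : ∀ f, δ (S.j f) = δ' (S.j f))
    (h₁ : ∀ X, δ (S.ι X) = δ' (S.ι X)) : δ = δ' :=
  sub_eq_zero.1 (S.uniq (n + 1) _ (h.sub h').leibniz (fun f => by simp [h₀]) (fun X => by simp [h₁]))

theorem der_smul {n : ℕ} {δ : B →ₗ[ℝ] B} (h : IsGradedDerivation S.deg n δ) (f : C) (b : B) :
    δ (S.j f * b) = δ (S.j f) * b + S.j f * δ b := by
  simpa using h.leibniz 0 _ (S.j_mem f) b

end ExteriorCalculus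

/-- Data for the Schouten bracket of a Lie-Rinehart structure: the Gerstenhaber brackets on `B`
which extend it. -/
structure ExteriorCalculus.IsSchouten (ℓ : LieRinehart C Γ) (br : B →ₗ[ℝ] B →ₗ[ℝ] B) : Prop where
  gerstenhaber : IsHomGerstenhaber S.deg br (AlgHom.id ℝ B)
  ι_ι : ∀ X Y, br (S.ι X) (S.ι Y) = S.ι (ℓ.br X Y)
  ι_j : ∀ X f, br (S.ι X) (S.j f) = S.j (ℓ.D X f)

namespace IsHomGerstenhaber

variable {S} {br : B →ₗ[ℝ] B →ₗ[ℝ] B} (h : IsHomGerstenhaber S.deg br (AlgHom.id ℝ B))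

include h

theorem isGradedDerivation {i : ℕ} {a : B} (ha : a ∈ S.deg i) :
    IsGradedDerivation S.deg i (br a) where
  mem p k hk b hb := h.bracket_mem i p k (by omega) a ha b hb
  zero hi b hb := by subst hi; exact h.bracket_zero_zero a ha b hb
  leibniz p b hb c := by
    refine LinearMap.congr_fun (f := br a ∘ₗ LinearMap.mulLeft ℝ b)
      (g := LinearMap.mulLeft ℝ (br a b) + (-1 : ℝ) ^ ((i + 1) * p) • LinearMap.mulLeft ℝ b ∘ₗ br a)
      (S.gca.linearMap_ext fun q c hc => ?_) c
    simpa using h.leibniz i p q a ha b hb c hc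

end IsHomGerstenhaber

end Schouten

end HomBundles

namespace HomBundles

section Schouten

variable {C Γ Γ' B : Type*} [CommRing C] [Algebra ℝ C]
  [AddCommGroup Γ] [Module ℝ Γ] [Module C Γ] [AddCommGroup Γ'] [Module ℝ Γ'] [Module C Γ']
  [Ring B] [Algebra ℝ B] (S : ExteriorCalculus C Γ Γ' B)

namespace ExteriorCalculus

/-- A linear family of data extends to a linear family of graded derivations. -/
theorem exists_ext_linear {V : Type*} [AddCommGroup V] [Module ℝ V] (n : ℕ)
    (δ₀ : V →ₗ[ℝ] C →ₗ[ℝ] B) (δ₁ : V →ₗ[ℝ] Γ →ₗ[ℝ] B)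
    (h : ∀ v, (∀ k, n = k + 1 → ∀ f, δ₀ v f ∈ S.deg k) ∧ (n = 0 → δ₀ v = 0) ∧
      (∀ X, δ₁ v X ∈ S.deg n) ∧ (∀ f g, δ₀ v (f * g) = δ₀ v f * S.j g + S.j f * δ₀ v g) ∧
      (∀ (f : C) X, δ₁ v (f • X) = δ₀ v f * S.ι X + S.j f * δ₁ v X)) :
    ∃ Δ : V →ₗ[ℝ] B →ₗ[ℝ] B, ∀ v, IsGradedDerivation S.deg n (Δ v) ∧
      (∀ f, Δ v (S.j f) = δ₀ v f) ∧ (∀ X, Δ v (S.ι X) = δ₁ v X) := by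
  choose Δ hΔ h₀ h₁ using fun v => S.exists_ext n (δ₀ v) (δ₁ v) (h v).1 (h v).2.1 (h v).2.2.1
    (h v).2.2.2.1 (h v).2.2.2.2
  refine ⟨{ toFun := Δ, map_add' := fun v w => ?_, map_smul' := fun r v => ?_ },
    fun v => ⟨hΔ v, h₀ v, h₁ v⟩⟩
  · exact S.derivation_ext (hΔ _) ((hΔ v).add (hΔ w)) (fun f => by simp [h₀])
      (fun X => by simp [h₁])
  · exact S.derivation_ext (hΔ _) ((hΔ v).smul r) (fun f => by simp [h₀])
      (fun X => by simp [h₁])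

/-- The operators `[X, ·]` and `[f, ·]`. -/
theorem exists_lie (ℓ : LieRinehart C Γ) : ∃ (L : Γ →ₗ[ℝ] B →ₗ[ℝ] B) (K : C →ₗ[ℝ] B →ₗ[ℝ] B),
    (∀ X, IsGradedDerivation S.deg 1 (L X)) ∧ (∀ f, IsGradedDerivation S.deg 0 (K f)) ∧
    (∀ X f, L X (S.j f) = S.j (ℓ.D X f)) ∧ (∀ X Y, L X (S.ι Y) = S.ι (ℓ.br X Y)) ∧
    (∀ f g, K f (S.j g) = 0) ∧ (∀ f X, K f (S.ι X) = -S.j (ℓ.D X f)) := by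
  obtain ⟨L, hL⟩ := S.exists_ext_linear 1 (ℓ.D.compr₂ S.j.toLinearMap) (ℓ.br.compr₂ S.ι)
    (fun X => by
      refine ⟨fun k hk f => ?_, by simp, fun Y => S.ι_mem _, fun f g => ?_, fun f Y => ?_⟩
      · obtain rfl : k = 0 := by omega
        exact S.j_mem _
      · simp [ℓ.D_mul]
      · simp [ℓ.leibniz, S.ι_smul, add_comm])
  -- The operator [f, ·] is minus the contraction with the differential of f. It has degree -1 and
  -- so kills functions.
  obtain ⟨K, hK⟩ := S.exists_ext_linear (V := C) 0 0 (-(ℓ.D.compr₂ S.j.toLinearMap).flip)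
    (fun f => by
      refine ⟨by simp, by simp, fun Y => ?_, by simp, fun g Y => ?_⟩
      · simpa using S.j_mem _
      · simp [ℓ.D_smul])
  exact ⟨L, K, fun X => (hL X).1, fun f => (hK f).1, fun X => (hL X).2.1, fun X => (hL X).2.2,
    fun f g => by simpa using (hK f).2.1 g, fun f X => by simpa using (hK f).2.2 X⟩

/-- Skew-symmetry forces [b, ·] on generators: [b, f] = (-1)^q [f, b] and [b, X] = -[X, b], with the
right sides given by `exists_lie`. Such data extend to a derivation because the operators of
`exists_lie` satisfy K_{fg} = f K_g + g K_f and L_{fX} = f L_X + X K_f. The operators for the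
separate degrees of b are then assembled along the direct sum. -/
theorem exists_ad (ℓ : LieRinehart C Γ) : ∃ ad : B →ₗ[ℝ] B →ₗ[ℝ] B,
    (∀ q, ∀ b ∈ S.deg q, IsGradedDerivation S.deg q (ad b)) ∧
    (∀ q, ∀ b ∈ S.deg q, ∀ f, ad b (S.j f) = (-1 : ℝ) ^ q • ad (S.j f) b) ∧
    (∀ X b, ad b (S.ι X) = -ad (S.ι X) b) ∧
    (∀ X f, ad (S.ι X) (S.j f) = S.j (ℓ.D X f)) ∧
    (∀ X Y, ad (S.ι X) (S.ι Y) = S.ι (ℓ.br X Y)) := by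
  obtain ⟨L, K, hL, hK, Lj, Lι, Kj, Kι⟩ := S.exists_lie ℓ
  have hKmul : ∀ f g b, K (f * g) b = S.j f * K g b + S.j g * K f b := by
    intro f g
    refine LinearMap.congr_fun (f := K (f * g)) (g := LinearMap.mulLeft ℝ (S.j f) ∘ₗ K g +
      LinearMap.mulLeft ℝ (S.j g) ∘ₗ K f) (S.derivation_ext (hK _)
        (((hK g).mul_left S.gca (add_zero 0) (S.j_mem f)).add
          ((hK f).mul_left S.gca (add_zero 0) (S.j_mem g))) (fun h => ?_) (fun X => ?_))
    · simp [Kj]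
    · simp only [Kι, ℓ.D_mul, LinearMap.add_apply, LinearMap.comp_apply, LinearMap.mulLeft_apply,
        map_add, map_mul, mul_neg]
      rw [S.j_comm g]
      abel
  have hLsmul : ∀ f X b, L (f • X) b = S.j f * L X b + S.ι X * K f b := by
    intro f X
    refine LinearMap.congr_fun (f := L (f • X)) (g := LinearMap.mulLeft ℝ (S.j f) ∘ₗ L X +
      LinearMap.mulLeft ℝ (S.ι X) ∘ₗ K f) (S.derivation_ext (hL _)
        (((hL X).mul_left S.gca (zero_add 1) (S.j_mem f)).add
          ((hK f).mul_left S.gca (add_zero 1) (S.ι_mem X))) (fun h => ?_) (fun Y => ?_))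
    · simp [Kj, Lj, ℓ.D_smul]
    · simp only [Lι, LinearMap.add_apply, LinearMap.comp_apply, LinearMap.mulLeft_apply, Kι]
      rw [ℓ.skew, ℓ.leibniz, ℓ.skew Y X, map_neg, map_add, S.ι_smul, S.ι_smul, map_neg, mul_neg,
        S.j_comm (ℓ.D Y f)]
      simp [add_comm]
  have key : ∀ q, ∃ Δ : S.deg q →ₗ[ℝ] B →ₗ[ℝ] B, ∀ b, IsGradedDerivation S.deg q (Δ b) ∧
      (∀ f, Δ b (S.j f) = (-1 : ℝ) ^ q • K f b) ∧ (∀ X, Δ b (S.ι X) = -L X b) := by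
    intro q
    refine S.exists_ext_linear q (((-1 : ℝ) ^ q • K.flip) ∘ₗ (S.deg q).subtype)
      (-(L.flip ∘ₗ (S.deg q).subtype)) fun b => ⟨fun k hk f => ?_, fun h0 => ?_, fun X => ?_,
        fun f g => ?_, fun f X => ?_⟩
    · exact Submodule.smul_mem _ _ ((hK f).mem q k (by omega) _ b.2)
    · ext f
      subst h0
      simpa using (hK f).zero rfl _ b.2
    · simpa using (hL X).mem q q rfl _ b.2
    · simp [hKmul, ← S.j_comm, add_comm]
    · simp only [LinearMap.neg_apply, LinearMap.comp_apply, Submodule.subtype_apply,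
        LinearMap.flip_apply, hLsmul, LinearMap.smul_apply, neg_add, mul_neg, smul_mul_assoc]
      rcases Nat.eq_zero_or_pos q with h0 | h0
      · subst h0
        simp [(hK f).zero rfl _ b.2]
      · obtain ⟨k, rfl⟩ : ∃ k, q = k + 1 := ⟨q - 1, by omega⟩
        -- In degree q = k + 1 the factor K_f b passes X with sign (-1)^k, and together with (-1)^q
        -- this leaves -1. In degree 0 both terms vanish.
        rw [(hK f).mul_right S.gca (S.ι_mem X) (add_zero (k + 1)) b.2, smul_smul, ← pow_add]
        rw [add_comm]
        congr 1
        rw [show k + 1 + k * 1 = 2 * k + 1 by ring, pow_succ, pow_mul]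
        simp
  choose Δ hΔ Δj Δι using key
  let _ := S.gca.gradedMonoid
  let _ := S.gca.isInternal.chooseDecomposition
  let ad : B →ₗ[ℝ] B →ₗ[ℝ] B := DirectSum.toModule ℝ ℕ _ Δ ∘ₗ
    (DirectSum.decomposeLinearEquiv S.deg).toLinearMap
  have had : ∀ q (b : B) (hb : b ∈ S.deg q), ad b = Δ q ⟨b, hb⟩ := by
    intro q b hb
    simp only [ad, LinearMap.comp_apply, LinearEquiv.coe_coe, DirectSum.decomposeLinearEquiv_apply]
    rw [DirectSum.decompose_of_mem S.deg hb]
    exact DirectSum.toModule_lof ℝ q _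
  -- Consistency: in degrees 0 and 1 the operators just built are the K and L they were built from,
  -- since they agree on generators.
  have hadj : ∀ f, ad (S.j f) = K f := by
    intro f
    rw [had 0 _ (S.j_mem f)]
    refine S.derivation_ext (hΔ _ _) (hK f) (fun g => ?_) (fun X => ?_)
    · simp [Δj, Kj]
    · simp [Δι, Kι, Lj]
  have hadι : ∀ X, ad (S.ι X) = L X := by
    intro X
    rw [had 1 _ (S.ι_mem X)]
    refine S.derivation_ext (hΔ _ _) (hL X) (fun g => ?_) (fun Y => ?_)
    · simp [Δj, Lj, Kι]
    · simp only [Δι, Lι]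
      rw [ℓ.skew, map_neg, neg_neg]
  refine ⟨ad, fun q b hb => ?_, fun q b hb f => ?_, fun X => ?_, fun X f => ?_, fun X Y => ?_⟩
  · rw [had q b hb]; exact hΔ _ _
  · rw [had q b hb, hadj, Δj]
  · refine LinearMap.congr_fun (f := ad.flip (S.ι X)) (g := -ad (S.ι X))
      (S.gca.linearMap_ext fun q b hb => ?_)
    simp only [LinearMap.flip_apply, LinearMap.neg_apply]
    rw [had q b hb, hadι, Δι]
  · rw [hadι, Lj]
  · rw [hadι, Lι]

end ExteriorCalculus

end Schouten

end HomBundles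

namespace HomBundles

section Schouten

variable {C Γ Γ' B : Type*} [CommRing C] [Algebra ℝ C]
  [AddCommGroup Γ] [Module ℝ Γ] [Module C Γ] [AddCommGroup Γ'] [Module ℝ Γ'] [Module C Γ']
  [Ring B] [Algebra ℝ B]

theorem neg_one_pow_four : (-1 : ℝ) ^ 4 = 1 := by norm_num

theorem IsGradedDerivation.of_homogeneous {𝒜 : ℕ → Submodule ℝ B}
    (h𝒜 : IsGradedCommutativeAlgebra 𝒜) {n : ℕ} {δ : B →ₗ[ℝ] B}
    (h₁ : ∀ i k, i + n = k + 1 → ∀ a ∈ 𝒜 i, δ a ∈ 𝒜 k) (h₂ : n = 0 → ∀ a ∈ 𝒜 0, δ a = 0)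
    (h₃ : ∀ i k, ∀ a ∈ 𝒜 i, ∀ b ∈ 𝒜 k,
      δ (a * b) = δ a * b + (-1 : ℝ) ^ ((n + 1) * i) • (a * δ b)) :
    IsGradedDerivation 𝒜 n δ where
  mem := h₁
  zero := h₂
  leibniz p b hb c := by
    refine LinearMap.congr_fun (f := δ ∘ₗ LinearMap.mulLeft ℝ b)
      (g := LinearMap.mulLeft ℝ (δ b) + (-1 : ℝ) ^ ((n + 1) * p) • LinearMap.mulLeft ℝ b ∘ₗ δ)
      (h𝒜.linearMap_ext fun q c hc => ?_) c
    simpa using h₃ p q b hb c hc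

/-- The map a ↦ [a, b] obeys a Leibniz rule with signs on the wrong side. This sign operator turns
it into a graded derivation to which uniqueness applies. -/
theorem exists_signed {𝒜 : ℕ → Submodule ℝ B} (h𝒜 : IsGradedCommutativeAlgebra 𝒜) (m : ℕ) :
    ∃ P : B →ₗ[ℝ] B, ∀ i, ∀ a ∈ 𝒜 i, P a = (-1 : ℝ) ^ (m * i) • a := by
  let _ := h𝒜.gradedMonoid
  let _ := h𝒜.isInternal.chooseDecomposition
  refine ⟨DirectSum.toModule ℝ ℕ _ (fun i => (-1 : ℝ) ^ (m * i) • (𝒜 i).subtype) ∘ₗ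
    (DirectSum.decomposeLinearEquiv 𝒜).toLinearMap, fun i a ha => ?_⟩
  simp only [LinearMap.comp_apply, LinearEquiv.coe_coe, DirectSum.decomposeLinearEquiv_apply]
  rw [DirectSum.decompose_of_mem 𝒜 ha]
  exact DirectSum.toModule_lof ℝ i _

variable (S : ExteriorCalculus C Γ Γ' B)

namespace ExteriorCalculus

variable {br : B →ₗ[ℝ] B →ₗ[ℝ] B}

/-- The Leibniz rule in the first argument. -/
theorem bracket_mul_left
    (hder : ∀ q, ∀ b ∈ S.deg q, IsGradedDerivation S.deg q (br b))
    (hj : ∀ q, ∀ b ∈ S.deg q, ∀ f, br b (S.j f) = (-1 : ℝ) ^ q • br (S.j f) b)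
    (hι : ∀ X b, br b (S.ι X) = -br (S.ι X) b)
    {p q : ℕ} {b c : B} (hb : b ∈ S.deg p) (hc : c ∈ S.deg q) (a : B) :
    br (b * c) a = b * br c a + (-1 : ℝ) ^ (p * q) • (c * br b a) := by
  -- Both sides are graded derivations in a. On generators the claim becomes the Leibniz rule for
  -- [f, ·] and [X, ·].
  refine LinearMap.congr_fun (f := br (b * c)) (g := LinearMap.mulLeft ℝ b ∘ₗ br c +
      (-1 : ℝ) ^ (p * q) • (LinearMap.mulLeft ℝ c ∘ₗ br b))
    (S.derivation_ext (hder _ _ (S.gca.mul_mem hb hc)) (((hder q c hc).mul_left S.gca rfl hb).add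
      (((hder p b hb).mul_left S.gca (add_comm q p) hc).smul _)) (fun f => ?_) (fun X => ?_)) a
  · simp only [LinearMap.add_apply, LinearMap.comp_apply, LinearMap.mulLeft_apply,
      LinearMap.smul_apply]
    rw [hj _ _ (S.gca.mul_mem hb hc), hj _ _ hb, hj _ _ hc,
      (hder 0 _ (S.j_mem f)).leibniz p b hb c]
    have h1 : br (S.j f) b * c = (-1 : ℝ) ^ ((p + 1) * q) • (c * br (S.j f) b) := by
      rcases Nat.eq_zero_or_pos p with h0 | h0
      · subst h0
        simp [(hder 0 _ (S.j_mem f)).zero rfl b hb]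
      · obtain ⟨k, rfl⟩ : ∃ k, p = k + 1 := ⟨p - 1, by omega⟩
        rw [(hder 0 _ (S.j_mem f)).mul_right S.gca hc (add_zero (k + 1)) hb]
        congr 1
        simp only [neg_one_pow_eq_ite, parity_simps]
        by_cases h1 : Even k <;> by_cases h2 : Even q <;> simp [*]
    rw [h1]
    simp only [smul_add, mul_smul_comm, smul_smul]
    simp only [neg_one_pow_eq_ite, parity_simps]
    by_cases h1 : Even p <;> by_cases h2 : Even q <;> simp [*] <;> abel
  · simp only [LinearMap.add_apply, LinearMap.comp_apply, LinearMap.mulLeft_apply,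
      LinearMap.smul_apply, hι]
    rw [(hder 1 _ (S.ι_mem X)).leibniz p b hb c,
      (hder 1 _ (S.ι_mem X)).mul_right S.gca hc (k := p) rfl hb]
    have h2 : (-1 : ℝ) ^ ((1 + 1) * p) = 1 := Even.neg_one_pow (by simp [parity_simps])
    rw [h2]
    simp [add_comm]

/-- For fixed b, the map a ↦ (-1)^{(q+1)|a|} [a, b] is a graded derivation, by the Leibniz rule in
the first argument, and so is a multiple of [b, ·]. The hypotheses `hj` and `hι` say that the two
agree on generators. -/
theorem bracket_skew
    (hder : ∀ q, ∀ b ∈ S.deg q, IsGradedDerivation S.deg q (br b))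
    (hj : ∀ q, ∀ b ∈ S.deg q, ∀ f, br b (S.j f) = (-1 : ℝ) ^ q • br (S.j f) b)
    (hι : ∀ X b, br b (S.ι X) = -br (S.ι X) b)
    {p q : ℕ} {a b : B} (ha : a ∈ S.deg p) (hb : b ∈ S.deg q) :
    br a b = -((-1 : ℝ) ^ ((p + 1) * (q + 1)) • br b a) := by
  obtain ⟨P, hP⟩ := exists_signed S.gca (q + 1)
  have key : br.flip b ∘ₗ P = (-(-1 : ℝ) ^ (q + 1)) • br b := by
    refine S.derivation_ext (n := q) (.of_homogeneous S.gca ?_ ?_ ?_) ((hder q b hb).smul _)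
      (fun f => ?_) (fun X => ?_)
    · intro i k hk a ha
      simp only [LinearMap.comp_apply, hP i a ha, map_smul, LinearMap.flip_apply]
      exact Submodule.smul_mem _ _ ((hder i a ha).mem q k (by omega) b hb)
    · rintro rfl a ha
      simp only [LinearMap.comp_apply, hP 0 a ha, map_smul, LinearMap.flip_apply]
      rw [(hder 0 a ha).zero rfl b hb, smul_zero]
    · intro i k a ha c hc
      simp only [LinearMap.comp_apply, hP i a ha, hP k c hc, hP _ _ (S.gca.mul_mem ha hc),
        map_smul, LinearMap.flip_apply, S.bracket_mul_left hder hj hι ha hc]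
      have h1 : br a b * c = (-1 : ℝ) ^ ((i + q + 1) * k) • (c * br a b) := by
        rcases Nat.eq_zero_or_pos (i + q) with h0 | h0
        · rw [(hder i a ha).mem_deg_zero (by omega) hb]
          simp
        · obtain ⟨m, hm⟩ : ∃ m, i + q = m + 1 := ⟨i + q - 1, by omega⟩
          rw [(hder i a ha).mul_right S.gca hc (k := m) (by omega) hb, hm]
          congr 1
          simp only [neg_one_pow_eq_ite, parity_simps]
          by_cases h1 : Even m <;> by_cases h2 : Even k <;> simp [*]
      rw [smul_mul_assoc, h1]
      simp only [smul_add, mul_smul_comm, smul_smul]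
      simp only [neg_one_pow_eq_ite, parity_simps]
      by_cases h1 : Even i <;> by_cases h2 : Even q <;> by_cases h3 : Even k <;>
        simp [*] <;> abel
    · simp only [LinearMap.comp_apply, hP 0 _ (S.j_mem f), map_smul, LinearMap.flip_apply,
        LinearMap.smul_apply, hj q b hb, smul_smul]
      simp only [neg_one_pow_eq_ite, parity_simps]
      by_cases h2 : Even q <;> simp [*]
    · simp only [LinearMap.comp_apply, hP 1 _ (S.ι_mem X), map_smul, LinearMap.flip_apply,
        LinearMap.smul_apply, hι]
      simp
  have := LinearMap.congr_fun key a
  simp only [LinearMap.comp_apply, hP p a ha, map_smul, LinearMap.flip_apply,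
    LinearMap.smul_apply] at this
  have h2 := congrArg (fun x => (-1 : ℝ) ^ ((q + 1) * p) • x) this
  simp only [smul_smul, ← pow_add] at h2
  rw [Even.neg_one_pow (Even.add_self _), one_smul] at h2
  rw [h2]
  simp only [← neg_smul]
  congr 1
  simp only [neg_one_pow_eq_ite, parity_simps]
  by_cases h1 : Even p <;> by_cases h2 : Even q <;> simp [*]

/-- The defect of the Jacobi identity. -/
def jacobiator (br : B →ₗ[ℝ] B →ₗ[ℝ] B) (i j k : ℕ) (a b c : B) : B :=
  (-1 : ℝ) ^ ((i + 1) * (k + 1)) • br a (br b c) + (-1 : ℝ) ^ ((j + 1) * (i + 1)) • br b (br c a)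
    + (-1 : ℝ) ^ ((k + 1) * (j + 1)) • br c (br a b)

theorem jacobiator_cyclic (br : B →ₗ[ℝ] B →ₗ[ℝ] B) (i j k : ℕ) (a b c : B) :
    jacobiator br i j k a b c = jacobiator br j k i b c a := by
  unfold jacobiator
  abel

/-- The graded commutator `[ad a, ad b]` minus `ad [a, b]`. -/
def adDefect (br : B →ₗ[ℝ] B →ₗ[ℝ] B) (i j : ℕ) (a b : B) : B →ₗ[ℝ] B :=
  (br a ∘ₗ br b - (-1 : ℝ) ^ ((i + 1) * (j + 1)) • (br b ∘ₗ br a)) - br (br a b)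

/-- By skew-symmetry the Jacobi identity says that ad is compatible with brackets. In this form it
can be treated as a derivation in the last argument. -/
theorem jacobiator_eq_adDefect
    (hder : ∀ q, ∀ b ∈ S.deg q, IsGradedDerivation S.deg q (br b))
    (hskew : ∀ p q, ∀ a ∈ S.deg p, ∀ b ∈ S.deg q,
      br a b = -((-1 : ℝ) ^ ((p + 1) * (q + 1)) • br b a))
    {i j k : ℕ} {a b c : B} (ha : a ∈ S.deg i) (hb : b ∈ S.deg j) (hc : c ∈ S.deg k) :
    jacobiator br i j k a b c = (-1 : ℝ) ^ ((i + 1) * (k + 1)) • adDefect br i j a b c := by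
  have h1 : br c (br a b) = -((-1 : ℝ) ^ ((k + 1) * (i + j)) • br (br a b) c) := by
    rcases Nat.eq_zero_or_pos (i + j) with h0 | h0
    · rw [(hder i a ha).mem_deg_zero (by omega) hb]
      simp
    · obtain ⟨m, hm⟩ : ∃ m, i + j = m + 1 := ⟨i + j - 1, by omega⟩
      rw [hskew k m c hc _ ((hder i a ha).mem j m (by omega) b hb), hm]
  unfold jacobiator adDefect
  rw [h1, hskew k i c hc a ha]
  simp only [LinearMap.sub_apply, LinearMap.comp_apply, LinearMap.smul_apply, smul_sub, smul_smul,
    map_neg, smul_neg, map_smul]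
  simp only [neg_one_pow_eq_ite, parity_simps]
  by_cases h1 : Even i <;> by_cases h2 : Even j <;> by_cases h3 : Even k <;>
        simp [*] <;> abel

/-- A graded commutator of derivations minus an inner derivation follows one Leibniz rule, with sign
exponent i + j. When i = j = 0 the inner term is absent because [a, b] = 0. -/
theorem adDefect_eq_zero
    (hder : ∀ q, ∀ b ∈ S.deg q, IsGradedDerivation S.deg q (br b))
    {i j : ℕ} {a b : B} (ha : a ∈ S.deg i) (hb : b ∈ S.deg j)
    (h₀ : ∀ f, adDefect br i j a b (S.j f) = 0) (h₁ : ∀ X, adDefect br i j a b (S.ι X) = 0) :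
    adDefect br i j a b = 0 := by
  refine S.uniq (i + j) _ (fun p c hc e => ?_) h₀ h₁
  have h1 := (hder i a ha).commutator_leibniz (hder j b hb) p c hc e
  have h2 : br (br a b) (c * e) = br (br a b) c * e +
      (-1 : ℝ) ^ ((i + j) * p) • (c * br (br a b) e) := by
    rcases Nat.eq_zero_or_pos (i + j) with h0 | h0
    · rw [(hder i a ha).mem_deg_zero (by omega) hb]
      simp
    · obtain ⟨m, hm⟩ : ∃ m, i + j = m + 1 := ⟨i + j - 1, by omega⟩
      rw [(hder m _ ((hder i a ha).mem j m (by omega) b hb)).leibniz p c hc, hm]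
  unfold adDefect
  rw [LinearMap.sub_apply, h1, h2]
  simp only [LinearMap.sub_apply _ (br (br a b)), sub_mul, mul_sub, smul_sub]
  abel

/-- With two arguments fixed, vanishing on generators in the third suffices. Cyclic rotation brings
each argument into third place, so everything reduces to generators. With at least two functions
among them every term is zero, since functions commute; the remaining types are the two hypotheses.
-/
theorem jacobiator_eq_zero
    (hder : ∀ q, ∀ b ∈ S.deg q, IsGradedDerivation S.deg q (br b))
    (hskew : ∀ p q, ∀ a ∈ S.deg p, ∀ b ∈ S.deg q,
      br a b = -((-1 : ℝ) ^ ((p + 1) * (q + 1)) • br b a))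
    (h₁₁₁ : ∀ X Y Z, jacobiator br 1 1 1 (S.ι X) (S.ι Y) (S.ι Z) = 0)
    (h₁₁₀ : ∀ X Y f, jacobiator br 1 1 0 (S.ι X) (S.ι Y) (S.j f) = 0)
    {i j k : ℕ} {a b c : B} (ha : a ∈ S.deg i) (hb : b ∈ S.deg j) (hc : c ∈ S.deg k) :
    jacobiator br i j k a b c = 0 := by
  have hone : ∀ n : ℕ, ∀ x : B, (-1 : ℝ) ^ n • x = 0 → x = 0 := fun n x hx =>
    (smul_eq_zero.1 hx).resolve_left (pow_ne_zero _ (by norm_num))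
  have step : ∀ {i j : ℕ} {a b : B}, a ∈ S.deg i → b ∈ S.deg j →
      (∀ f, jacobiator br i j 0 a b (S.j f) = 0) → (∀ X, jacobiator br i j 1 a b (S.ι X) = 0) →
      ∀ {k c}, c ∈ S.deg k → jacobiator br i j k a b c = 0 := by
    intro i j a b ha hb h0 h1 k c hc
    rw [S.jacobiator_eq_adDefect hder hskew ha hb hc, S.adDefect_eq_zero hder ha hb]
    · simp
    · intro f
      have := h0 f
      rw [S.jacobiator_eq_adDefect hder hskew ha hb (S.j_mem f)] at this
      exact hone _ _ this
    · intro f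
      have := h1 f
      rw [S.jacobiator_eq_adDefect hder hskew ha hb (S.ι_mem f)] at this
      exact hone _ _ this
  have hfg : ∀ f g, br (S.j f) (S.j g) = 0 := fun f g =>
    (hder 0 _ (S.j_mem f)).zero rfl _ (S.j_mem g)
  have h1g : ∀ X f, ∃ g, br (S.ι X) (S.j f) = S.j g := fun X f =>
    ((S.mem_zero _).1 ((hder 1 _ (S.ι_mem X)).mem 0 0 rfl _ (S.j_mem f))).imp fun _ h => h.symm
  have h1g' : ∀ X f, ∃ g, br (S.j f) (S.ι X) = S.j g := fun X f =>
    ((S.mem_zero _).1 ((hder 0 _ (S.j_mem f)).mem 1 0 rfl _ (S.ι_mem X))).imp fun _ h => h.symm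
  have h₁₀₀ : ∀ X f g, jacobiator br 1 0 0 (S.ι X) (S.j f) (S.j g) = 0 := by
    intro X f g
    obtain ⟨u, hu⟩ := h1g' X g
    obtain ⟨v, hv⟩ := h1g X f
    simp [jacobiator, hfg, hu, hv]
  have h₀₀₀ : ∀ f g h, jacobiator br 0 0 0 (S.j f) (S.j g) (S.j h) = 0 := by
    intro f g h
    simp [jacobiator, hfg]
  have a11 : ∀ X Y {k c}, c ∈ S.deg k → jacobiator br 1 1 k (S.ι X) (S.ι Y) c = 0 :=
    fun X Y => step (S.ι_mem X) (S.ι_mem Y) (h₁₁₀ X Y) (h₁₁₁ X Y)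
  have a10 : ∀ X f {k c}, c ∈ S.deg k → jacobiator br 1 0 k (S.ι X) (S.j f) c = 0 :=
    fun X f => step (S.ι_mem X) (S.j_mem f) (h₁₀₀ X f)
      (fun Y => by rw [← jacobiator_cyclic]; exact h₁₁₀ Y X f)
  have a01 : ∀ X f {k c}, c ∈ S.deg k → jacobiator br 0 1 k (S.j f) (S.ι X) c = 0 :=
    fun X f => step (S.j_mem f) (S.ι_mem X)
      (fun g => by rw [jacobiator_cyclic]; exact h₁₀₀ X g f)
      (fun Y => by rw [jacobiator_cyclic]; exact h₁₁₀ X Y f)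
  have a00 : ∀ f g {k c}, c ∈ S.deg k → jacobiator br 0 0 k (S.j f) (S.j g) c = 0 :=
    fun f g => step (S.j_mem f) (S.j_mem g) (h₀₀₀ f g)
      (fun Y => by rw [← jacobiator_cyclic]; exact h₁₀₀ Y f g)
  have b1 : ∀ X {k l c e}, c ∈ S.deg k → e ∈ S.deg l → jacobiator br 1 k l (S.ι X) c e = 0 :=
    fun X {k l c e} hc => step (S.ι_mem X) hc
      (fun f => by rw [← jacobiator_cyclic]; exact a01 X f hc)
      (fun Y => by rw [← jacobiator_cyclic]; exact a11 Y X hc)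
  have b0 : ∀ f {k l c e}, c ∈ S.deg k → e ∈ S.deg l → jacobiator br 0 k l (S.j f) c e = 0 :=
    fun f {k l c e} hc => step (S.j_mem f) hc
      (fun g => by rw [← jacobiator_cyclic]; exact a00 g f hc)
      (fun Y => by rw [← jacobiator_cyclic]; exact a10 Y f hc)
  exact step ha hb (fun f => by rw [← jacobiator_cyclic]; exact b0 f ha hb)
    (fun X => by rw [← jacobiator_cyclic]; exact b1 X ha hb) hc

/-- The Schouten bracket of a Lie-Rinehart structure. -/
theorem exists_isSchouten (ℓ : LieRinehart C Γ) : ∃ br, S.IsSchouten ℓ br := by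
  obtain ⟨br, hder, hj, hι, Xf, XY⟩ := S.exists_ad ℓ
  have hskew : ∀ p q, ∀ a ∈ S.deg p, ∀ b ∈ S.deg q,
      br a b = -((-1 : ℝ) ^ ((p + 1) * (q + 1)) • br b a) :=
    fun p q a ha b hb => S.bracket_skew hder hj hι ha hb
  have fX : ∀ X f, br (S.j f) (S.ι X) = -S.j (ℓ.D X f) := fun X f => by rw [hι, Xf]
  refine ⟨br, ⟨S.gca, fun i a ha => ha, fun i j k hk a ha b hb =>
    (hder i a ha).mem j k (by omega) b hb, fun a ha b hb => (hder 0 a ha).zero rfl b hb,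
    hskew, fun a b => rfl, fun i j k a ha b hb c hc => ?_,
    fun i j k a ha b hb c hc => (hder i a ha).leibniz j b hb c⟩, XY, Xf⟩
  refine S.jacobiator_eq_zero hder hskew (fun X Y Z => ?_) (fun X Y f => ?_) ha hb hc
  · simp [jacobiator, XY, neg_one_pow_four, ← map_add, ℓ.jacobi]
  · simp [jacobiator, XY, Xf, fX, neg_one_pow_four, ℓ.D_br]
    abel

/-- First [f, ·] and [X, ·] are determined as derivations with known values on generators.
Skew-symmetry then gives the values of [a, ·] on generators for arbitrary a. -/
theorem IsSchouten.unique {ℓ : LieRinehart C Γ} {br br' : B →ₗ[ℝ] B →ₗ[ℝ] B}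
    (h : S.IsSchouten ℓ br) (h' : S.IsSchouten ℓ br') : br = br' := by
  have hskew : ∀ {br : B →ₗ[ℝ] B →ₗ[ℝ] B}, S.IsSchouten ℓ br → ∀ X f,
      br (S.j f) (S.ι X) = -S.j (ℓ.D X f) := by
    intro br h X f
    rw [h.gerstenhaber.bracket_skew 0 1 _ (S.j_mem f) _ (S.ι_mem X), h.ι_j]
    simp
  have hj : ∀ f, br (S.j f) = br' (S.j f) := fun f =>
    S.derivation_ext (h.gerstenhaber.isGradedDerivation (S.j_mem f))
      (h'.gerstenhaber.isGradedDerivation (S.j_mem f))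
      (fun g => by rw [h.gerstenhaber.bracket_zero_zero _ (S.j_mem f) _ (S.j_mem g),
        h'.gerstenhaber.bracket_zero_zero _ (S.j_mem f) _ (S.j_mem g)])
      (fun X => by rw [hskew h, hskew h'])
  have hι : ∀ X, br (S.ι X) = br' (S.ι X) := fun X =>
    S.derivation_ext (h.gerstenhaber.isGradedDerivation (S.ι_mem X))
      (h'.gerstenhaber.isGradedDerivation (S.ι_mem X))
      (fun g => by rw [h.ι_j, h'.ι_j]) (fun Y => by rw [h.ι_ι, h'.ι_ι])
  refine S.gca.linearMap_ext fun i a ha => S.derivation_ext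
    (h.gerstenhaber.isGradedDerivation ha) (h'.gerstenhaber.isGradedDerivation ha)
    (fun f => ?_) (fun X => ?_)
  · rw [h.gerstenhaber.bracket_skew i 0 a ha _ (S.j_mem f),
      h'.gerstenhaber.bracket_skew i 0 a ha _ (S.j_mem f), hj]
  · rw [h.gerstenhaber.bracket_skew i 1 a ha _ (S.ι_mem X),
      h'.gerstenhaber.bracket_skew i 1 a ha _ (S.ι_mem X), hι]

/-- The Lie-Rinehart structure of a Gerstenhaber bracket. -/
theorem exists_lieRinehart {br : B →ₗ[ℝ] B →ₗ[ℝ] B}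
    (h : IsHomGerstenhaber S.deg br (AlgHom.id ℝ B)) : ∃ ℓ, S.IsSchouten ℓ br := by
  choose b hb using fun X Y => (S.mem_one _).1
    (h.bracket_mem 1 1 1 rfl _ (S.ι_mem X) _ (S.ι_mem Y))
  choose D hD using fun X f => (S.mem_zero _).1
    (h.bracket_mem 1 0 0 rfl _ (S.ι_mem X) _ (S.j_mem f))
  have fX : ∀ X f, br (S.j f) (S.ι X) = -S.j (D X f) := fun X f => by
    rw [h.bracket_skew 0 1 _ (S.j_mem f) _ (S.ι_mem X), hD]
    simp
  have hder : ∀ X, IsGradedDerivation S.deg 1 (br (S.ι X)) := fun X =>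
    h.isGradedDerivation (S.ι_mem X)
  have hskew : ∀ X Y, b X Y = -b Y X := fun X Y => S.ι_injective (by
      rw [map_neg, hb, hb, h.bracket_skew 1 1 _ (S.ι_mem X) _ (S.ι_mem Y)]
      simp [neg_one_pow_four])
  refine ⟨{
    br := LinearMap.mk₂ ℝ b (fun X Y Z => S.ι_injective (by simp [hb]))
      (fun r X Y => S.ι_injective (by simp [hb])) (fun X Y Z => S.ι_injective (by simp [hb]))
      (fun r X Y => S.ι_injective (by simp [hb]))
    D := LinearMap.mk₂ ℝ D (fun X Y Z => S.j_injective (by simp [hD]))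
      (fun r X Y => S.j_injective (by simp [hD])) (fun X Y Z => S.j_injective (by simp [hD]))
      (fun r X Y => S.j_injective (by simp [hD]))
    skew := hskew
    jacobi := fun X Y Z => S.ι_injective ?_
    leibniz := fun X f Y => S.ι_injective ?_
    D_mul := fun X f g => S.j_injective ?_
    D_smul := fun f X g => S.j_injective ?_
    D_br := fun X Y f => S.j_injective ?_ }, h, fun X Y => (hb X Y).symm, fun X f => (hD X f).symm⟩
  · have := h.jacobi 1 1 1 _ (S.ι_mem X) _ (S.ι_mem Y) _ (S.ι_mem Z)
    simpa [hb, neg_one_pow_four] using this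
  · simp only [LinearMap.mk₂_apply, hb, S.ι_smul, S.der_smul (hder X), map_add, hD]
    rw [add_comm]
  · simp only [LinearMap.mk₂_apply, map_mul, S.der_smul (hder X), map_add, hD]
  · simp only [LinearMap.mk₂_apply, map_mul, hD]
    -- Linearity over functions in X comes from exchanging the arguments: [g, ·] is a derivation and
    -- [g, f] = 0, so fX contributes only f [g, X].
    rw [h.bracket_skew 1 0 _ (S.ι_mem _) _ (S.j_mem g), S.ι_smul,
      S.der_smul (h.isGradedDerivation (S.j_mem g)), fX,
      h.bracket_zero_zero _ (S.j_mem g) _ (S.j_mem f), hD]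
    simp
  · have := h.jacobi 1 1 0 _ (S.ι_mem X) _ (S.ι_mem Y) _ (S.j_mem f)
    simp only [AlgHom.id_apply, ← hD, ← hb, fX, map_neg] at this
    simp only [LinearMap.mk₂_apply, map_sub]
    simp only [zero_add, mul_one, one_add_one_eq_two, Nat.reduceMul, even_two, Even.neg_pow,
      one_pow, neg_one_pow_four, one_smul, smul_neg] at this
    rw [← sub_eq_zero, ← neg_eq_zero, ← this]
    abel

end ExteriorCalculus

end Schouten

end HomBundles

namespace HomBundles

/-! ### Cartan calculus and the Chevalley-Eilenberg differential -/

section Differential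

variable {C Γ Γ' B : Type*} [CommRing C] [Algebra ℝ C]
  [AddCommGroup Γ] [Module ℝ Γ] [Module C Γ] [AddCommGroup Γ'] [Module ℝ Γ'] [Module C Γ']
  [Ring B] [Algebra ℝ B] (S : ExteriorCalculus C Γ Γ' B)

theorem LieRinehart.br_self (ℓ : LieRinehart C Γ) (X : Γ) : ℓ.br X X = 0 := by
  have h : (2 : ℝ) • ℓ.br X X = 0 := by
    rw [two_smul]
    nth_rewrite 1 [ℓ.skew]
    exact neg_add_cancel _
  exact (smul_eq_zero.1 h).resolve_left two_ne_zero

namespace ExteriorCalculus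

/-- `d` is the differential, with square zero, of a Lie-Rinehart structure on the dual module. -/
structure IsDifferential (ℓ : LieRinehart C Γ') (d : B →ₗ[ℝ] B) : Prop where
  der : IsGradedDerivation S.deg 2 d
  d_d : ∀ a, d (d a) = 0
  I_d_j : ∀ ξ f, S.I ξ (d (S.j f)) = S.j (ℓ.D ξ f)
  I_I_d_ι : ∀ ξ η X, S.I η (S.I ξ (d (S.ι X))) =
    S.j (ℓ.D ξ (S.pair X η) - ℓ.D η (S.pair X ξ) - S.pair X (ℓ.br ξ η))

theorem ext_of_I {k : ℕ} {s t : B} (hs : s ∈ S.deg (k + 1)) (ht : t ∈ S.deg (k + 1))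
    (h : ∀ ξ, S.I ξ s = S.I ξ t) : s = t :=
  sub_eq_zero.1 (S.sep k _ (sub_mem hs ht) fun ξ => by rw [map_sub, h, sub_self])

theorem ext_of_I_I {k : ℕ} {s t : B} (hs : s ∈ S.deg (k + 2)) (ht : t ∈ S.deg (k + 2))
    (h : ∀ ξ η, S.I η (S.I ξ s) = S.I η (S.I ξ t)) : s = t :=
  S.ext_of_I hs ht fun ξ => S.ext_of_I ((S.I_der ξ).mem _ _ rfl _ hs)
    ((S.I_der ξ).mem _ _ rfl _ ht) (h ξ)

theorem I_j (ξ : Γ') (f : C) : S.I ξ (S.j f) = 0 := (S.I_der ξ).zero rfl _ (S.j_mem f)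

theorem I_smul_right (ξ : Γ') (f : C) (s : B) : S.I ξ (S.j f * s) = S.j f * S.I ξ s := by
  simpa [S.I_j] using (S.I_der ξ).leibniz 0 _ (S.j_mem f) s

theorem exists_rep_linear {V : Type*} [AddCommGroup V] [Module ℝ V] (k : ℕ)
    (Ω : V →ₗ[ℝ] Γ' →ₗ[ℝ] B) (h : ∀ v, (∀ ξ, Ω v ξ ∈ S.deg k) ∧
      (∀ (f : C) ξ, Ω v (f • ξ) = S.j f * Ω v ξ) ∧ ∀ ξ, S.I ξ (Ω v ξ) = 0) :
    ∃ W : V →ₗ[ℝ] B, ∀ v, W v ∈ S.deg (k + 1) ∧ ∀ ξ, S.I ξ (W v) = Ω v ξ := by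
  choose W hW hI using fun v => S.exists_rep k (Ω v) (h v).1 (h v).2.1 (h v).2.2
  refine ⟨{ toFun := W, map_add' := fun v w => ?_, map_smul' := fun r v => ?_ },
    fun v => ⟨hW v, hI v⟩⟩
  · exact S.ext_of_I (hW _) (add_mem (hW v) (hW w)) fun ξ => by simp [hI]
  · exact S.ext_of_I (hW _) (Submodule.smul_mem _ _ (hW v)) fun ξ => by simp [hI]

/-- The Lie derivative. -/
def lieDer (d : B →ₗ[ℝ] B) (ξ : Γ') : B →ₗ[ℝ] B := S.I ξ ∘ₗ d + d ∘ₗ S.I ξ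

theorem lieDer_apply (d : B →ₗ[ℝ] B) (ξ : Γ') (s : B) :
    S.lieDer d ξ s = S.I ξ (d s) + d (S.I ξ s) := rfl

theorem lieDer_der {d : B →ₗ[ℝ] B} (hd : IsGradedDerivation S.deg 2 d) (ξ : Γ') :
    IsGradedDerivation S.deg 1 (S.lieDer d ξ) := by
  have := (S.I_der ξ).commutator (n := 1) (by norm_num : 0 + 2 = 1 + 1) hd
  rwa [show (-1 : ℝ) ^ ((0 + 1) * (2 + 1)) • (d ∘ₗ S.I ξ) = -(d ∘ₗ S.I ξ) by
    rw [show (-1 : ℝ) ^ ((0 + 1) * (2 + 1)) = -1 by norm_num]; ext; simp, sub_neg_eq_add] at this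

section Cartan

variable {S} {d : B →ₗ[ℝ] B} {D : Γ' → C → C} {b : Γ' → Γ' → Γ'}
  (hd : IsGradedDerivation S.deg 2 d) (hD : ∀ ξ f, S.I ξ (d (S.j f)) = S.j (D ξ f))
  (hb : ∀ ξ η X, S.I η (S.I ξ (d (S.ι X))) =
    S.j (D ξ (S.pair X η) - D η (S.pair X ξ) - S.pair X (b ξ η)))

include hD in
theorem lieDer_j (ξ : Γ') (f : C) : S.lieDer d ξ (S.j f) = S.j (D ξ f) := by
  simp [lieDer_apply, S.I_j, hD]

include hd hD hb in
-- Cartan's identity [L_ξ, ι_η] = ι_{[ξ,η]}: both sides are derivations of degree -1, zero on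
-- functions, and on sections the identity is the formula for dX. Neither skewness nor Jacobi for b
-- is used, so it also serves to recover an unknown bracket from d.
theorem lieDer_I (ξ η : Γ') (s : B) :
    S.lieDer d ξ (S.I η s) = S.I η (S.lieDer d ξ s) + S.I (b ξ η) s := by
  have hc := (S.lieDer_der hd ξ).commutator (n := 0) (by norm_num : 1 + 0 = 0 + 1) (S.I_der η)
  have := LinearMap.congr_fun (S.derivation_ext hc (S.I_der (b ξ η)) (fun f => ?_)
    (fun X => ?_)) s
  · simp only [LinearMap.sub_apply, LinearMap.comp_apply, LinearMap.smul_apply] at this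
    rw [← this]
    simp
  · simp [S.I_j, lieDer_j hD]
  · simp only [LinearMap.sub_apply, LinearMap.comp_apply, LinearMap.smul_apply, S.I_ι,
      lieDer_j hD]
    rw [lieDer_apply, map_add, hb, S.I_ι, hD]
    simp
    abel

/-- The iterated contraction `s(ξ₁, …, ξ_k)`. -/
def contr (S : ExteriorCalculus C Γ Γ' B) : (k : ℕ) → (Fin k → Γ') → B →ₗ[ℝ] B
  | 0, _ => LinearMap.id
  | k + 1, ξ => contr S k (Fin.tail ξ) ∘ₗ S.I (ξ 0)

theorem contr_succ (k : ℕ) (ξ : Fin (k + 1) → Γ') (s : B) :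
    S.contr (k + 1) ξ s = S.contr k (Fin.tail ξ) (S.I (ξ 0) s) := rfl

theorem contr_cons (k : ℕ) (a : Γ') (ξ : Fin k → Γ') (s : B) :
    S.contr (k + 1) (Fin.cons a ξ) s = S.contr k ξ (S.I a s) := by
  rw [contr_succ, Fin.tail_cons, Fin.cons_zero]

theorem removeNth_succ {α : Type*} {k : ℕ} (j : Fin (k + 1)) (ξ : Fin (k + 2) → α) :
    j.succ.removeNth ξ = Fin.cons (ξ 0) (j.removeNth (Fin.tail ξ)) := by
  ext i
  refine Fin.cases ?_ (fun i => ?_) i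
  · simp [Fin.removeNth]
  · simp [Fin.removeNth, Fin.tail]

include hd hD hb in
-- Cartan's identity for each contraction in turn. Moving the new contraction with b(ξ, η_j) to the
-- front past j others costs (-1)^j.
theorem lieDer_contr (ξ : Γ') : ∀ (m : ℕ) (η : Fin (m + 1) → Γ') (s : B),
    S.lieDer d ξ (S.contr (m + 1) η s) = S.contr (m + 1) η (S.lieDer d ξ s) +
      ∑ j : Fin (m + 1), (-1 : ℝ) ^ (j : ℕ) •
        S.contr (m + 1) (Fin.cons (b ξ (η j)) (j.removeNth η)) s
  | 0, η, s => by
    simp [contr, lieDer_I hd hD hb]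
  | m + 1, η, s => by
    rw [contr_succ, lieDer_contr ξ m, lieDer_I hd hD hb, map_add, contr_succ (m + 1) η,
      Fin.sum_univ_succ (n := m + 1)]
    simp only [Fin.removeNth_zero, contr_cons, removeNth_succ, Fin.val_zero, pow_zero, one_smul,
      Fin.val_succ, S.I_I (η 0), map_neg, smul_neg, pow_succ, mul_neg, mul_one, neg_smul,
      neg_neg]
    rw [add_assoc]
    rfl

include hd hD hb in
/-- The formula of Chevalley and Eilenberg. -/
theorem contr_d : ∀ (k : ℕ) (ξ : Fin (k + 2) → Γ') (s : B),
    S.contr (k + 2) ξ (d s) =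
      ∑ i : Fin (k + 2), (-1 : ℝ) ^ (i : ℕ) •
        S.lieDer d (ξ i) (S.contr (k + 1) (i.removeNth ξ) s)
      + ∑ j : Fin (k + 2), ∑ i : Fin (k + 1), (if i.castSucc < j then
          (-1 : ℝ) ^ ((i : ℕ) + (j : ℕ)) • S.contr (k + 1)
            (Fin.cons (b (ξ i.castSucc) (ξ j)) (i.removeNth (j.removeNth ξ))) s
        else 0)
      + (-1 : ℝ) ^ k • d (S.contr (k + 2) ξ s)
  | 0, ξ, s => by
    have h1 : ∀ ξ (t : B), S.I ξ (d t) = S.lieDer d ξ t - d (S.I ξ t) := fun ξ t => by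
      simp [lieDer_apply]
    simp [contr, Fin.sum_univ_two, Fin.tail, Fin.removeNth, h1, lieDer_I hd hD hb]
    abel
  | k + 1, ξ, s => by
    -- Induction through ι_{ξ₀} d = L_{ξ₀} - d ι_{ξ₀}. The first term is expanded by `lieDer_contr`,
    -- the second by the induction hypothesis for ι_{ξ₀} s. In `e1` and `e2` the terms with index 0
    -- are split off from the two sums. The summand d(s(ξ₀, …)) is kept because no degree is imposed
    -- on s; it drops out for s of degree k + 1.
    have h1 : ∀ ξ (t : B), S.I ξ (d t) = S.lieDer d ξ t - d (S.I ξ t) := fun ξ t => by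
      simp [lieDer_apply]
    have h2 := lieDer_contr hd hD hb (ξ 0) (k + 1) (Fin.tail ξ) s
    have e1 : ∑ i : Fin (k + 3), (-1 : ℝ) ^ (i : ℕ) •
        S.lieDer d (ξ i) (S.contr (k + 2) (i.removeNth ξ) s) =
        S.lieDer d (ξ 0) (S.contr (k + 2) (Fin.tail ξ) s) - ∑ i : Fin (k + 2), (-1 : ℝ) ^ (i : ℕ) •
          S.lieDer d (Fin.tail ξ i) (S.contr (k + 1) (i.removeNth (Fin.tail ξ)) (S.I (ξ 0) s)) := by
      rw [Fin.sum_univ_succ, sub_eq_add_neg, ← Finset.sum_neg_distrib]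
      congr 1
      · simp
      · refine Finset.sum_congr rfl fun i _ => ?_
        rw [removeNth_succ, contr_cons, Fin.val_succ, pow_succ, mul_neg, mul_one, neg_smul]
        rfl
    have e2 : ∑ j : Fin (k + 3), ∑ i : Fin (k + 2), (if i.castSucc < j then
          (-1 : ℝ) ^ ((i : ℕ) + (j : ℕ)) • S.contr (k + 2)
            (Fin.cons (b (ξ i.castSucc) (ξ j)) (i.removeNth (j.removeNth ξ))) s else 0) =
        -(∑ j : Fin (k + 2), (-1 : ℝ) ^ (j : ℕ) • S.contr (k + 2)
          (Fin.cons (b (ξ 0) (Fin.tail ξ j)) (j.removeNth (Fin.tail ξ))) s) -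
        ∑ j : Fin (k + 2), ∑ i : Fin (k + 1), (if i.castSucc < j then
          (-1 : ℝ) ^ ((i : ℕ) + (j : ℕ)) • S.contr (k + 1)
            (Fin.cons (b (Fin.tail ξ i.castSucc) (Fin.tail ξ j))
              (i.removeNth (j.removeNth (Fin.tail ξ)))) (S.I (ξ 0) s) else 0) := by
      rw [Fin.sum_univ_succ, Finset.sum_eq_zero (fun i _ => if_neg (Fin.not_lt_zero _)), zero_add,
        ← Finset.sum_neg_distrib, ← Finset.sum_sub_distrib]
      refine Finset.sum_congr rfl fun j _ => ?_
      rw [Fin.sum_univ_succ, sub_eq_add_neg, ← Finset.sum_neg_distrib]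
      congr 1
      · rw [if_pos (by simp), removeNth_succ, Fin.removeNth_zero, Fin.tail_cons, Fin.val_succ,
          ← add_assoc, pow_succ, mul_neg, mul_one, neg_smul]
        simp [Fin.tail]
      · refine Finset.sum_congr rfl fun i _ => ?_
        rw [← Fin.succ_castSucc]
        by_cases hij : i.castSucc < j
        · rw [if_pos hij, if_pos (Fin.succ_lt_succ_iff.2 hij), removeNth_succ j, removeNth_succ i,
            contr_cons, contr_cons, contr_cons, Fin.cons_zero, S.I_I (ξ 0), map_neg, Fin.tail_cons,
            smul_neg, neg_inj, Fin.val_succ, Fin.val_succ,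
            show (i : ℕ) + 1 + (j + 1) = i + j + 2 by ring, pow_add _ _ 2, neg_one_sq, mul_one]
          rfl
        · rw [if_neg hij, if_neg (fun h => hij (Fin.succ_lt_succ_iff.1 h)), neg_zero]
    rw [contr_succ, h1, map_sub, contr_d k, eq_sub_of_add_eq h2.symm, e1, e2, contr_succ (k + 2) ξ,
      pow_succ, mul_neg, mul_one, neg_smul]
    abel

include hd hD hb in
theorem lieDer_lieDer_I (ξ η ζ : Γ') (s : B) :
    S.lieDer d ξ (S.lieDer d η (S.I ζ s)) - S.lieDer d η (S.lieDer d ξ (S.I ζ s)) =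
      S.I ζ (S.lieDer d ξ (S.lieDer d η s) - S.lieDer d η (S.lieDer d ξ s)) +
        (S.I (b ξ (b η ζ)) s - S.I (b η (b ξ ζ)) s) := by
  simp only [lieDer_I hd hD hb, map_add, map_sub]
  abel

end Cartan

variable {S} in
theorem IsDifferential.unique {ℓ : LieRinehart C Γ'} {d d' : B →ₗ[ℝ] B} (h : S.IsDifferential ℓ d)
    (h' : S.IsDifferential ℓ d') : d = d' := by
  refine S.derivation_ext h.der h'.der (fun f => ?_) (fun X => ?_)
  · exact S.ext_of_I (h.der.mem 0 1 rfl _ (S.j_mem f)) (h'.der.mem 0 1 rfl _ (S.j_mem f))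
      fun ξ => by rw [h.I_d_j, h'.I_d_j]
  · exact S.ext_of_I_I (h.der.mem 1 2 rfl _ (S.ι_mem X)) (h'.der.mem 1 2 rfl _ (S.ι_mem X))
      fun ξ η => by rw [h.I_I_d_ι, h'.I_I_d_ι]

/-- A derivation of degree `1` which is compatible with a Lie-Rinehart structure squares to zero. -/
theorem d_d_of_lieRinehart (ℓ : LieRinehart C Γ') {d : B →ₗ[ℝ] B}
    (hd : IsGradedDerivation S.deg 2 d) (hD : ∀ ξ f, S.I ξ (d (S.j f)) = S.j (ℓ.D ξ f))
    (hb : ∀ ξ η X, S.I η (S.I ξ (d (S.ι X))) =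
      S.j (ℓ.D ξ (S.pair X η) - ℓ.D η (S.pair X ξ) - S.pair X (ℓ.br ξ η))) (a : B) :
    d (d a) = 0 := by
  have hL := fun ξ => S.lieDer_der hd ξ
  have Lj := fun ξ f => lieDer_j hD (D := fun ξ f => ℓ.D ξ f) ξ f
  have LI := fun ξ η s => lieDer_I (b := fun ξ η => ℓ.br ξ η) (D := fun ξ f => ℓ.D ξ f) hd hD hb ξ η s
  have Ix : ∀ ξ s, S.I ξ (d s) = S.lieDer d ξ s - d (S.I ξ s) := fun ξ s => by simp [lieDer_apply]
  -- The curvature [L_ξ, L_η] - L_{[ξ,η]} vanishes on functions since D is a representation.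
  have Rj : ∀ ξ η f, S.lieDer d ξ (S.lieDer d η (S.j f)) - S.lieDer d η (S.lieDer d ξ (S.j f)) -
      S.lieDer d (ℓ.br ξ η) (S.j f) = 0 := fun ξ η f => by
    simp [Lj, ℓ.D_br]
  -- On sections it suffices to contract with ζ. Commuting ι_ζ to the front leaves the curvature on
  -- the function ⟨X, ζ⟩ and a contraction that is zero by the Jacobi identity.
  have Rι : ∀ ξ η X, S.lieDer d ξ (S.lieDer d η (S.ι X)) - S.lieDer d η (S.lieDer d ξ (S.ι X)) -
      S.lieDer d (ℓ.br ξ η) (S.ι X) = 0 := fun ξ η X => by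
    have hm : ∀ ξ, ∀ s ∈ S.deg 1, S.lieDer d ξ s ∈ S.deg 1 := fun ξ s hs => (hL ξ).mem 1 1 rfl s hs
    refine S.sep 0 _ (sub_mem (sub_mem (hm _ _ (hm _ _ (S.ι_mem X))) (hm _ _ (hm _ _ (S.ι_mem X))))
      (hm _ _ (S.ι_mem X))) fun ζ => ?_
    have h1 := lieDer_lieDer_I (b := fun ξ η => ℓ.br ξ η) (D := fun ξ f => ℓ.D ξ f) hd hD hb ξ η ζ
      (S.ι X)
    have h2 := LI (ℓ.br ξ η) ζ (S.ι X)
    have h3 := ℓ.jacobi ξ η ζ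
    rw [ℓ.skew ζ ξ, map_neg, ℓ.skew ζ] at h3
    have h4 : S.I (ℓ.br ξ (ℓ.br η ζ)) (S.ι X) - S.I (ℓ.br η (ℓ.br ξ ζ)) (S.ι X) =
        S.I (ℓ.br (ℓ.br ξ η) ζ) (S.ι X) := by
      rw [← LinearMap.sub_apply, ← map_sub]
      congr 2
      rw [← sub_eq_zero, ← h3]
      abel
    rw [h4] at h1
    have h5 := Rj ξ η (S.pair X ζ)
    rw [← S.I_ι, h1, h2] at h5
    rw [map_sub, ← h5]
    abel
  -- With T_ξ = [L_ξ, d] and curvature R this reads ι_η T_ξ = R(ξ, η) - T_ξ ι_η. Hence T_ξ vanishes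
  -- on functions, and then on sections. As ι_ξ d d = T_ξ + d d ι_ξ, the same ascent applies to d d.
  have IT : ∀ ξ η s, S.I η (S.lieDer d ξ (d s) - d (S.lieDer d ξ s)) =
      (S.lieDer d ξ (S.lieDer d η s) - S.lieDer d η (S.lieDer d ξ s) - S.lieDer d (ℓ.br ξ η) s)
      - (S.lieDer d ξ (d (S.I η s)) - d (S.lieDer d ξ (S.I η s))) := fun ξ η s => by
    have h1 := LI ξ η (d s)
    have h2 := LI ξ η s
    rw [map_sub, ← sub_eq_of_eq_add h1, Ix, Ix, Ix, map_sub, ← sub_eq_of_eq_add h2, map_sub]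
    abel
  have Tj : ∀ ξ f, S.lieDer d ξ (d (S.j f)) - d (S.lieDer d ξ (S.j f)) = 0 := fun ξ f => by
    refine S.sep 0 _ (sub_mem ((hL ξ).mem 1 1 rfl _ (hd.mem 0 1 rfl _ (S.j_mem f)))
      (hd.mem 0 1 rfl _ ((hL ξ).mem 0 0 rfl _ (S.j_mem f)))) fun η => ?_
    rw [IT, Rj, S.I_j]
    simp
  have Tι : ∀ ξ X, S.lieDer d ξ (d (S.ι X)) - d (S.lieDer d ξ (S.ι X)) = 0 := fun ξ X => by
    refine S.sep 1 _ (sub_mem ((hL ξ).mem 2 2 rfl _ (hd.mem 1 2 rfl _ (S.ι_mem X)))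
      (hd.mem 1 2 rfl _ ((hL ξ).mem 1 1 rfl _ (S.ι_mem X)))) fun η => ?_
    rw [IT, Rι, S.I_ι, Tj]
    simp
  have ddj : ∀ f, d (d (S.j f)) = 0 := fun f => by
    refine S.sep 1 _ (hd.mem 1 2 rfl _ (hd.mem 0 1 rfl _ (S.j_mem f))) fun ξ => ?_
    rw [Ix, ← Tj ξ f, hD, Lj]
  have ddι : ∀ X, d (d (S.ι X)) = 0 := fun X => by
    refine S.sep 2 _ (hd.mem 2 3 rfl _ (hd.mem 1 2 rfl _ (S.ι_mem X))) fun ξ => ?_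
    rw [Ix, ← Tι ξ X, Ix, map_sub, S.I_ι, ddj, sub_zero]
  have h9 : (-1 : ℝ) ^ ((2 + 1) * (2 + 1)) = -1 := by norm_num
  -- The graded commutator of d with itself is 2 d d, so it obeys a Leibniz rule and is zero as soon
  -- as it vanishes on generators.
  have h0 := S.uniq (2 + 2) _ (fun i a ha b => hd.commutator_leibniz hd i a ha b)
    (fun f => by simp [ddj]) (fun X => by simp [ddι])
  have h1 := LinearMap.congr_fun h0 a
  rw [h9] at h1
  have h2 : (2 : ℝ) • d (d a) = 0 := by
    rw [two_smul]
    simpa using h1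
  exact (smul_eq_zero.1 h2).resolve_left two_ne_zero

/-- The differential of a Lie-Rinehart structure on the dual module. -/
theorem exists_isDifferential (ℓ : LieRinehart C Γ') : ∃ d, S.IsDifferential ℓ d := by
  obtain ⟨δ₀, hδ₀⟩ := S.exists_rep_linear (V := C) 0 (ℓ.D.flip.compr₂ S.j.toLinearMap)
    fun f => ⟨fun ξ => S.j_mem _, fun g ξ => by simp [ℓ.D_smul], fun ξ => S.I_j _ _⟩
  -- The element dX of degree 2 is represented in two stages: for fixed ξ by W ξ X of degree 1,
  -- which is to be ι_ξ dX, and below by the family ξ ↦ W ξ X, which is alternating because [ξ, ξ] =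
  -- 0.
  have hω : ∀ ξ, ∃ W : Γ →ₗ[ℝ] B, ∀ X, W X ∈ S.deg 1 ∧ ∀ η, S.I η (W X) =
      S.j (ℓ.D ξ (S.pair X η) - ℓ.D η (S.pair X ξ) - S.pair X (ℓ.br ξ η)) := fun ξ => by
    obtain ⟨W, hW⟩ := S.exists_rep_linear (V := Γ) 0
      ((S.pair.compr₂ (ℓ.D ξ) - ℓ.D.flip ∘ₗ S.pair.flip ξ - S.pair.compl₂ (ℓ.br ξ)).compr₂
        S.j.toLinearMap) fun X => ⟨fun η => S.j_mem _, fun f η => by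
          simp [S.pair_smul_right, ℓ.D_mul, ℓ.D_smul, ℓ.leibniz]
          rw [mul_sub, mul_sub]
          abel, fun η => S.I_j _ _⟩
    exact ⟨W, fun X => ⟨(hW X).1, fun η => by rw [(hW X).2]; simp⟩⟩
  choose W hW hIW using hω
  have hW1 : ∀ X η, S.I η (W η X) = 0 := fun X η => by simp [hIW, ℓ.br_self]
  obtain ⟨δ₁, hδ₁⟩ := S.exists_rep_linear (V := Γ) 1 (LinearMap.mk₂ ℝ (fun X ξ => W ξ X)
      (fun X Y ξ => map_add _ _ _) (fun r X ξ => map_smul _ _ _)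
      (fun X ξ η => S.ext_of_I (hW _ _) (add_mem (hW _ _) (hW _ _)) fun ζ => by
        simp [hIW]; abel)
      (fun r X ξ => S.ext_of_I (hW _ _) (Submodule.smul_mem _ _ (hW _ _)) fun ζ => by
        simp [hIW, smul_sub]))
    fun X => ⟨fun ξ => hW _ _, fun f ξ => S.ext_of_I (hW _ _)
      (by simpa using S.gca.mul_mem (S.j_mem f) (hW ξ X)) fun ζ => by
        simp only [LinearMap.mk₂_apply, hIW, S.I_smul_right, ← map_mul]
        rw [ℓ.skew, ℓ.leibniz, ℓ.skew ζ]
        simp [S.pair_smul_right, ℓ.D_mul, ℓ.D_smul]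
        rw [mul_sub, mul_sub]
        abel, fun ξ => hW1 _ _⟩
  have hI0 : ∀ f, δ₀ f ∈ S.deg 1 := fun f => (hδ₀ f).1
  have hI1 : ∀ X, δ₁ X ∈ S.deg 2 := fun X => (hδ₁ X).1
  have hII : ∀ X ξ η, S.I η (S.I ξ (δ₁ X)) = 
      S.j (ℓ.D ξ (S.pair X η) - ℓ.D η (S.pair X ξ) - S.pair X (ℓ.br ξ η)) := fun X ξ η => by
    rw [(hδ₁ X).2]
    exact hIW _ _ _
  have hI00 : ∀ f ξ, S.I ξ (δ₀ f) = S.j (ℓ.D ξ f) := fun f ξ => (hδ₀ f).2 ξ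
  have hmul : ∀ {i k : ℕ} {a : B}, i + 0 = k → a ∈ S.deg i → a ∈ S.deg k := by
    rintro i k a rfl h; exact h
  have h0 : ∀ f g, δ₀ (f * g) = δ₀ f * S.j g + S.j f * δ₀ g := fun f g => by
    refine S.ext_of_I (hI0 _) (add_mem (hmul (by omega) (S.gca.mul_mem (hI0 f) (S.j_mem g)))
      (hmul (by omega) (S.gca.mul_mem (S.j_mem f) (hI0 g)))) fun ξ => ?_
    rw [map_add, ← S.j_comm, S.I_smul_right, S.I_smul_right, hI00, hI00, hI00, ℓ.D_mul]
    simp only [← map_mul, ← map_add]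
    congr 1
    ring
  have h1 : ∀ (f : C) X, δ₁ (f • X) = δ₀ f * S.ι X + S.j f * δ₁ X := fun f X => by
    refine S.ext_of_I_I (hI1 _) (add_mem (hmul (by omega) (S.gca.mul_mem (hI0 f) (S.ι_mem X)))
      (hmul (by omega) (S.gca.mul_mem (S.j_mem f) (hI1 X)))) fun ξ η => ?_
    rw [map_add, (S.I_der ξ).leibniz 1 _ (hI0 f), map_add, map_add, hI00, S.I_smul_right,
      S.I_smul_right, S.I_smul_right, S.I_ι, S.I_ι, map_smul (S.I η) (_ : ℝ) _,
      ← S.j_comm (S.pair X ξ), S.I_smul_right, hI00, hII, hII]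
    simp only [S.pair_smul_left, ℓ.D_mul, ← map_mul, ← map_add, ← map_smul]
    congr 1
    simp
    ring
  obtain ⟨d, hd, hdj, hdι⟩ := S.exists_ext 2 δ₀ δ₁ (fun k hk f => hmul (by omega) (hI0 f)) (by simp)
    hI1 h0 h1
  have hD : ∀ ξ f, S.I ξ (d (S.j f)) = S.j (ℓ.D ξ f) := fun ξ f => by rw [hdj, hI00]
  have hb : ∀ ξ η X, S.I η (S.I ξ (d (S.ι X))) =
    S.j (ℓ.D ξ (S.pair X η) - ℓ.D η (S.pair X ξ) - S.pair X (ℓ.br ξ η)) := fun ξ η X => by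
      rw [hdι, hII]
  exact ⟨d, hd, S.d_d_of_lieRinehart ℓ hd hD hb, hD, hb⟩

/-- The Lie-Rinehart structure on the dual module of a differential. -/
theorem exists_lieRinehart_dual {d : B →ₗ[ℝ] B} (hd : IsGradedDerivation S.deg 2 d)
    (hdd : ∀ a, d (d a) = 0) : ∃ ℓ, S.IsDifferential ℓ d := by
  have hd0 : ∀ f, d (S.j f) ∈ S.deg 1 := fun f => hd.mem 0 1 rfl _ (S.j_mem f)
  have hd1 : ∀ X, d (S.ι X) ∈ S.deg 2 := fun X => hd.mem 1 2 rfl _ (S.ι_mem X)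
  choose D hD using fun ξ f => (S.mem_zero _).1 ((S.I_der ξ).mem 1 0 rfl _ (hd0 f))
  choose c hc using fun ξ η X => (S.mem_zero _).1 ((S.I_der η).mem 1 0 rfl _
    ((S.I_der ξ).mem 2 1 rfl _ (hd1 X)))
  have hdsmul : ∀ f b, d (S.j f * b) = d (S.j f) * b + S.j f * d b := S.der_smul hd
  have Dmul : ∀ ξ f g, D ξ (f * g) = D ξ f * g + f * D ξ g := fun ξ f g => S.j_injective (by
    rw [hD, map_mul, hdsmul, map_add, ← S.j_comm, S.I_smul_right, S.I_smul_right, ← hD, ← hD]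
    simp [mul_comm, add_comm])
  have Dadd : ∀ ξ f g, D ξ (f + g) = D ξ f + D ξ g := fun ξ f g => S.j_injective (by
    simp [hD])
  have Dsmul : ∀ ξ (r : ℝ) f, D ξ (r • f) = r • D ξ f := fun ξ r f => S.j_injective (by
    simp [hD])
  have Dsmul' : ∀ (f : C) ξ g, D (f • ξ) g = f * D ξ g := fun ξ r f => S.j_injective (by
    simp [hD, S.I_smul])
  have csmul : ∀ ξ η f X, c ξ η (f • X) = D ξ f * S.pair X η - D η f * S.pair X ξ + f * c ξ η X :=
    fun ξ η f X => S.j_injective (by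
      rw [hc, S.ι_smul, hdsmul, map_add, map_add, (S.I_der ξ).leibniz 1 _ (hd0 f), S.I_smul_right,
        S.I_smul_right, ← hc, ← hD, S.I_ι, map_add, S.I_smul_right, S.I_ι, map_smul,
        ← S.j_comm (S.pair X ξ), S.I_smul_right, ← hD]
      simp
      rw [S.j_comm (S.pair X ξ)]
      abel)
  -- The two derivative terms cancel the failure of c to be linear over functions in X, recorded in
  -- `csmul`. The expression is therefore represented by an element of the dual module.
  have hb : ∀ ξ η, ∃ ζ, ∀ X, S.pair X ζ = D ξ (S.pair X η) - D η (S.pair X ξ) - c ξ η X :=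
    fun ξ η => S.pair_rep
      { toFun := fun X => D ξ (S.pair X η) - D η (S.pair X ξ) - c ξ η X
        map_add' := fun X Y => S.j_injective (by simp [hD, hc]; abel)
        map_smul' := fun r X => S.j_injective (by simp [hD, hc, smul_sub]) }
      fun f X => by
        simp only [LinearMap.coe_mk, AddHom.coe_mk, csmul, S.pair_smul_left, Dmul]
        ring
  choose b hb using hb
  have hb' : ∀ ξ η X, S.I η (S.I ξ (d (S.ι X))) =
    S.j (D ξ (S.pair X η) - D η (S.pair X ξ) - S.pair X (b ξ η)) := fun ξ η X => by
      rw [hb, ← hc]; congr 1; ring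
  have hD' : ∀ ξ f, S.I ξ (d (S.j f)) = S.j (D ξ f) := fun ξ f => (hD ξ f).symm
  have LI := fun ξ η s => lieDer_I hd hD' hb' ξ η s
  have Lj := fun ξ f => lieDer_j hD' ξ f
  have Ld : ∀ ξ s, S.lieDer d ξ (d s) = d (S.lieDer d ξ s) := fun ξ s => by
    simp [lieDer_apply, hdd]
  have Iext : ∀ ξ η, (∀ X, S.I ξ (S.ι X) = S.I η (S.ι X)) → ξ = η := fun ξ η h =>
    S.pair_ext _ _ fun X => S.j_injective (by rw [← S.I_ι, ← S.I_ι, h])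
  -- The bracket is a derived bracket, ι_{[ξ,η]} = [L_ξ, ι_η]. Bilinearity, the Jacobi identity and
  -- the Leibniz rule are read off from this operator identity.
  have hbI : ∀ ξ η s, S.I (b ξ η) s = S.lieDer d ξ (S.I η s) - S.I η (S.lieDer d ξ s) :=
    fun ξ η s => by rw [LI]; abel
  have hskew : ∀ ξ η, b ξ η = -b η ξ := fun ξ η => Iext _ _ fun X => by
    rw [map_neg, LinearMap.neg_apply, S.I_ι, S.I_ι, ← map_neg]
    congr 1
    have h1 : c ξ η X = -c η ξ X := S.j_injective (by rw [map_neg, hc, hc, S.I_I])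
    rw [hb, hb, h1]
    ring
  have hLadd : ∀ ξ η s, S.lieDer d (ξ + η) s = S.lieDer d ξ s + S.lieDer d η s := fun ξ η s => by
    simp [lieDer_apply]; abel
  have hLsmul : ∀ (r : ℝ) η s, S.lieDer d (r • η) s = r • S.lieDer d η s := fun ξ η s => by
    simp [lieDer_apply]
  -- Here d² = 0 enters: L commutes with d, so Cartan's identity for ι carries over to L = [ι, d].
  have hLb : ∀ ξ η s, S.lieDer d (b ξ η) s =
      S.lieDer d ξ (S.lieDer d η s) - S.lieDer d η (S.lieDer d ξ s) := fun ξ η s => by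
    have h1 := lieDer_apply S d η s
    rw [lieDer_apply, hbI, hbI, h1, map_add, map_sub, Ld, ← Ld ξ (S.I η s),
      lieDer_apply S d η (S.lieDer d ξ s)]
    abel
  refine ⟨{
    br := LinearMap.mk₂ ℝ b (fun ξ η ζ => Iext _ _ fun X => ?_) (fun r ξ η => Iext _ _ fun X => ?_)
      (fun ξ η ζ => Iext _ _ fun X => ?_) (fun r ξ η => Iext _ _ fun X => ?_)
    D := LinearMap.mk₂ ℝ D (fun X Y Z => S.j_injective (by simp [hD]))
      (fun r X Y => S.j_injective (by simp [hD])) Dadd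
      (fun r X Y => S.j_injective (by simp [hD]))
    skew := hskew
    jacobi := fun ξ η ζ => Iext _ _ fun X => ?_
    leibniz := fun ξ f η => Iext _ _ fun X => ?_
    D_mul := Dmul
    D_smul := Dsmul'
    D_br := fun X Y f => S.j_injective ?_ }, hd, hdd, hD', hb'⟩
  · simp only [hbI, map_add, LinearMap.add_apply, hLadd]
    abel
  · simp only [hbI, map_smul, LinearMap.smul_apply, hLsmul, smul_sub]
  · simp only [hbI, map_add, LinearMap.add_apply]
    abel
  · simp only [hbI, map_smul, LinearMap.smul_apply, smul_sub]
  · simp only [LinearMap.mk₂_apply]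
    rw [hskew ζ, hskew ζ]
    simp only [map_add, map_neg, LinearMap.add_apply, LinearMap.neg_apply, map_zero,
      LinearMap.zero_apply, hbI, map_sub, hLb]
    abel
  · simp only [LinearMap.mk₂_apply, hbI, map_add, LinearMap.add_apply, S.I_smul,
      S.der_smul (S.lieDer_der hd ξ), Lj, mul_sub]
    abel
  · simp only [LinearMap.mk₂_apply]
    rw [← hD', hbI, hD', Lj, Ld, Lj, hD', map_sub]

end ExteriorCalculus

end Differential

end HomBundles

namespace HomBundles

/-! ### The derivation rule of the differential for the bracket -/

section Strong

variable {C Γ Γ' B : Type*} [CommRing C] [Algebra ℝ C]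
  [AddCommGroup Γ] [Module ℝ Γ] [Module C Γ] [AddCommGroup Γ'] [Module ℝ Γ'] [Module C Γ']
  [Ring B] [Algebra ℝ B]

/-- The defect of the derivation rule of `d` for the bracket. -/
def strongDefect (br : B →ₗ[ℝ] B →ₗ[ℝ] B) (d : B →ₗ[ℝ] B) (i : ℕ) (a : B) : B →ₗ[ℝ] B :=
  (d ∘ₗ br a - (-1 : ℝ) ^ ((2 + 1) * (i + 1)) • (br a ∘ₗ d)) - br (d a)

theorem strongDefect_apply (br : B →ₗ[ℝ] B →ₗ[ℝ] B) (d : B →ₗ[ℝ] B) (i : ℕ) (a b : B) :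
    strongDefect br d i a b = d (br a b) - (br (d a) b + (-1 : ℝ) ^ (i + 1) • br a (d b)) := by
  have : (-1 : ℝ) ^ ((2 + 1) * (i + 1)) = (-1 : ℝ) ^ (i + 1) := by
    rw [pow_mul]; norm_num
  simp only [strongDefect, this, LinearMap.sub_apply, LinearMap.comp_apply, LinearMap.smul_apply]
  abel

namespace ExteriorCalculus

variable {S : ExteriorCalculus C Γ Γ' B} {br : B →ₗ[ℝ] B →ₗ[ℝ] B} {d : B →ₗ[ℝ] B}

theorem strongDefect_der (h : IsHomGerstenhaber S.deg br (AlgHom.id ℝ B))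
    (hd : IsGradedDerivation S.deg 2 d) {i : ℕ} {a : B} (ha : a ∈ S.deg i) :
    IsGradedDerivation S.deg (i + 1) (strongDefect br d i a) :=
  (hd.commutator (by omega) (h.isGradedDerivation ha)).sub
    (h.isGradedDerivation (hd.mem i (i + 1) (by omega) a ha))

/-- All brackets involved are skew, hence so is the defect. This transfers vanishing from one
argument to the other. -/
theorem strongDefect_skew (h : IsHomGerstenhaber S.deg br (AlgHom.id ℝ B))
    (hd : IsGradedDerivation S.deg 2 d) {i k : ℕ} {a b : B} (ha : a ∈ S.deg i) (hb : b ∈ S.deg k) :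
    strongDefect br d i a b = -((-1 : ℝ) ^ ((i + 1) * (k + 1)) • strongDefect br d k b a) := by
  rw [strongDefect_apply, strongDefect_apply, h.bracket_skew i k a ha b hb,
    h.bracket_skew (i + 1) k _ (hd.mem i (i + 1) (by omega) a ha) b hb,
    h.bracket_skew i (k + 1) a ha _ (hd.mem k (k + 1) (by omega) b hb)]
  simp only [map_neg, map_smul, smul_sub, smul_add, smul_neg, smul_smul]
  simp only [neg_one_pow_eq_ite, parity_simps]
  by_cases h1 : Even i <;> by_cases h2 : Even k <;> simp [*] <;> abel

/-- The derivation rule of `d` for the bracket follows from the rule for elements of degree `1`, if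
multiplication by the elements of degree `1` separates the elements of degree `0` and `1`. -/
theorem strongDefect_eq_zero (h : IsHomGerstenhaber S.deg br (AlgHom.id ℝ B))
    (hd : IsGradedDerivation S.deg 2 d)
    (hW₁ : ∀ v ∈ S.deg 1, (∀ X, v * S.ι X = 0) → v = 0)
    (hW₀ : (∀ v ∈ S.deg 0, (∀ X, v * S.ι X = 0) → v = 0) ∨ ∀ v ∈ S.deg 1, v = 0)
    (hXY : ∀ X Y, strongDefect br d 1 (S.ι X) (S.ι Y) = 0) {i : ℕ} {a : B} (ha : a ∈ S.deg i) :
    strongDefect br d i a = 0 := by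
  have hder := fun {i : ℕ} {a : B} (ha : a ∈ S.deg i) => strongDefect_der h hd ha
  have uniq : ∀ {i : ℕ} {a : B}, a ∈ S.deg i → (∀ f, strongDefect br d i a (S.j f) = 0) →
      (∀ X, strongDefect br d i a (S.ι X) = 0) → strongDefect br d i a = 0 :=
    fun ha h0 h1 => S.uniq _ _ (hder ha).leibniz h0 h1
  have hX : ∀ X, strongDefect br d 1 (S.ι X) = 0 := fun X => uniq (S.ι_mem X) (fun f => by
    -- From 0 = Δ_X(fY) = Δ_X(f) Y + f Δ_X(Y) and Δ_X(Y) = 0, the element Δ_X(f) of degree 1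
    -- annihilates every Y.
    refine hW₁ _ ((hder (S.ι_mem X)).mem 0 1 rfl _ (S.j_mem f)) fun Y => ?_
    have := S.der_smul (hder (S.ι_mem X)) f (S.ι Y)
    rwa [← S.ι_smul, hXY, hXY, mul_zero, add_zero, eq_comm] at this) (hXY X)
  have hf : ∀ f, strongDefect br d 0 (S.j f) = 0 := fun f => by
    have hfX : ∀ X, strongDefect br d 0 (S.j f) (S.ι X) = 0 := fun X => by
      rw [strongDefect_skew h hd (S.j_mem f) (S.ι_mem X), hX]
      simp
    refine uniq (S.j_mem f) (fun g => ?_) hfX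
    -- The same device in degree 0. If instead degree 1 is trivial, then d kills functions and all
    -- terms are zero.
    rcases hW₀ with hW₀ | hW₀
    · refine hW₀ _ ((hder (S.j_mem f)).mem 0 0 rfl _ (S.j_mem g)) fun Y => ?_
      have := S.der_smul (hder (S.j_mem f)) g (S.ι Y)
      rwa [← S.ι_smul, hfX, hfX, mul_zero, add_zero, eq_comm] at this
    · have hd0 : ∀ f, d (S.j f) = 0 := fun f => hW₀ _ (hd.mem 0 1 rfl _ (S.j_mem f))
      rw [strongDefect_apply, hd0, hd0, h.bracket_zero_zero _ (S.j_mem f) _ (S.j_mem g)]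
      simp
  -- For arbitrary a, the values of Δ_a on generators are, up to sign, Δ_f(a) and Δ_X(a).
  refine uniq ha (fun f => ?_) (fun X => ?_)
  · rw [strongDefect_skew h hd ha (S.j_mem f), hf]
    simp
  · rw [strongDefect_skew h hd ha (S.ι_mem X), hX]
    simp

theorem isDifferentialHomGerstenhaber (h : IsHomGerstenhaber S.deg br (AlgHom.id ℝ B))
    (hd : IsGradedDerivation S.deg 2 d) (hdd : ∀ a, d (d a) = 0) :
    IsDifferentialHomGerstenhaber S.deg br (AlgHom.id ℝ B) d where
  toIsHomGerstenhaber := h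
  d_mem i a ha := hd.mem i (i + 1) (by omega) a ha
  d_mul i j a ha b hb := by
    have : (-1 : ℝ) ^ ((2 + 1) * i) = (-1 : ℝ) ^ i := by
      rw [pow_mul]; norm_num
    simpa [this] using hd.leibniz i a ha b
  d_d := hdd
  d_map _ := rfl

end ExteriorCalculus

theorem IsDifferentialHomGerstenhaber.isGradedDerivation {𝒜 : ℕ → Submodule ℝ B}
    {br : B →ₗ[ℝ] B →ₗ[ℝ] B} {d : B →ₗ[ℝ] B}
    (h : IsDifferentialHomGerstenhaber 𝒜 br (AlgHom.id ℝ B) d) : IsGradedDerivation 𝒜 2 d := by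
  refine .of_homogeneous h.toIsGradedCommutativeAlgebra (fun i k hk a ha => ?_) (by simp)
    (fun i k a ha b hb => ?_)
  · obtain rfl : k = i + 1 := by omega
    exact h.d_mem i a ha
  · have : (-1 : ℝ) ^ ((2 + 1) * i) = (-1 : ℝ) ^ i := by
      rw [pow_mul]; norm_num
    simpa [this] using h.d_mul i k a ha b hb

end Strong

/-! ### Automorphisms of the calculus and invariant structures -/

section Automorphism

variable {C Γ Γ' B : Type*} [CommRing C] [Algebra ℝ C]
  [AddCommGroup Γ] [Module ℝ Γ] [Module C Γ] [AddCommGroup Γ'] [Module ℝ Γ'] [Module C Γ']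
  [Ring B] [Algebra ℝ B]

/-- Automorphisms of the calculus of an exterior algebra. -/
structure ExteriorCalculus.Automorphism (S : ExteriorCalculus C Γ Γ' B) where
  /-- the automorphism of the exterior algebra -/
  α : B ≃ₐ[ℝ] B
  /-- the automorphism of the scalars -/
  ψ : C → C
  /-- the automorphism of the module -/
  β : Γ → Γ
  /-- the automorphism of the dual module -/
  β' : Γ' → Γ'
  mem : ∀ i, ∀ a ∈ S.deg i, α a ∈ S.deg i
  symm_mem : ∀ i, ∀ a ∈ S.deg i, α.symm a ∈ S.deg i
  map_j : ∀ f, α (S.j f) = S.j (ψ f)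
  map_ι : ∀ X, α (S.ι X) = S.ι (β X)
  pair_map : ∀ X ξ, S.pair (β X) (β' ξ) = ψ (S.pair X ξ)

/-- The compatibility of a Lie-Rinehart structure with a pair of maps. -/
structure LieRinehart.IsInvariant (ℓ : LieRinehart C Γ) (ψ : C → C) (β : Γ → Γ) : Prop where
  br : ∀ X Y, ℓ.br (β X) (β Y) = β (ℓ.br X Y)
  D : ∀ X f, ℓ.D (β X) (ψ f) = ψ (ℓ.D X f)

namespace ExteriorCalculus.Automorphism

variable {S : ExteriorCalculus C Γ Γ' B} (Φ : S.Automorphism)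

/-- Conjugating a contraction by the automorphism gives a derivation of degree -1, which
preservation of the pairing identifies on generators. -/
theorem I_map (ξ : Γ') (s : B) : S.I (Φ.β' ξ) (Φ.α s) = Φ.α (S.I ξ s) := by
  have := LinearMap.congr_fun (S.derivation_ext ((S.I_der (Φ.β' ξ)).conj Φ.α Φ.mem Φ.symm_mem)
    (S.I_der ξ) (fun f => ?_) (fun X => ?_)) s
  · rw [← this]; simp
  · simp [Φ.map_j, S.I_j]
  · simp [Φ.map_ι, S.I_ι, Φ.pair_map, ← Φ.map_j]

theorem contr_map (k : ℕ) (ξ : Fin k → Γ') (s : B) :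
    S.contr k (fun i => Φ.β' (ξ i)) (Φ.α s) = Φ.α (S.contr k ξ s) := by
  induction k generalizing s with
  | zero => rfl
  | succ k ih => rw [contr_succ, contr_succ, I_map, ← ih]; rfl

/-- The bracket transported by the automorphism is again a Gerstenhaber bracket, and by invariance
it extends the same Lie-Rinehart structure. Uniqueness of the Schouten bracket concludes. -/
theorem bracket_map {ℓ : LieRinehart C Γ} (hℓ : ℓ.IsInvariant Φ.ψ Φ.β) {br : B →ₗ[ℝ] B →ₗ[ℝ] B}
    (h : S.IsSchouten ℓ br) (a b : B) : Φ.α (br a b) = br (Φ.α a) (Φ.α b) := by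
  let br' : B →ₗ[ℝ] B →ₗ[ℝ] B :=
    (br.compl₁₂ Φ.α.toLinearMap Φ.α.toLinearMap).compr₂ Φ.α.symm.toLinearMap
  have hbr' : ∀ a b, br' a b = Φ.α.symm (br (Φ.α a) (Φ.α b)) := fun _ _ => rfl
  have h' : S.IsSchouten ℓ br' := by
    have g := h.gerstenhaber
    refine ⟨⟨S.gca, fun i a ha => ha, fun i j k hk a ha b hb => ?_, fun a ha b hb => ?_,
      fun i j a ha b hb => ?_, fun _ _ => rfl, fun i j k a ha b hb c hc => ?_,
      fun i j k a ha b hb c hc => ?_⟩, fun X Y => ?_, fun X f => ?_⟩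
    · exact Φ.symm_mem _ _ (g.bracket_mem i j k hk _ (Φ.mem _ _ ha) _ (Φ.mem _ _ hb))
    · rw [hbr', g.bracket_zero_zero _ (Φ.mem _ _ ha) _ (Φ.mem _ _ hb), map_zero]
    · rw [hbr', g.bracket_skew i j _ (Φ.mem _ _ ha) _ (Φ.mem _ _ hb)]
      simp [hbr']
    · have := g.jacobi i j k _ (Φ.mem _ _ ha) _ (Φ.mem _ _ hb) _ (Φ.mem _ _ hc)
      simpa [hbr'] using congrArg Φ.α.symm this
    · have := g.leibniz i j k _ (Φ.mem _ _ ha) _ (Φ.mem _ _ hb) _ (Φ.mem _ _ hc)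
      simpa [hbr'] using congrArg Φ.α.symm this
    · rw [hbr', Φ.map_ι, Φ.map_ι, h.ι_ι, hℓ.br, ← Φ.map_ι, AlgEquiv.symm_apply_apply]
    · rw [hbr', Φ.map_ι, Φ.map_j, h.ι_j, hℓ.D, ← Φ.map_j, AlgEquiv.symm_apply_apply]
  rw [h.unique S h', hbr', AlgEquiv.apply_symm_apply, ← h.unique S h']

theorem isInvariant_of_bracket {ℓ : LieRinehart C Γ} {br : B →ₗ[ℝ] B →ₗ[ℝ] B}
    (h : S.IsSchouten ℓ br) (hα : ∀ a b, Φ.α (br a b) = br (Φ.α a) (Φ.α b)) :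
    ℓ.IsInvariant Φ.ψ Φ.β where
  br X Y := S.ι_injective (by rw [← h.ι_ι, ← Φ.map_ι, ← Φ.map_ι, ← hα, h.ι_ι, Φ.map_ι])
  D X f := S.j_injective (by rw [← h.ι_j, ← Φ.map_ι, ← Φ.map_j, ← hα, h.ι_j, Φ.map_j])

/-- The conjugate of d is a differential of the same invariant Lie-Rinehart structure, so it equals
d. -/
theorem d_map {ℓ : LieRinehart C Γ'} (hℓ : ℓ.IsInvariant Φ.ψ Φ.β') {d : B →ₗ[ℝ] B}
    (h : S.IsDifferential ℓ d) (hψ : ∀ f g, Φ.ψ (f - g) = Φ.ψ f - Φ.ψ g) (a : B) :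
    Φ.α (d a) = d (Φ.α a) := by
  have hI : ∀ ξ s, S.I ξ (Φ.α.symm s) = Φ.α.symm (S.I (Φ.β' ξ) s) := fun ξ s => by
    rw [← Φ.α.symm_apply_apply (S.I ξ (Φ.α.symm s)), ← Φ.I_map, AlgEquiv.apply_symm_apply]
  have h' : S.IsDifferential ℓ (Φ.α.symm.toLinearMap ∘ₗ d ∘ₗ Φ.α.toLinearMap) := by
    refine ⟨h.der.conj Φ.α Φ.mem Φ.symm_mem, fun a => by simp [h.d_d], fun ξ f => ?_,
      fun ξ η X => ?_⟩
    · simp [hI, Φ.map_j, h.I_d_j, hℓ.D]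
      rw [← Φ.map_j, AlgEquiv.symm_apply_apply]
    · simp only [LinearMap.comp_apply, AlgEquiv.toLinearMap_apply, hI, Φ.map_ι, h.I_I_d_ι,
        Φ.pair_map, hℓ.D, hℓ.br]
      rw [← hψ, ← hψ, ← Φ.map_j, AlgEquiv.symm_apply_apply]
  have := LinearMap.congr_fun (h.unique h') a
  rw [this]
  simp

theorem isInvariant_of_d {ℓ : LieRinehart C Γ'} {d : B →ₗ[ℝ] B}
    (h : S.IsDifferential ℓ d) (hψ : ∀ f g, Φ.ψ (f - g) = Φ.ψ f - Φ.ψ g)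
    (hβ : Function.Surjective Φ.β) (hα : ∀ a, Φ.α (d a) = d (Φ.α a)) :
    ℓ.IsInvariant Φ.ψ Φ.β' := by
  have hD : ∀ ξ f, ℓ.D (Φ.β' ξ) (Φ.ψ f) = Φ.ψ (ℓ.D ξ f) := fun ξ f => S.j_injective (by
    rw [← h.I_d_j, ← Φ.map_j, ← hα, Φ.I_map, h.I_d_j, Φ.map_j])
  refine ⟨fun ξ η => S.pair_ext _ _ fun Y => ?_, hD⟩
  -- Invariance of the pairing gives information only on arguments of the form βX; surjectivity
  -- makes these all of Γ.
  obtain ⟨X, rfl⟩ := hβ Y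
  have h1 := h.I_I_d_ι (Φ.β' ξ) (Φ.β' η) (Φ.β X)
  rw [← Φ.map_ι, ← hα, Φ.I_map, Φ.I_map, h.I_I_d_ι, Φ.map_j, Φ.pair_map, Φ.pair_map, hD, hD, hψ,
    hψ] at h1
  rw [Φ.pair_map]
  exact (sub_right_inj.1 (S.j_injective h1)).symm

end ExteriorCalculus.Automorphism

end Automorphism

end HomBundles

namespace HomBundles

/-! ### Multivectors on a vector space: degrees and contractions -/

section LinearAlgebra

variable {V W : Type*} [AddCommGroup V] [Module ℝ V] [AddCommGroup W] [Module ℝ W]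

theorem exteriorPower_induction {P : ℕ → ExteriorAlgebra ℝ V → Prop}
    (h0 : ∀ r, P 0 (algebraMap ℝ _ r)) (hadd : ∀ k a b, P k a → P k b → P k (a + b))
    (hmul : ∀ k v, ∀ a ∈ ⋀[ℝ]^k V, P k a → P (k + 1) (ExteriorAlgebra.ι ℝ v * a))
    {k : ℕ} {a : ExteriorAlgebra ℝ V} (ha : a ∈ ⋀[ℝ]^k V) : P k a := by
  have key : ∀ k, ∀ a ∈ (LinearMap.range (ExteriorAlgebra.ι ℝ : V →ₗ[ℝ] _)) ^ k, P k a := by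
    intro k
    induction k with
    | zero =>
      intro a ha
      rw [pow_zero, Submodule.mem_one] at ha
      obtain ⟨r, rfl⟩ := ha
      exact h0 r
    | succ k ih =>
      intro a ha
      rw [pow_succ'] at ha
      refine Submodule.mul_induction_on ha ?_ (fun x y => hadd _ x y)
      rintro _ ⟨v, rfl⟩ b hb
      exact hmul k v b hb (ih b hb)
  exact key k a ha

theorem ι_mul_mem_exteriorPower {k : ℕ} {a : ExteriorAlgebra ℝ V} (ha : a ∈ ⋀[ℝ]^k V) (v : V) :
    ExteriorAlgebra.ι ℝ v * a ∈ ⋀[ℝ]^(k + 1) V := by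
  have := Submodule.mul_mem_mul (LinearMap.mem_range_self (ExteriorAlgebra.ι ℝ) v) ha
  rwa [← pow_succ'] at this

theorem mul_mem_exteriorPower {i j : ℕ} {a b : ExteriorAlgebra ℝ V} (ha : a ∈ ⋀[ℝ]^i V)
    (hb : b ∈ ⋀[ℝ]^j V) : a * b ∈ ⋀[ℝ]^(i + j) V := by
  have := Submodule.mul_mem_mul ha hb
  rwa [← pow_add] at this

theorem mem_exteriorPower_zero {a : ExteriorAlgebra ℝ V} :
    a ∈ ⋀[ℝ]^0 V ↔ ∃ r, algebraMap ℝ _ r = a := by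
  change a ∈ (LinearMap.range (ExteriorAlgebra.ι ℝ : V →ₗ[ℝ] _)) ^ 0 ↔ _
  rw [pow_zero, Submodule.mem_one]

theorem mem_exteriorPower_one {a : ExteriorAlgebra ℝ V} :
    a ∈ ⋀[ℝ]^1 V ↔ ∃ v, ExteriorAlgebra.ι ℝ v = a := by
  change a ∈ (LinearMap.range (ExteriorAlgebra.ι ℝ : V →ₗ[ℝ] _)) ^ 1 ↔ _
  rw [pow_one, LinearMap.mem_range]

theorem map_mem_exteriorPower (f : V →ₗ[ℝ] W) {k : ℕ} {a : ExteriorAlgebra ℝ V}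
    (ha : a ∈ ⋀[ℝ]^k V) : ExteriorAlgebra.map f a ∈ ⋀[ℝ]^k W := by
  refine exteriorPower_induction (P := fun k a => ExteriorAlgebra.map f a ∈ ⋀[ℝ]^k W)
    (fun r => ?_) (fun k a b h h' => ?_) (fun k v a _ h => ?_) ha
  · exact mem_exteriorPower_zero.2 ⟨r, by simp⟩
  · rw [map_add]; exact add_mem h h'
  · rw [map_mul, ExteriorAlgebra.map_apply_ι]; exact ι_mul_mem_exteriorPower h _

theorem ι_mul_comm_exteriorPower (v : V) {k : ℕ} {a : ExteriorAlgebra ℝ V} (ha : a ∈ ⋀[ℝ]^k V) :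
    ExteriorAlgebra.ι ℝ v * a = (-1 : ℝ) ^ k • (a * ExteriorAlgebra.ι ℝ v) := by
  refine exteriorPower_induction (P := fun k a =>
    ExteriorAlgebra.ι ℝ v * a = (-1 : ℝ) ^ k • (a * ExteriorAlgebra.ι ℝ v))
    (fun r => ?_) (fun k a b h h' => ?_) (fun k w a _ h => ?_) ha
  · simp [Algebra.commutes]
  · rw [mul_add, add_mul, h, h', smul_add]
  · have hs : ExteriorAlgebra.ι ℝ v * ExteriorAlgebra.ι ℝ w =
        -(ExteriorAlgebra.ι ℝ w * ExteriorAlgebra.ι ℝ v) :=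
      eq_neg_of_add_eq_zero_left (ExteriorAlgebra.ι_add_mul_swap v w)
    rw [← mul_assoc, hs, neg_mul, mul_assoc, h, mul_smul_comm, mul_assoc, pow_succ]
    simp

theorem mul_comm_exteriorPower {i j : ℕ} {a b : ExteriorAlgebra ℝ V} (ha : a ∈ ⋀[ℝ]^i V)
    (hb : b ∈ ⋀[ℝ]^j V) : a * b = (-1 : ℝ) ^ (i * j) • (b * a) := by
  refine exteriorPower_induction (P := fun i a => a * b = (-1 : ℝ) ^ (i * j) • (b * a))
    (fun r => ?_) (fun k a b h h' => ?_) (fun k v a _ h => ?_) ha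
  · simp [Algebra.commutes]
  · rw [mul_add, add_mul, h, h', smul_add]
  · rw [mul_assoc, h, mul_smul_comm, ← mul_assoc, ι_mul_comm_exteriorPower v hb, smul_mul_assoc,
      smul_smul, ← pow_add, mul_assoc, add_mul, one_mul]

/-- The contraction of multivectors with a covector. -/
def contractMultivector : Module.Dual ℝ V →ₗ[ℝ] ExteriorAlgebra ℝ V →ₗ[ℝ] ExteriorAlgebra ℝ V :=
  CliffordAlgebra.contractLeft

theorem contractMultivector_ι (φ : Module.Dual ℝ V) (v : V) :
    contractMultivector φ (ExteriorAlgebra.ι ℝ v) = algebraMap ℝ _ (φ v) :=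
  CliffordAlgebra.contractLeft_ι 0 φ v

theorem contractMultivector_algebraMap (φ : Module.Dual ℝ V) (r : ℝ) :
    contractMultivector φ (algebraMap ℝ _ r) = 0 :=
  CliffordAlgebra.contractLeft_algebraMap 0 φ r

theorem contractMultivector_ι_mul (φ : Module.Dual ℝ V) (v : V) (a : ExteriorAlgebra ℝ V) :
    contractMultivector φ (ExteriorAlgebra.ι ℝ v * a) =
      φ v • a - ExteriorAlgebra.ι ℝ v * contractMultivector φ a :=
  CliffordAlgebra.contractLeft_ι_mul φ v a

theorem contractMultivector_comm (φ χ : Module.Dual ℝ V) (a : ExteriorAlgebra ℝ V) :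
    contractMultivector φ (contractMultivector χ a) =
      -contractMultivector χ (contractMultivector φ a) :=
  CliffordAlgebra.contractLeft_comm φ χ a

theorem contractMultivector_mem (φ : Module.Dual ℝ V) {k : ℕ} {a : ExteriorAlgebra ℝ V}
    (ha : a ∈ ⋀[ℝ]^(k + 1) V) : contractMultivector φ a ∈ ⋀[ℝ]^k V := by
  -- Subtraction is truncated, so vanishing in degree 0 is carried along; it is needed for v ∧ ι_φ a
  -- with a scalar.
  have key := exteriorPower_induction (P := fun k a => contractMultivector φ a ∈ ⋀[ℝ]^(k - 1) V ∧
    (k = 0 → contractMultivector φ a = 0)) (fun r => ?_) (fun k a b h h' => ?_)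
    (fun k v a hk h => ?_) ha
  · exact key.1
  · rw [contractMultivector_algebraMap]
    exact ⟨zero_mem _, fun _ => rfl⟩
  · refine ⟨?_, fun hk => ?_⟩
    · rw [map_add]; exact add_mem h.1 h'.1
    · rw [map_add, h.2 hk, h'.2 hk, add_zero]
  · refine ⟨?_, fun hk => by simp at hk⟩
    rw [contractMultivector_ι_mul, Nat.add_sub_cancel]
    refine sub_mem (Submodule.smul_mem _ _ hk) ?_
    rcases k with _ | k
    · rw [h.2 rfl, mul_zero]; exact zero_mem _
    · exact ι_mul_mem_exteriorPower h.1 v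

theorem contractMultivector_zero (φ : Module.Dual ℝ V) {a : ExteriorAlgebra ℝ V}
    (ha : a ∈ ⋀[ℝ]^0 V) : contractMultivector φ a = 0 := by
  obtain ⟨r, rfl⟩ := mem_exteriorPower_zero.1 ha
  exact contractMultivector_algebraMap φ r

theorem contractMultivector_mul (φ : Module.Dual ℝ V) {k : ℕ} {a : ExteriorAlgebra ℝ V}
    (ha : a ∈ ⋀[ℝ]^k V) (b : ExteriorAlgebra ℝ V) :
    contractMultivector φ (a * b) =
      contractMultivector φ a * b + (-1 : ℝ) ^ k • (a * contractMultivector φ b) := by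
  refine exteriorPower_induction (P := fun k a => contractMultivector φ (a * b) =
      contractMultivector φ a * b + (-1 : ℝ) ^ k • (a * contractMultivector φ b))
    (fun r => ?_) (fun k a b h h' => ?_) (fun k v a _ h => ?_) ha
  · rw [contractMultivector_algebraMap, ← Algebra.smul_def, ← Algebra.smul_def, map_smul]
    simp
  · simp only [add_mul, map_add, smul_add, h, h']
    abel
  · rw [mul_assoc, contractMultivector_ι_mul, h, contractMultivector_ι_mul, pow_succ, mul_add,
      sub_mul, smul_mul_assoc, mul_smul_comm, mul_assoc, mul_assoc]
    simp only [mul_neg, mul_one, neg_smul]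
    abel

theorem contractMultivector_map (f : V →ₗ[ℝ] W) (φ : Module.Dual ℝ W) (a : ExteriorAlgebra ℝ V) :
    contractMultivector φ (ExteriorAlgebra.map f a) =
      ExteriorAlgebra.map f (contractMultivector (φ ∘ₗ f) a) := by
  refine CliffordAlgebra.left_induction (Q := (0 : QuadraticForm ℝ V)) (P := fun a =>
    contractMultivector φ (ExteriorAlgebra.map f a) =
      ExteriorAlgebra.map f (contractMultivector (φ ∘ₗ f) a)) (fun r => ?_) (fun a b h h' => ?_)
    (fun a v h => ?_) a
  · have h1 : ExteriorAlgebra.map f (algebraMap ℝ _ r) = algebraMap ℝ _ r := AlgHom.commutes _ r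
    have h2 := contractMultivector_algebraMap (φ ∘ₗ f) r
    exact (congrArg (contractMultivector φ) h1).trans ((contractMultivector_algebraMap φ r).trans
      ((congrArg (ExteriorAlgebra.map f) h2).trans (map_zero _)).symm)
  · rw [map_add, map_add, h, h', map_add, map_add]
  · change contractMultivector φ (ExteriorAlgebra.map f (ExteriorAlgebra.ι ℝ v * a)) =
      ExteriorAlgebra.map f (contractMultivector (φ ∘ₗ f) (ExteriorAlgebra.ι ℝ v * a))
    rw [map_mul, ExteriorAlgebra.map_apply_ι, contractMultivector_ι_mul, h,
      contractMultivector_ι_mul, map_sub, map_smul, map_mul, ExteriorAlgebra.map_apply_ι]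
    rfl

/-- Euler's formula: the operator ∑ v_i ∧ ι_{φ_i} is a derivation and acts on vectors as r, hence on
Λ^k as kr. The scalar r leaves room for frames cut off by a bump function. -/
theorem sum_ι_mul_contractMultivector {κ : Type*} [Fintype κ] (v : κ → V)
    (φ : κ → Module.Dual ℝ V) (r : ℝ) (h : ∀ w, ∑ i, φ i w • v i = r • w) {k : ℕ}
    {a : ExteriorAlgebra ℝ V} (ha : a ∈ ⋀[ℝ]^k V) :
    ∑ i, ExteriorAlgebra.ι ℝ (v i) * contractMultivector (φ i) a = ((k : ℝ) * r) • a := by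
  refine exteriorPower_induction (P := fun k a =>
    ∑ i, ExteriorAlgebra.ι ℝ (v i) * contractMultivector (φ i) a = ((k : ℝ) * r) • a)
    (fun s => ?_) (fun k a b h h' => ?_) (fun k w a _ ih => ?_) ha
  · simp [contractMultivector_algebraMap]
  · simp only [map_add, mul_add, Finset.sum_add_distrib, smul_add, h, h']
  · have h1 : ∀ i, ExteriorAlgebra.ι ℝ (v i) * contractMultivector (φ i) (ExteriorAlgebra.ι ℝ w * a)
        = ExteriorAlgebra.ι ℝ (φ i w • v i) * a +
          ExteriorAlgebra.ι ℝ w * (ExteriorAlgebra.ι ℝ (v i) * contractMultivector (φ i) a) := by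
      intro i
      have hs : ExteriorAlgebra.ι ℝ (v i) * ExteriorAlgebra.ι ℝ w =
          -(ExteriorAlgebra.ι ℝ w * ExteriorAlgebra.ι ℝ (v i)) :=
        eq_neg_of_add_eq_zero_left (ExteriorAlgebra.ι_add_mul_swap _ _)
      rw [contractMultivector_ι_mul, mul_sub, ← mul_assoc, hs, map_smul, mul_smul_comm,
        smul_mul_assoc, neg_mul, sub_neg_eq_add, mul_assoc]
    rw [Finset.sum_congr rfl fun i _ => h1 i, Finset.sum_add_distrib, ← Finset.mul_sum, ih,
      ← Finset.sum_mul, ← map_sum, h, map_smul, smul_mul_assoc, mul_smul_comm, ← add_smul]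
    push_cast
    congr 1
    ring

end LinearAlgebra

end HomBundles

namespace HomBundles

/-! ### Sections, tensorial maps and global dual frames -/

noncomputable section Sections

variable (E : Type*) [NormedAddCommGroup E] [NormedSpace ℝ E]
  (M : Type*) [TopologicalSpace M] [ChartedSpace E M]
  (F : Type*) [NormedAddCommGroup F] [NormedSpace ℝ F]
  (A : M → Type*) [TopologicalSpace (TotalSpace F A)]
  [∀ x, AddCommGroup (A x)] [∀ x, Module ℝ (A x)] [∀ x, TopologicalSpace (A x)]
  [FiberBundle F A] [VectorBundle ℝ F A]

/-- Smooth functions. -/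
abbrev Fn := C^∞⟮𝓘(ℝ, E), M; ℝ⟯

variable {M}

/-- Smooth sections. -/
abbrev Sec := Cₛ^∞⟮𝓘(ℝ, E); F, A⟯

/-- Smooth sections of the dual bundle. -/
abbrev DualSec [∀ x, IsTopologicalAddGroup (A x)] [∀ x, ContinuousSMul ℝ (A x)] :=
  Cₛ^∞⟮𝓘(ℝ, E); F →L[ℝ] ℝ, (fun x => A x →L[ℝ] ℝ)⟯

variable {E F A}

@[simp]
theorem sec_sum_apply {κ : Type*} (t : Finset κ) (T : κ → Sec E F A) (y : M) :
    (∑ i ∈ t, T i) y = ∑ i ∈ t, T i y := by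
  have := congrFun (map_sum (ContMDiffSection.coeAddHom 𝓘(ℝ, E) F ∞ A) T t) y
  simpa only [Finset.sum_apply, ContMDiffSection.coeAddHom_apply] using this

@[simp]
theorem fn_sum_apply {κ : Type*} (t : Finset κ) (T : κ → Fn E M) (y : M) :
    (∑ i ∈ t, T i) y = ∑ i ∈ t, T i y := by
  classical
  induction t using Finset.induction_on with
  | empty => rfl
  | insert a t ha ih =>
    rw [Finset.sum_insert ha, Finset.sum_insert ha, ← ih]
    rfl

variable [IsManifold 𝓘(ℝ, E) ∞ M] [ContMDiffVectorBundle ∞ F A 𝓘(ℝ, E)]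

instance : Module (Fn E M) (Sec E F A) where
  smul := fsmul
  one_smul X := by ext x; exact one_smul ℝ (X x)
  mul_smul f g X := by ext x; exact mul_smul (f x) (g x) (X x)
  smul_zero f := by ext x; exact smul_zero (f x)
  smul_add f X Y := by ext x; exact smul_add (f x) (X x) (Y x)
  add_smul f g X := by ext x; exact add_smul (f x) (g x) (X x)
  zero_smul X := by ext x; exact zero_smul ℝ (X x)

theorem fsmul_eq_smul (f : Fn E M) (X : Sec E F A) : fsmul f X = f • X := rfl

@[simp]
theorem fn_smul_apply (f : Fn E M) (X : Sec E F A) (x : M) : (f • X) x = f x • X x := rfl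

section Tensorial

variable [FiniteDimensional ℝ E] [T2Space M] [FiniteDimensional ℝ F]
  {W : Type*} [AddCommGroup W] [Module ℝ W] {x : M} {Φ : Sec E F A →ₗ[ℝ] W}

/-- With hX = ∑ c_i S_i, h(x) = 1 and c_i(x) = 0, tensoriality gives Φ X = ∑ c_i(x) Φ S_i = 0. -/
theorem eq_zero_of_tensorial (hΦ : ∀ (f : Fn E M) (X : Sec E F A), Φ (f • X) = f x • Φ X)
    {X : Sec E F A} (hX : X x = 0) : Φ X = 0 := by
  obtain ⟨S, -, hS⟩ := exists_global_frame (F := F) (A := A) (E := E) x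
  obtain ⟨h, c, h1, hc, h0⟩ := hS X
  have := congrArg Φ hc
  simp only [map_sum, fsmul_eq_smul, hΦ, h1, one_smul, h0 hX, zero_smul,
    Finset.sum_const_zero] at this
  exact this

/-- A map of sections which is tensorial at `x` factors through the fibre. -/
theorem exists_fiberMap (hΦ : ∀ (f : Fn E M) (X : Sec E F A), Φ (f • X) = f x • Φ X) :
    ∃ G : A x →ₗ[ℝ] W, ∀ X, G (X x) = Φ X := by
  have hval : ∀ (X Y : Sec E F A), X x = Y x → Φ X = Φ Y := by
    intro X Y h
    have := eq_zero_of_tensorial hΦ (X := X - Y) (by simp [h])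
    rwa [map_sub, sub_eq_zero] at this
  choose s hs using fun v : A x => exists_section (E := E) (F := F) x v
  refine ⟨{ toFun := fun v => Φ (s v), map_add' := fun v w => ?_, map_smul' := fun r v => ?_ },
    fun X => hval _ _ (hs _)⟩
  · rw [← map_add]
    exact hval _ _ (by simp [hs])
  · rw [RingHom.id_apply, ← map_smul]
    exact hval _ _ (by simp [hs])

end Tensorial

section HomBundle

variable [FiniteDimensional ℝ E] [T2Space M] [FiniteDimensional ℝ F]
  [∀ x, IsTopologicalAddGroup (A x)] [∀ x, ContinuousSMul ℝ (A x)]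
  {F₂ : Type*} [NormedAddCommGroup F₂] [NormedSpace ℝ F₂]
  {V : M → Type*} [TopologicalSpace (TotalSpace F₂ V)]
  [∀ x, AddCommGroup (V x)] [∀ x, Module ℝ (V x)] [∀ x, TopologicalSpace (V x)]
  [FiberBundle F₂ V] [VectorBundle ℝ F₂ V] [ContMDiffVectorBundle ∞ F₂ V 𝓘(ℝ, E)]
  [∀ x, IsTopologicalAddGroup (V x)] [∀ x, ContinuousSMul ℝ (V x)]

/-- A field of linear maps is smooth if it is so on every section. -/
theorem contMDiff_hom_of_apply {φ : M → M} (hφ : ContMDiff 𝓘(ℝ, E) 𝓘(ℝ, E) ∞ φ)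
    (G : ∀ x, A (φ x) →L[ℝ] V (φ x))
    (hG : ∀ X : Sec E F A, ContMDiff 𝓘(ℝ, E) (𝓘(ℝ, E).prod 𝓘(ℝ, F₂)) ∞
      (fun x => TotalSpace.mk' F₂ (E := V) (φ x) (G x (X (φ x))))) :
    ContMDiff 𝓘(ℝ, E) (𝓘(ℝ, E).prod 𝓘(ℝ, F →L[ℝ] F₂)) ∞
      (fun x => TotalSpace.mk' (F →L[ℝ] F₂) (E := fun y : M => A y →L[ℝ] V y) (φ x) (G x)) := by
  intro x₀
  rw [contMDiffAt_hom_bundle]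
  refine ⟨hφ x₀, ?_⟩
  obtain ⟨S, hS, -⟩ := exists_global_frame (F := F) (A := A) (E := E) (φ x₀)
  set e := trivializationAt F A (φ x₀) with he
  set e₂ := trivializationAt F₂ V (φ x₀) with he₂
  let b := Module.finBasis ℝ F
  have hx₀ : φ x₀ ∈ e.baseSet := FiberBundle.mem_baseSet_trivializationAt F A _
  have hx₂ : φ x₀ ∈ e₂.baseSet := FiberBundle.mem_baseSet_trivializationAt F₂ V _
  have hsm : ∀ i, ContMDiffAt 𝓘(ℝ, E) 𝓘(ℝ, F₂) ∞
      (fun x => (e₂ (TotalSpace.mk' F₂ (E := V) (φ x) (G x (S i (φ x))))).2) x₀ := fun i =>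
    ((contMDiffAt_totalSpace).1 (hG (S i) x₀)).2
  -- In coordinates the field is the sum of the dual basis covectors b^i tensored with the values of
  -- G on the frame.
  have hcoord : ∀ i, ContMDiffAt 𝓘(ℝ, E) 𝓘(ℝ, F →L[ℝ] F₂) ∞ (fun x =>
      (ContinuousLinearMap.smulRightL ℝ F F₂ (LinearMap.toContinuousLinearMap (b.coord i)))
        (e₂ (TotalSpace.mk' F₂ (E := V) (φ x) (G x (S i (φ x))))).2) x₀ := fun i =>
    ((ContinuousLinearMap.smulRightL ℝ F F₂
      (LinearMap.toContinuousLinearMap (b.coord i))).contMDiff.contMDiffAt).comp x₀ (hsm i)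
  have hsum : ContMDiffAt 𝓘(ℝ, E) 𝓘(ℝ, F →L[ℝ] F₂) ∞ (fun x => ∑ i,
      (ContinuousLinearMap.smulRightL ℝ F F₂ (LinearMap.toContinuousLinearMap (b.coord i)))
        (e₂ (TotalSpace.mk' F₂ (E := V) (φ x) (G x (S i (φ x))))).2) x₀ :=
    contMDiffAt_finsetSum fun i _ => hcoord i
  refine hsum.congr_of_eventuallyEq ?_
  have hcont := hφ.continuous.continuousAt (x := x₀)
  filter_upwards [hcont.eventually hS, hcont (e.open_baseSet.mem_nhds hx₀),
    hcont (e₂.open_baseSet.mem_nhds hx₂)] with x hx hxe hxe₂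
  refine ContinuousLinearMap.coe_inj.1 (b.ext fun j => ?_)
  have hSj : S j (φ x) = (e.continuousLinearEquivAt ℝ (φ x) hxe).symm (b j) := by
    rw [hx j, Bundle.Trivialization.localFrame_apply_of_mem_baseSet _ _ hxe]
    simp [Bundle.Trivialization.basisAt]
    rfl
  have hL : (ContinuousLinearMap.inCoordinates F A F₂ V (φ x₀) (φ x) (φ x₀) (φ x) (G x)) (b j) =
      (e₂ (TotalSpace.mk' F₂ (E := V) (φ x) (G x (S j (φ x))))).2 := by
    rw [ContinuousLinearMap.inCoordinates_eq (by exact hxe) (by exact hxe₂), hSj]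
    rfl
  refine hL.trans ?_
  simp [Finsupp.single_apply, ContinuousLinearMap.smulRightL]

end HomBundle

section Dual

variable [∀ x, IsTopologicalAddGroup (A x)] [∀ x, ContinuousSMul ℝ (A x)]

theorem contMDiff_trivial_iff {f : M → ℝ} :
    ContMDiff 𝓘(ℝ, E) (𝓘(ℝ, E).prod 𝓘(ℝ, ℝ)) ∞
      (fun x => TotalSpace.mk' ℝ (E := fun _ : M => ℝ) x (f x)) ↔
    ContMDiff 𝓘(ℝ, E) 𝓘(ℝ, ℝ) ∞ f :=
  forall_congr' fun x => contMDiffAt_section (F := ℝ) (E := fun _ : M => ℝ) x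

/-- The pairing of sections of a bundle and its dual. -/
def pairing : Sec E F A →ₗ[ℝ] DualSec E F A →ₗ[ℝ] Fn E M :=
  LinearMap.mk₂ ℝ (fun X ξ => ⟨fun x => ξ x (X x),
      contMDiff_trivial_iff.1 (ContMDiff.clm_bundle_apply ξ.contMDiff X.contMDiff)⟩)
    (fun X Y ξ => by ext x; exact map_add (ξ x) (X x) (Y x))
    (fun r X ξ => by ext x; exact map_smul (ξ x) r (X x))
    (fun X ξ η => by ext x; rfl) (fun r X ξ => by ext x; rfl)

@[simp]
theorem pairing_apply (X : Sec E F A) (ξ : DualSec E F A) (x : M) :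
    pairing X ξ x = ξ x (X x) := rfl

variable [FiniteDimensional ℝ E] [T2Space M] [FiniteDimensional ℝ F]

/-- Linearity over functions yields a covector in every fibre, and the field of covectors is smooth
because it is so on every section. -/
theorem exists_pairing_eq (Φ : Sec E F A →ₗ[ℝ] Fn E M)
    (hΦ : ∀ (f : Fn E M) X, Φ (f • X) = f * Φ X) :
    ∃ ξ : DualSec E F A, ∀ X, pairing X ξ = Φ X := by
  have hfin : ∀ x, FiniteDimensional ℝ (A x) := fun x =>
    VectorBundle.finiteDimensional ℝ F A x
  have hT2 : ∀ x, T2Space (A x) := FiberBundle.t2Space F A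
  have hG : ∀ x : M, ∃ G : A x →ₗ[ℝ] ℝ, ∀ X, G (X x) = Φ X x := by
    intro x
    refine exists_fiberMap (Φ := (LinearMap.mk ⟨fun f : Fn E M => f x, fun _ _ => rfl⟩
      fun _ _ => rfl : Fn E M →ₗ[ℝ] ℝ) ∘ₗ Φ) fun f X => ?_
    exact congrArg (fun g : Fn E M => g x) (hΦ f X)
  choose G hG using hG
  refine ⟨⟨fun x => LinearMap.toContinuousLinearMap (G x),
    contMDiff_hom_of_apply (V := fun _ : M => ℝ) contMDiff_id _ fun X => ?_⟩, fun X => ?_⟩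
  · refine contMDiff_trivial_iff.2 ((Φ X).contMDiff.congr fun x => hG x X)
  · ext x
    exact hG x X

variable (E F A) in
/-- Near any point there are dual frames made of global sections. -/
theorem exists_dual_frame (x₀ : M) :
    ∃ (S : Fin (Module.finrank ℝ F) → Sec E F A) (T : Fin (Module.finrank ℝ F) → DualSec E F A)
      (h : Fn E M), h x₀ = 1 ∧ ∀ X, ∑ i, pairing X (T i) • S i = h • X := by
  classical
  set e := trivializationAt F A x₀ with he
  set b := Module.finBasis ℝ F
  obtain ⟨χ, -, hχ⟩ := (SmoothBumpFunction.nhds_basis_tsupport (I := 𝓘(ℝ, E)) x₀).mem_iff.1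
    (e.open_baseSet.mem_nhds (FiberBundle.mem_baseSet_trivializationAt F A x₀))
  have hχs : ContMDiff 𝓘(ℝ, E) 𝓘(ℝ, ℝ) ∞ χ := χ.contMDiff
  -- The local frame and its coefficients are each multiplied by χ to become global, so the
  -- resolution of the identity carries the factor h = χ².
  let S : Fin (Module.finrank ℝ F) → Sec E F A := fun i =>
    ⟨fun x => χ x • e.localFrame b i x,
      ContMDiffOn.smul_section_of_tsupport hχs.contMDiffOn e.open_baseSet hχ
        (e.contMDiffOn_localFrame_baseSet ∞ b i)⟩
  have hT : ∀ i, ∃ ξ : DualSec E F A, ∀ X x,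
      pairing X ξ x = χ x • e.localFrameCoeff 𝓘(ℝ, E) b i x (X x) := by
    intro i
    obtain ⟨ξ, hξ⟩ := exists_pairing_eq (E := E) (F := F) (A := A)
      { toFun := fun X => ⟨fun x => χ x • e.localFrameCoeff 𝓘(ℝ, E) b i x (X x), by
          refine contMDiff_of_tsupport fun x hx => ?_
          have hx' : x ∈ e.baseSet :=
            hχ (closure_mono (Function.support_smul_subset_left _ _) hx)
          exact hχs.contMDiffAt.smul
            (contMDiffAt_localFrameCoeff b hx' X.contMDiff.contMDiffAt i)⟩
        map_add' := fun X Y => by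
          ext x
          change χ x • e.localFrameCoeff 𝓘(ℝ, E) b i x (X x + Y x) = _
          rw [map_add, smul_add]; rfl
        map_smul' := fun r X => by
          ext x
          change χ x • e.localFrameCoeff 𝓘(ℝ, E) b i x (r • X x) = _
          rw [map_smul, smul_comm]; rfl }
      (fun f X => by
          ext x
          change χ x • e.localFrameCoeff 𝓘(ℝ, E) b i x (f x • X x) = _
          rw [map_smul, smul_comm]; rfl)
    exact ⟨ξ, fun X x => congrArg (fun g : Fn E M => g x) (hξ X)⟩
  choose T hT using hT
  refine ⟨S, T, ⟨fun x => χ x * χ x, hχs.mul hχs⟩, ?_, fun X => ?_⟩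
  · change χ x₀ * χ x₀ = 1
    simp
  · ext x
    simp only [sec_sum_apply, fn_smul_apply, hT]
    change ∑ i, (χ x • e.localFrameCoeff 𝓘(ℝ, E) b i x (X x)) • χ x • e.localFrame b i x =
      (χ x * χ x) • X x
    by_cases hx : x ∈ e.baseSet
    · conv_rhs => rw [Bundle.Trivialization.eq_sum_localFrameCoeff_smul (I := 𝓘(ℝ, E)) (b := b)
        (s := fun x => X x) hx]
      rw [Finset.smul_sum]
      refine Finset.sum_congr rfl fun i _ => ?_
      rw [smul_smul, smul_smul, smul_eq_mul]
      congr 1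
      ring
    · have : χ x = 0 := image_eq_zero_of_notMem_tsupport fun h => hx (hχ h)
      simp [this]

end Dual

end Sections

end HomBundles

namespace HomBundles

/-! ### The grading of multivectors and of multisections -/

section LinearAlgebra

variable {V W : Type*} [AddCommGroup V] [Module ℝ V] [AddCommGroup W] [Module ℝ W]

/-- The component of degree `i` of a multivector. -/
noncomputable def degreePart (V : Type*) [AddCommGroup V] [Module ℝ V] (i : ℕ) :
    ExteriorAlgebra ℝ V →ₗ[ℝ] ExteriorAlgebra ℝ V :=
  GradedAlgebra.proj (fun i : ℕ => ⋀[ℝ]^i V) i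

theorem degreePart_mem (i : ℕ) (a : ExteriorAlgebra ℝ V) : degreePart V i a ∈ ⋀[ℝ]^i V :=
  SetLike.coe_mem _

theorem degreePart_of_mem {i : ℕ} {a : ExteriorAlgebra ℝ V} (ha : a ∈ ⋀[ℝ]^i V) :
    degreePart V i a = a :=
  DirectSum.decompose_of_mem_same (fun i : ℕ => ⋀[ℝ]^i V) ha

theorem degreePart_of_mem_ne {i j : ℕ} {a : ExteriorAlgebra ℝ V} (ha : a ∈ ⋀[ℝ]^i V)
    (hij : i ≠ j) : degreePart V j a = 0 :=
  DirectSum.decompose_of_mem_ne (fun i : ℕ => ⋀[ℝ]^i V) ha hij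

theorem exteriorAlgebra_linearMap_ext {U : Type*} [AddCommGroup U] [Module ℝ U]
    {f g : ExteriorAlgebra ℝ V →ₗ[ℝ] U} (h : ∀ i, ∀ a ∈ ⋀[ℝ]^i V, f a = g a) : f = g := by
  refine LinearMap.ext fun a => ?_
  refine DirectSum.Decomposition.inductionOn (fun i : ℕ => ⋀[ℝ]^i V) (motive := fun a => f a = g a)
    (by simp) (fun {i} m => h i m m.2) (fun a b ha hb => ?_) a
  rw [map_add, map_add, ha, hb]

theorem degreePart_map (f : V →ₗ[ℝ] W) (i : ℕ) (a : ExteriorAlgebra ℝ V) :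
    degreePart W i (ExteriorAlgebra.map f a) = ExteriorAlgebra.map f (degreePart V i a) := by
  refine LinearMap.congr_fun (f := degreePart W i ∘ₗ (ExteriorAlgebra.map f).toLinearMap)
    (g := (ExteriorAlgebra.map f).toLinearMap ∘ₗ degreePart V i)
    (exteriorAlgebra_linearMap_ext fun k a ha => ?_) a
  change degreePart W i (ExteriorAlgebra.map f a) = ExteriorAlgebra.map f (degreePart V i a)
  by_cases hk : k = i
  · subst hk
    rw [degreePart_of_mem ha, degreePart_of_mem (map_mem_exteriorPower f ha)]
  · rw [degreePart_of_mem_ne ha hk, degreePart_of_mem_ne (map_mem_exteriorPower f ha) hk, map_zero]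

theorem exteriorPower_eq_zero [FiniteDimensional ℝ V] {k : ℕ} (hk : Module.finrank ℝ V < k)
    {a : ExteriorAlgebra ℝ V} (ha : a ∈ ⋀[ℝ]^k V) : a = 0 := by
  have h : Module.finrank ℝ (⋀[ℝ]^k V) = 0 := by
    rw [exteriorPower.finrank_eq, Nat.choose_eq_zero_of_lt hk]
  have := Module.finrank_zero_iff.1 h
  exact congrArg Subtype.val (Subsingleton.elim (⟨a, ha⟩ : ⋀[ℝ]^k V) 0)

theorem sum_degreePart [FiniteDimensional ℝ V] {N : ℕ} (hN : Module.finrank ℝ V < N)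
    (a : ExteriorAlgebra ℝ V) : ∑ i ∈ Finset.range N, degreePart V i a = a := by
  have := LinearMap.congr_fun (f := ∑ i ∈ Finset.range N, degreePart V i) (g := LinearMap.id)
    (exteriorAlgebra_linearMap_ext fun k a ha => ?_) a
  · simpa using this
  · rw [LinearMap.sum_apply, LinearMap.id_apply]
    by_cases hk : k < N
    · rw [Finset.sum_eq_single k (fun j _ hj => degreePart_of_mem_ne ha hj.symm)
        (fun h => absurd (Finset.mem_range.2 hk) h), degreePart_of_mem ha]
    · rw [exteriorPower_eq_zero (by omega) ha]
      simp

end LinearAlgebra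

/-- Since only degrees below N occur, the finite sum of the projections is a decomposition map. -/
theorem isInternal_of_projections {U : Type*} [AddCommGroup U] [Module ℝ U]
    (𝒜 : ℕ → Submodule ℝ U) (p : ∀ i, U →ₗ[ℝ] 𝒜 i) (N : ℕ)
    (hsum : ∀ s, ∑ i ∈ Finset.range N, (p i s).1 = s) (heq : ∀ i, ∀ s ∈ 𝒜 i, (p i s).1 = s)
    (hne : ∀ i j, i ≠ j → ∀ s ∈ 𝒜 i, (p j s).1 = 0) (hN : ∀ i, N ≤ i → ∀ s ∈ 𝒜 i, s = 0) :
    DirectSum.IsInternal 𝒜 := by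
  classical
  let D : DirectSum.Decomposition 𝒜 := DirectSum.Decomposition.ofLinearMap _
    (∑ i ∈ Finset.range N, DirectSum.lof ℝ ℕ (fun i => 𝒜 i) i ∘ₗ p i)
    (by
      ext1 s
      simp only [LinearMap.comp_apply, LinearMap.sum_apply, map_sum, DirectSum.coeLinearMap_lof,
        LinearMap.id_apply]
      exact hsum s)
    (by
      ext k s : 2
      simp only [LinearMap.comp_apply, LinearMap.sum_apply, DirectSum.coeLinearMap_lof,
        LinearMap.id_apply]
      have hne' : ∀ i, i ≠ k → p i s.1 = 0 := fun i hi => Subtype.ext (hne k i hi.symm _ s.2)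
      by_cases hk : k < N
      · rw [Finset.sum_eq_single k (fun i _ hi => by rw [hne' i hi, map_zero])
          (fun h => absurd (Finset.mem_range.2 hk) h), Subtype.ext (heq k _ s.2)]
      · have : s = 0 := Subtype.ext (hN k (by omega) _ s.2)
        simp [this])
  exact DirectSum.Decomposition.isInternal _

noncomputable section Multisections

variable {E : Type*} [NormedAddCommGroup E] [NormedSpace ℝ E]
  {M : Type*} [TopologicalSpace M] [ChartedSpace E M]
  {F : Type*} [NormedAddCommGroup F] [NormedSpace ℝ F]
  {A : M → Type*} [TopologicalSpace (TotalSpace F A)]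
  [∀ x, AddCommGroup (A x)] [∀ x, Module ℝ (A x)] [∀ x, TopologicalSpace (A x)]
  [FiberBundle F A] [VectorBundle ℝ F A]

/-- Smoothness is local, and near x₀ one may divide by f. This handles fields known to be smooth
only after multiplication by a cut-off function. -/
theorem isSmoothMultisection_of_smul {t : ∀ x, ExteriorAlgebra ℝ (A x)}
    (h : ∀ x₀, ∃ f : Fn E M, f x₀ ≠ 0 ∧ IsSmoothMultisection E F A (fun x => f x • t x)) :
    IsSmoothMultisection E F A t := by
  intro e _ l x₀ hx₀
  obtain ⟨f, hf, hs⟩ := h x₀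
  have h1 := hs e l x₀ hx₀
  have h2 : ContMDiffWithinAt 𝓘(ℝ, E) 𝓘(ℝ, ℝ) ∞ (fun x => (f x)⁻¹) e.baseSet x₀ :=
    (f.contMDiff.contMDiffAt.contMDiffWithinAt).inv₀ hf
  refine (h2.mul h1).congr_of_eventuallyEq ?_ ?_
  · have : ∀ᶠ x in 𝓝 x₀, f x ≠ 0 := f.contMDiff.continuous.continuousAt.eventually_ne hf
    filter_upwards [nhdsWithin_le_nhds this] with x hx
    change _ = (f x)⁻¹ * l (ExteriorAlgebra.map (e.linearMapAt ℝ x) (f x • t x))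
    rw [map_smul, map_smul, smul_eq_mul, inv_mul_cancel_left₀ hx]
  · change _ = (f x₀)⁻¹ * l (ExteriorAlgebra.map (e.linearMapAt ℝ x₀) (f x₀ • t x₀))
    rw [map_smul, map_smul, smul_eq_mul, inv_mul_cancel_left₀ hf]

variable [FiniteDimensional ℝ F]

namespace Multisection

instance : Ring (Multisection E F A) := Subalgebra.toRing _

instance : NonUnitalNonAssocRing (Multisection E F A) := Ring.toNonAssocRing.toNonUnitalNonAssocRing

instance : AddCommGroup (Multisection E F A) := Ring.toAddCommGroup

@[ext]
theorem ext {s t : Multisection E F A} (h : ∀ x, s.1 x = t.1 x) : s = t :=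
  Subtype.ext (funext h)

@[simp]
theorem mul_val (s t : Multisection E F A) (x : M) : (s * t).1 x = s.1 x * t.1 x := rfl

@[simp]
theorem add_val (s t : Multisection E F A) (x : M) : (s + t).1 x = s.1 x + t.1 x := rfl

@[simp]
theorem smul_val (r : ℝ) (s : Multisection E F A) (x : M) : (r • s).1 x = r • s.1 x := rfl

/-- The value of a multisection at a point. -/
def eval (x : M) : Multisection E F A →ₐ[ℝ] ExteriorAlgebra ℝ (A x) :=
  (Pi.evalAlgHom ℝ _ x).comp (Multisection E F A).val

@[simp]
theorem eval_apply (x : M) (s : Multisection E F A) : eval x s = s.1 x := rfl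

@[simp]
theorem sum_val {κ : Type*} (t : Finset κ) (s : κ → Multisection E F A) (x : M) :
    (∑ i ∈ t, s i).1 x = ∑ i ∈ t, (s i).1 x := map_sum (eval x) s t

/-- The inclusion of functions as an algebra morphism. -/
def ofFunHom : Fn E M →ₐ[ℝ] Multisection E F A where
  toFun := ofFun
  map_one' := by ext x; exact map_one (algebraMap ℝ _)
  map_mul' f g := by ext x; exact map_mul (algebraMap ℝ _) (f x) (g x)
  map_zero' := by ext x; exact map_zero (algebraMap ℝ _)
  map_add' f g := by ext x; exact map_add (algebraMap ℝ _) (f x) (g x)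
  commutes' r := rfl

@[simp]
theorem ofFunHom_val (f : Fn E M) (x : M) :
    (ofFunHom f : Multisection E F A).1 x = algebraMap ℝ _ (f x) := rfl

theorem ofFunHom_mul_val (f : Fn E M) (s : Multisection E F A) (x : M) :
    (ofFunHom f * s).1 x = f x • s.1 x := by
  rw [mul_val, ofFunHom_val, ← Algebra.smul_def]

variable [IsManifold 𝓘(ℝ, E) ∞ M] [ContMDiffVectorBundle ∞ F A 𝓘(ℝ, E)]

/-- The inclusion of sections as a linear map. -/
def ofSectionHom : Sec E F A →ₗ[ℝ] Multisection E F A where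
  toFun := ofSection
  map_add' X Y := by ext x; exact map_add (ExteriorAlgebra.ι ℝ) (X x) (Y x)
  map_smul' r X := by ext x; exact map_smul (ExteriorAlgebra.ι ℝ) r (X x)

@[simp]
theorem ofSectionHom_val (X : Sec E F A) (x : M) :
    (ofSectionHom X : Multisection E F A).1 x = ExteriorAlgebra.ι ℝ (X x) := rfl

variable [∀ x, IsTopologicalAddGroup (A x)] [∀ x, ContinuousSMul ℝ (A x)]

/-- In a trivialization ξ = ∑ ξ(e_i) b^i has smooth coefficients, and each contraction with the
fixed covector b^i only changes the coordinate functional. -/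
theorem isSmooth_contract (ξ : DualSec E F A) (s : Multisection E F A) :
    IsSmoothMultisection E F A (fun x => contractMultivector (ξ x : A x →ₗ[ℝ] ℝ) (s.1 x)) := by
  intro e _ l
  let b := Module.finBasis ℝ F
  have hξ : ∀ i, ContMDiffOn 𝓘(ℝ, E) 𝓘(ℝ, ℝ) ∞ (fun x => ξ x (e.localFrame b i x)) e.baseSet :=
    fun i x hx => (contMDiffWithinAt_section (F := ℝ) (E := fun _ : M => ℝ)).1
      (ContMDiffOn.clm_bundle_apply ξ.contMDiff.contMDiffOn
        (e.contMDiffOn_localFrame_baseSet ∞ b i) x hx)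
  have hsum : ContMDiffOn 𝓘(ℝ, E) 𝓘(ℝ, ℝ) ∞ (fun x => ∑ i, ξ x (e.localFrame b i x) *
      (l ∘ₗ contractMultivector (b.coord i)) (ExteriorAlgebra.map (e.linearMapAt ℝ x) (s.1 x)))
      e.baseSet :=
    contMDiffOn_finsetSum fun i _ => (hξ i).mul (s.2 e _)
  refine hsum.congr fun x hx => ?_
  have hφ : (ξ x : A x →ₗ[ℝ] ℝ) = (∑ i, ξ x (e.localFrame b i x) • b.coord i) ∘ₗ
      (e.linearMapAt ℝ x) := by
    ext v
    have hv : v = e.symm x (e.linearMapAt ℝ x v) := by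
      rw [← e.symmₗ_apply (R := ℝ) hx, e.symmₗ_linearMapAt hx]
    have hb : ∀ i, e.localFrame b i x = e.symmₗ ℝ x (b i) := by
      intro i
      rw [Bundle.Trivialization.localFrame_apply_of_mem_baseSet _ _ hx, e.symmₗ_apply hx]
      simp [Bundle.Trivialization.basisAt]
    have hw : ∀ w : F, (ξ x : A x →ₗ[ℝ] ℝ) (e.symmₗ ℝ x w) =
        (∑ i, ξ x (e.localFrame b i x) • b.coord i) w := by
      intro w
      conv_lhs => rw [← b.sum_repr w]
      simp only [map_sum, map_smul, LinearMap.sum_apply, LinearMap.smul_apply, hb,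
        Module.Basis.coord_apply, smul_eq_mul]
      exact Finset.sum_congr rfl fun i _ => mul_comm _ _
    rw [LinearMap.comp_apply, ← hw, e.symmₗ_linearMapAt hx]
  change l (ExteriorAlgebra.map (e.linearMapAt ℝ x)
    (contractMultivector (ξ x : A x →ₗ[ℝ] ℝ) (s.1 x))) = _
  rw [hφ, ← contractMultivector_map]
  simp only [map_sum, map_smul, LinearMap.sum_apply, LinearMap.smul_apply, LinearMap.comp_apply,
    smul_eq_mul]

/-- The contraction of multisections with a section of the dual bundle. -/
def contract : DualSec E F A →ₗ[ℝ] Multisection E F A →ₗ[ℝ] Multisection E F A :=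
  LinearMap.mk₂ ℝ (fun ξ s => ⟨_, isSmooth_contract ξ s⟩)
    (fun ξ η s => by
      ext x
      exact LinearMap.congr_fun (map_add contractMultivector (ξ x : A x →ₗ[ℝ] ℝ) (η x)) _)
    (fun r ξ s => by
      ext x
      exact LinearMap.congr_fun (map_smul contractMultivector r (ξ x : A x →ₗ[ℝ] ℝ)) _)
    (fun ξ s t => by ext x; exact map_add _ (s.1 x) (t.1 x))
    (fun r ξ s => by ext x; exact map_smul _ r (s.1 x))

@[simp]
theorem contract_val (ξ : DualSec E F A) (s : Multisection E F A) (x : M) :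
    (contract ξ s).1 x = contractMultivector (ξ x : A x →ₗ[ℝ] ℝ) (s.1 x) := rfl

end Multisection

namespace Multisection

theorem isSmooth_degreePart (i : ℕ) (s : Multisection E F A) :
    IsSmoothMultisection E F A (fun x => degreePart (A x) i (s.1 x)) := by
  intro e _ l
  refine (s.2 e (l ∘ₗ degreePart F i)).congr fun x _ => ?_
  rw [LinearMap.comp_apply, degreePart_map]

/-- The component of degree `i` of a multisection. -/
def proj (i : ℕ) : Multisection E F A →ₗ[ℝ] degree E F A i where
  toFun s := ⟨⟨_, isSmooth_degreePart i s⟩, fun x => degreePart_mem i (s.1 x)⟩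
  map_add' s t := Subtype.ext (ext fun x => map_add _ (s.1 x) (t.1 x))
  map_smul' r s := Subtype.ext (ext fun x => map_smul _ r (s.1 x))

theorem finrank_fiber (x : M) : Module.finrank ℝ (A x) = Module.finrank ℝ F :=
  ((trivializationAt F A x).linearEquivAt ℝ x
    (FiberBundle.mem_baseSet_trivializationAt F A x)).finrank_eq

theorem sum_proj (s : Multisection E F A) :
    ∑ i ∈ Finset.range (Module.finrank ℝ F + 1), (proj i s).1 = s := by
  ext x
  have := VectorBundle.finiteDimensional ℝ F A x
  rw [sum_val]
  exact sum_degreePart (by rw [finrank_fiber (F := F)]; omega) (s.1 x)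

theorem degree_eq_zero {k : ℕ} (hk : Module.finrank ℝ F < k) {s : Multisection E F A}
    (hs : s ∈ degree E F A k) : s = 0 := by
  ext x
  have := VectorBundle.finiteDimensional ℝ F A x
  exact exteriorPower_eq_zero (by rwa [finrank_fiber (F := F)]) (hs x)

theorem isInternal_degree : DirectSum.IsInternal (degree E F A) :=
  isInternal_of_projections (degree E F A) proj (Module.finrank ℝ F + 1) sum_proj
    (fun _ s hs => ext fun x => degreePart_of_mem (hs x))
    (fun _ _ h s hs => ext fun x => degreePart_of_mem_ne (hs x) h)
    (fun _ hk _ hs => degree_eq_zero (by omega) hs)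

theorem isGradedCommutativeAlgebra : IsGradedCommutativeAlgebra (degree E F A) where
  gradedMonoid :=
    { one_mem := fun _ => mem_exteriorPower_zero.2 ⟨1, map_one _⟩
      mul_mem := fun _ _ _ _ hs ht x => mul_mem_exteriorPower (hs x) (ht x) }
  isInternal := isInternal_degree
  mul_comm _ _ _ hs _ ht := ext fun x => mul_comm_exteriorPower (hs x) (ht x)

theorem mem_degree_zero {s : Multisection E F A} : s ∈ degree E F A 0 ↔ ∃ f, ofFunHom f = s := by
  constructor
  · intro hs
    have key : ∀ x, algebraMap ℝ _ (ExteriorAlgebra.algebraMapInv (s.1 x)) = s.1 x := by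
      intro x
      obtain ⟨r, hr⟩ := mem_exteriorPower_zero.1 (hs x)
      rw [← hr, ExteriorAlgebra.algebraMap_leftInverse]
    refine ⟨⟨fun x => ExteriorAlgebra.algebraMapInv (s.1 x), fun x₀ => ?_⟩, ext key⟩
    set e := trivializationAt F A x₀
    have h := s.2 e (ExteriorAlgebra.algebraMapInv (R := ℝ) (M := F)).toLinearMap
    have h' : ContMDiffOn 𝓘(ℝ, E) 𝓘(ℝ, ℝ) ∞ (fun x => ExteriorAlgebra.algebraMapInv (s.1 x))
        e.baseSet := by
      refine h.congr fun x _ => ?_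
      obtain ⟨r, hr⟩ := mem_exteriorPower_zero.1 (hs x)
      rw [← hr, AlgHom.commutes, AlgHom.toLinearMap_apply, AlgHom.commutes, AlgHom.commutes]
    exact h'.contMDiffAt (e.open_baseSet.mem_nhds (FiberBundle.mem_baseSet_trivializationAt F A x₀))
  · rintro ⟨f, rfl⟩ x
    exact mem_exteriorPower_zero.2 ⟨f x, rfl⟩

variable [IsManifold 𝓘(ℝ, E) ∞ M] [ContMDiffVectorBundle ∞ F A 𝓘(ℝ, E)]

theorem mem_degree_one {s : Multisection E F A} :
    s ∈ degree E F A 1 ↔ ∃ X, ofSectionHom X = s := by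
  constructor
  · intro hs
    have key : ∀ x, ExteriorAlgebra.ι ℝ (ExteriorAlgebra.ιInv (s.1 x)) = s.1 x := by
      intro x
      obtain ⟨r, hr⟩ := mem_exteriorPower_one.1 (hs x)
      rw [← hr, ExteriorAlgebra.ι_leftInverse]
    refine ⟨⟨fun x => ExteriorAlgebra.ιInv (s.1 x), fun x₀ => ?_⟩, ext key⟩
    set e := trivializationAt F A x₀
    let b := Module.finBasis ℝ F
    have h' : ContMDiffOn 𝓘(ℝ, E) (𝓘(ℝ, E).prod 𝓘(ℝ, F)) ∞
        (fun x => TotalSpace.mk' F x (ExteriorAlgebra.ιInv (s.1 x) : A x)) e.baseSet := by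
      refine (e.contMDiffOn_section_baseSet_iff (IB := 𝓘(ℝ, E)) (n := ∞)).2 ?_
      have hsum : ContMDiffOn 𝓘(ℝ, E) 𝓘(ℝ, F) ∞ (fun x => ∑ i,
          (b.coord i ∘ₗ ExteriorAlgebra.ιInv) (ExteriorAlgebra.map (e.linearMapAt ℝ x) (s.1 x)) •
            b i) e.baseSet :=
        contMDiffOn_finsetSum fun i _ => (s.2 e _).smul contMDiffOn_const
      refine hsum.congr fun x hx => ?_
      obtain ⟨v, hv⟩ := mem_exteriorPower_one.1 (hs x)
      simp only [LinearMap.comp_apply, Module.Basis.coord_apply]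
      rw [b.sum_repr, ← hv, ExteriorAlgebra.map_apply_ι, ExteriorAlgebra.ι_leftInverse,
        ExteriorAlgebra.ι_leftInverse, e.linearMapAt_apply, if_pos hx]
    exact h'.contMDiffAt (e.open_baseSet.mem_nhds (FiberBundle.mem_baseSet_trivializationAt F A x₀))
  · rintro ⟨X, rfl⟩ x
    exact mem_exteriorPower_one.2 ⟨X x, rfl⟩

end Multisection

end Multisections

end HomBundles

namespace HomBundles

/-! ### Euler's formula for multisections and its consequences -/

section LinearAlgebra

/-- The induction step of `IsFrameRecursion.leibniz`, stripped of geometry. There σ_i = S_i, U_i =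
δ₁ S_i, H = δ₀ h, Ia_i = ι_{T_i} a, da = δ a and dIa_i = δ(ι_{T_i} a). The signs are s = (-1)^p, t =
(-1)^{(n+1)p} and e = (-1)^{n+1}. Euler's formula collects the terms with an undifferentiated
contraction, and the recursions for a and b collect the others. -/
theorem leibniz_step {R κ : Type*} [Ring R] [Algebra ℝ R] [Fintype κ] {σ U Ia Ib dIa dIb : κ → R}
    {a b da db H : R} {p q e s t : ℝ} (ha : ∑ i, σ i * Ia i = p • a) (hb : ∑ i, σ i * Ib i = q • b)
    (hda : ∑ i, (U i * Ia i + e • (σ i * dIa i)) = p • (da + H * a))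
    (hdb : ∑ i, (U i * Ib i + e • (σ i * dIb i)) = q • (db + H * b))
    (hU : ∀ i, s • (U i * a) = t • (a * U i)) (hσa : ∀ i, s • (σ i * a) = a * σ i)
    (hσda : ∀ i, (s * e) • (σ i * da) = da * σ i) (hH : H * a = t • (a * H)) (he : e * e = 1) :
    ∑ i, (U i * (Ia i * b + s • (a * Ib i)) +
      e • (σ i * ((dIa i * b + (t * e) • (Ia i * db)) + s • (da * Ib i + t • (a * dIb i))))) =
    (p + q) • (da * b + t • (a * db) + H * (a * b)) := by
  have key : ∀ i, U i * (Ia i * b + s • (a * Ib i)) +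
      e • (σ i * ((dIa i * b + (t * e) • (Ia i * db)) + s • (da * Ib i + t • (a * dIb i)))) =
      (U i * Ia i + e • (σ i * dIa i)) * b + t • ((σ i * Ia i) * db) + da * (σ i * Ib i) +
        t • (a * (U i * Ib i + e • (σ i * dIb i))) := by
    intro i
    have h1 : s • (U i * a * Ib i) = t • (a * U i * Ib i) := by
      rw [← smul_mul_assoc, hU, smul_mul_assoc]
    have h2 : (s * e) • (σ i * da * Ib i) = da * σ i * Ib i := by
      rw [← smul_mul_assoc, hσda]
    have h3 : s • (σ i * a * dIb i) = a * σ i * dIb i := by rw [← smul_mul_assoc, hσa]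
    have h4 : (e * (t * e)) = t := by rw [mul_left_comm, he, mul_one]
    simp only [mul_add, add_mul, smul_add, mul_smul_comm, smul_mul_assoc, smul_smul, ← mul_assoc]
    rw [mul_assoc e t e, h4, h1, mul_comm e s, h2, mul_comm (s * e) t, show t * (s * e) = (t * e) * s by ring, mul_smul _ s, h3]
    abel
  rw [Finset.sum_congr rfl fun i _ => key i]
  simp only [Finset.sum_add_distrib, ← Finset.mul_sum, ← Finset.sum_mul, ← Finset.smul_sum]
  simp only [Finset.sum_add_distrib, ← Finset.smul_sum] at hda hdb
  rw [hda, hdb, ha, hb]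
  have h5 : t • (a * (H * b)) = H * a * b := by rw [hH, smul_mul_assoc, mul_assoc]
  simp only [mul_add, add_mul, smul_add, mul_smul_comm, smul_mul_assoc, smul_smul, ← mul_assoc,
    add_smul] at h5 ⊢
  rw [mul_comm t q, mul_smul q t (a * H * b), h5, mul_comm t p]
  abel

end LinearAlgebra

noncomputable section Multisections

variable {E : Type*} [NormedAddCommGroup E] [NormedSpace ℝ E]
  {M : Type*} [TopologicalSpace M] [ChartedSpace E M]
  {F : Type*} [NormedAddCommGroup F] [NormedSpace ℝ F]
  {A : M → Type*} [TopologicalSpace (TotalSpace F A)]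
  [∀ x, AddCommGroup (A x)] [∀ x, Module ℝ (A x)] [∀ x, TopologicalSpace (A x)]
  [FiberBundle F A] [VectorBundle ℝ F A] [FiniteDimensional ℝ F]
  [IsManifold 𝓘(ℝ, E) ∞ M] [ContMDiffVectorBundle ∞ F A 𝓘(ℝ, E)]
  [∀ x, IsTopologicalAddGroup (A x)] [∀ x, ContinuousSMul ℝ (A x)]

namespace Multisection

theorem ofFunHom_mem (f : Fn E M) : (ofFunHom f : Multisection E F A) ∈ degree E F A 0 :=
  mem_degree_zero.2 ⟨f, rfl⟩

theorem ofSectionHom_mem (X : Sec E F A) : ofSectionHom X ∈ degree E F A 1 :=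
  mem_degree_one.2 ⟨X, rfl⟩

theorem contract_mem (ξ : DualSec E F A) {k : ℕ} {s : Multisection E F A}
    (hs : s ∈ degree E F A (k + 1)) : contract ξ s ∈ degree E F A k :=
  fun x => contractMultivector_mem _ (hs x)

theorem contract_eq_zero (ξ : DualSec E F A) {s : Multisection E F A}
    (hs : s ∈ degree E F A 0) : contract ξ s = 0 :=
  ext fun x => contractMultivector_zero _ (hs x)

theorem contract_mul (ξ : DualSec E F A) {k : ℕ} {s : Multisection E F A}
    (hs : s ∈ degree E F A k) (t : Multisection E F A) :
    contract ξ (s * t) = contract ξ s * t + (-1 : ℝ) ^ k • (s * contract ξ t) :=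
  ext fun x => contractMultivector_mul _ (hs x) _

theorem contract_ofSectionHom (ξ : DualSec E F A) (X : Sec E F A) :
    contract ξ (ofSectionHom X) = ofFunHom (pairing X ξ) :=
  ext fun _ => contractMultivector_ι _ _

theorem contract_contract (ξ η : DualSec E F A) (s : Multisection E F A) :
    contract ξ (contract η s) = -contract η (contract ξ s) :=
  ext fun _ => contractMultivector_comm _ _ _

theorem contract_smul (f : Fn E M) (ξ : DualSec E F A) (s : Multisection E F A) :
    contract (f • ξ) s = ofFunHom f * contract ξ s :=
  ext fun x => by
    rw [ofFunHom_mul_val]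
    exact LinearMap.congr_fun (map_smul contractMultivector (f x) (ξ x : A x →ₗ[ℝ] ℝ)) _

theorem ofSectionHom_smul (f : Fn E M) (X : Sec E F A) :
    ofSectionHom (f • X) = ofFunHom f * ofSectionHom X :=
  ext fun x => by
    rw [ofFunHom_mul_val]
    exact map_smul (ExteriorAlgebra.ι ℝ) (f x) (X x)

theorem ofFunHom_injective : Function.Injective (ofFunHom : Fn E M →ₐ[ℝ] Multisection E F A) := by
  intro f g h
  ext x
  have := congrArg (fun s : Multisection E F A => ExteriorAlgebra.algebraMapInv (s.1 x)) h
  simpa [ExteriorAlgebra.algebraMap_leftInverse _ _] using this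

theorem ofSectionHom_injective :
    Function.Injective (ofSectionHom : Sec E F A →ₗ[ℝ] Multisection E F A) := by
  intro X Y h
  ext x
  have := congrArg (fun s : Multisection E F A => ExteriorAlgebra.ιInv (s.1 x)) h
  simpa [ExteriorAlgebra.ι_leftInverse _] using this

variable [FiniteDimensional ℝ E] [T2Space M]

/-- The sections `S` and `T` of a bundle and its dual are a dual frame where `h` does not vanish. -/
def IsDualFrame (S : Fin (Module.finrank ℝ F) → Sec E F A)
    (T : Fin (Module.finrank ℝ F) → DualSec E F A) (h : Fn E M) : Prop :=
  ∀ X, ∑ i, pairing X (T i) • S i = h • X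

section Frame

variable {S : Fin (Module.finrank ℝ F) → Sec E F A} {T : Fin (Module.finrank ℝ F) → DualSec E F A}
  {h : Fn E M} (hST : IsDualFrame S T h)

include hST

theorem IsDualFrame.sum_mul_contractMultivector {k : ℕ} {x : M} {a : ExteriorAlgebra ℝ (A x)}
    (ha : a ∈ ⋀[ℝ]^k (A x)) :
    ∑ i, ExteriorAlgebra.ι ℝ (S i x) * contractMultivector (T i x : A x →ₗ[ℝ] ℝ) a =
      ((k : ℝ) * h x) • a := by
  refine sum_ι_mul_contractMultivector _ _ _ (fun w => ?_) ha
  obtain ⟨X, rfl⟩ := exists_section (E := E) (F := F) x w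
  have := congrArg (fun Y : Sec E F A => Y x) (hST X)
  simpa using this

theorem IsDualFrame.sum_mul_contract {k : ℕ} {s : Multisection E F A} (hs : s ∈ degree E F A k) :
    ∑ i, ofSectionHom (S i) * contract (T i) s = (k : ℝ) • (ofFunHom h * s) := by
  ext x
  rw [sum_val, smul_val, ofFunHom_mul_val, smul_smul]
  exact hST.sum_mul_contractMultivector (hs x)

theorem IsDualFrame.sum_smul_dual (ξ : DualSec E F A) :
    ∑ i, pairing (S i) ξ • T i = h • ξ := by
  refine dualSection_ext fun X x => ?_
  have := congrArg (fun Y : Sec E F A => ξ x (Y x)) (hST X)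
  simp only [sec_sum_apply, fn_smul_apply, map_sum, map_smul, pairing_apply, smul_eq_mul] at this
  have h2 : (∑ i, pairing (S i) ξ • T i) x (X x) = ∑ i, ξ x (S i x) * T i x (X x) := by
    rw [sec_sum_apply, sum_apply]
    rfl
  rw [h2]
  refine Eq.trans ?_ this
  exact Finset.sum_congr rfl fun i _ => mul_comm _ _

end Frame

/-- Where h = 1, Euler's formula writes (k + 1) a as a sum over contractions of a. -/
theorem eq_zero_of_contractMultivector {k : ℕ} {x : M} {a : ExteriorAlgebra ℝ (A x)}
    (ha : a ∈ ⋀[ℝ]^(k + 1) (A x))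
    (h : ∀ ξ : DualSec E F A, contractMultivector (ξ x : A x →ₗ[ℝ] ℝ) a = 0) : a = 0 := by
  obtain ⟨S, T, g, hg, hST⟩ := exists_dual_frame E F A x
  have := IsDualFrame.sum_mul_contractMultivector hST ha
  simp only [h, mul_zero, Finset.sum_const_zero, hg, mul_one] at this
  exact (smul_eq_zero.1 this.symm).resolve_left (by positivity)

/-- Induction on the degree: applying δ to Euler's formula gives (k + 1) h δ s on one side, and on
the other products of sections with lower-degree elements, on which δ already vanishes. Then
evaluate where h = 1. -/
theorem linearMap_eq_zero (p : ℕ) (δ : Multisection E F A →ₗ[ℝ] Multisection E F A)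
    (hδ : ∀ i, ∀ a ∈ degree E F A i, ∀ b, δ (a * b) = δ a * b + (-1 : ℝ) ^ (p * i) • (a * δ b))
    (h0 : ∀ f, δ (ofFunHom f) = 0) (h1 : ∀ X, δ (ofSectionHom X) = 0) : δ = 0 := by
  refine isGradedCommutativeAlgebra.linearMap_ext fun k => ?_
  induction k with
  | zero =>
    intro a ha
    obtain ⟨f, rfl⟩ := mem_degree_zero.1 ha
    exact h0 f
  | succ k ih =>
    intro s hs
    ext x
    obtain ⟨S, T, g, hg, hST⟩ := exists_dual_frame E F A x
    have h2 := congrArg δ (IsDualFrame.sum_mul_contract hST hs)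
    rw [map_sum, map_smul, hδ 0 _ (ofFunHom_mem g), h0, zero_mul, zero_add] at h2
    have h3 : ∀ i, δ (ofSectionHom (S i) * contract (T i) s) = 0 := fun i => by
      rw [hδ 1 _ (ofSectionHom_mem _), h1, ih _ (contract_mem _ hs)]
      simp
    simp only [h3, Finset.sum_const_zero, mul_zero, pow_zero, one_smul] at h2
    have h4 := congrArg (fun t : Multisection E F A => t.1 x) h2
    simp only [smul_val, ofFunHom_mul_val, hg, one_smul] at h4
    exact (smul_eq_zero.1 h4.symm).resolve_left (by positivity)

/-- Near a point the candidate is (k + 1)⁻¹ ∑ S_i ∧ Ω(T_i). Its contraction with ξ is (k + 1)⁻¹ (h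
Ω(ξ) + k h Ω(ξ)) = h Ω(ξ), by skewness and Euler's formula. Contractions determine a multivector, so
the local candidates are compatible and glue. -/
theorem exists_contract_eq (k : ℕ) (Ω : DualSec E F A →ₗ[ℝ] Multisection E F A)
    (hk : ∀ ξ, Ω ξ ∈ degree E F A k) (hΩ : ∀ (f : Fn E M) ξ, Ω (f • ξ) = ofFunHom f * Ω ξ)
    (halt : ∀ ξ, contract ξ (Ω ξ) = 0) :
    ∃ w ∈ degree E F A (k + 1), ∀ ξ, contract ξ w = Ω ξ := by
  have hskew : ∀ ξ η, contract ξ (Ω η) = -contract η (Ω ξ) := by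
    intro ξ η
    have := halt (ξ + η)
    simp only [map_add, LinearMap.add_apply, halt, add_zero, zero_add] at this
    exact eq_neg_of_add_eq_zero_right this
  have hloc : ∀ x₀ : M, ∃ (g : Fn E M) (w : Multisection E F A), g x₀ = 1 ∧
      w ∈ degree E F A (k + 1) ∧ ∀ ξ, contract ξ w = ofFunHom g * Ω ξ := by
    intro x₀
    obtain ⟨S, T, g, hg, hST⟩ := exists_dual_frame E F A x₀
    refine ⟨g, ((k : ℝ) + 1)⁻¹ • ∑ i, ofSectionHom (S i) * Ω (T i), hg, ?_, fun ξ => ?_⟩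
    · refine Submodule.smul_mem _ _ (Submodule.sum_mem _ fun i _ => ?_)
      rw [add_comm]
      exact isGradedCommutativeAlgebra.mul_mem (ofSectionHom_mem _) (hk _)
    · have h1 : ∀ i, contract ξ (ofSectionHom (S i) * Ω (T i)) =
          Ω (pairing (S i) ξ • T i) + ofSectionHom (S i) * contract (T i) (Ω ξ) := by
        intro i
        rw [contract_mul ξ (ofSectionHom_mem _), contract_ofSectionHom, hskew, hΩ, pow_one, neg_smul, one_smul, mul_neg,
          neg_neg]
      rw [map_smul, map_sum, Finset.sum_congr rfl fun i _ => h1 i, Finset.sum_add_distrib,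
        IsDualFrame.sum_mul_contract hST (hk ξ), ← map_sum, IsDualFrame.sum_smul_dual hST, hΩ,
        smul_add, smul_smul, ← add_smul]
      have : ((k : ℝ) + 1)⁻¹ + ((k : ℝ) + 1)⁻¹ * k = 1 := by field_simp; ring
      rw [this, one_smul]
  choose g w hg hw hc using hloc
  have hval : ∀ x₀ x, (w x₀).1 x = g x₀ x • (w x).1 x := by
    intro x₀ x
    refine sub_eq_zero.1 (eq_zero_of_contractMultivector (E := E) (F := F) (k := k)
      (sub_mem (hw x₀ x) (Submodule.smul_mem _ _ (hw x x))) fun ξ => ?_)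
    have h1 := congrArg (fun t : Multisection E F A => t.1 x) (hc x₀ ξ)
    have h2 := congrArg (fun t : Multisection E F A => t.1 x) (hc x ξ)
    simp only [ofFunHom_mul_val, contract_val, hg, one_smul] at h1 h2
    rw [map_sub, map_smul, h1, h2, sub_self]
  refine ⟨⟨fun x => (w x).1 x, isSmoothMultisection_of_smul fun x₀ => ⟨g x₀, by simp [hg], ?_⟩⟩,
    fun x => hw x x, fun ξ => ext fun x => ?_⟩
  · have := (w x₀).2
    rwa [show (w x₀).1 = fun x => g x₀ x • (w x).1 x from funext (hval x₀)] at this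
  · have h2 := congrArg (fun t : Multisection E F A => t.1 x) (hc x ξ)
    simpa only [ofFunHom_mul_val, contract_val, hg, one_smul] using h2

end Multisection

end Multisections

end HomBundles

namespace HomBundles

/-! ### Extending data on functions and sections to a graded derivation -/

noncomputable section Multisections

variable {E : Type*} [NormedAddCommGroup E] [NormedSpace ℝ E]
  {M : Type*} [TopologicalSpace M] [ChartedSpace E M]
  {F : Type*} [NormedAddCommGroup F] [NormedSpace ℝ F]
  {A : M → Type*} [TopologicalSpace (TotalSpace F A)]
  [∀ x, AddCommGroup (A x)] [∀ x, Module ℝ (A x)] [∀ x, TopologicalSpace (A x)]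
  [FiberBundle F A] [VectorBundle ℝ F A] [FiniteDimensional ℝ F]
  [IsManifold 𝓘(ℝ, E) ∞ M] [ContMDiffVectorBundle ∞ F A 𝓘(ℝ, E)]
  [∀ x, IsTopologicalAddGroup (A x)] [∀ x, ContinuousSMul ℝ (A x)]
  [FiniteDimensional ℝ E] [T2Space M]

namespace Multisection

/-- The recursion through dual frames, on fields of multivectors, for the graded derivation which
extends given maps on functions and sections. -/
structure IsFrameRecursion (n : ℕ) (δ₀ : Fn E M →ₗ[ℝ] Multisection E F A)
    (δ₁ : Sec E F A →ₗ[ℝ] Multisection E F A)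
    (S : M → Fin (Module.finrank ℝ F) → Sec E F A)
    (T : M → Fin (Module.finrank ℝ F) → DualSec E F A) (h : M → Fn E M)
    (δ : ℕ → Multisection E F A →ₗ[ℝ] ∀ x, ExteriorAlgebra ℝ (A x)) : Prop where
  frame : ∀ x, IsDualFrame (S x) (T x) (h x)
  apply_self : ∀ x, h x x = 1
  mem : ∀ k, n = k + 1 → ∀ f, δ₀ f ∈ degree E F A k
  eq_zero : n = 0 → δ₀ = 0
  mem_one : ∀ X, δ₁ X ∈ degree E F A n
  mul : ∀ f g, δ₀ (f * g) = δ₀ f * ofFunHom g + ofFunHom f * δ₀ g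
  smul : ∀ (f : Fn E M) X, δ₁ (f • X) = δ₀ f * ofSectionHom X + ofFunHom f * δ₁ X
  zero : ∀ f x, δ 0 (ofFunHom f) x = (δ₀ f).1 x
  -- The derivation rule applied to Euler's formula and evaluated at x, where h = 1. On the right,
  -- δ(hs) contributes δ s + δ₀(h) s.
  succ : ∀ k s x, ∑ i, ((δ₁ (S x i)).1 x * (contract (T x i) s).1 x + (-1 : ℝ) ^ (n + 1) •
    (ExteriorAlgebra.ι ℝ (S x i x) * δ k (contract (T x i) s) x)) =
      ((k : ℝ) + 1) • (δ (k + 1) s x + (δ₀ (h x)).1 x * s.1 x)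

theorem exists_isFrameRecursion (n : ℕ) (δ₀ : Fn E M →ₗ[ℝ] Multisection E F A)
    (δ₁ : Sec E F A →ₗ[ℝ] Multisection E F A)
    (mem : ∀ k, n = k + 1 → ∀ f, δ₀ f ∈ degree E F A k) (eq_zero : n = 0 → δ₀ = 0)
    (mem_one : ∀ X, δ₁ X ∈ degree E F A n)
    (mul : ∀ f g, δ₀ (f * g) = δ₀ f * ofFunHom g + ofFunHom f * δ₀ g)
    (smul : ∀ (f : Fn E M) X, δ₁ (f • X) = δ₀ f * ofSectionHom X + ofFunHom f * δ₁ X) :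
    ∃ S T h δ, IsFrameRecursion n δ₀ δ₁ S T h δ := by
  choose S T h hx hST using exists_dual_frame E F A
  -- A linear left inverse of the inclusion of functions lets δ₀ act on all multisections; only its
  -- effect in degree 0 matters.
  obtain ⟨g, hg⟩ := LinearMap.exists_leftInverse_of_injective
    (ofFunHom : Fn E M →ₐ[ℝ] Multisection E F A).toLinearMap
    (LinearMap.ker_eq_bot.2 ofFunHom_injective)
  -- The frame varies with the point x without any regularity, so the result is a mere field of
  -- multivectors. Its smoothness is a separate matter, settled in `IsFrameRecursion.isSmooth`.
  let step : ℕ → (Multisection E F A →ₗ[ℝ] ∀ x, ExteriorAlgebra ℝ (A x)) →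
      Multisection E F A →ₗ[ℝ] ∀ x, ExteriorAlgebra ℝ (A x) := fun k D => LinearMap.pi fun x =>
    ((k : ℝ) + 1)⁻¹ • (∑ i, (LinearMap.mulLeft ℝ ((δ₁ (S x i)).1 x) ∘ₗ (eval x).toLinearMap ∘ₗ
      contract (T x i) + (-1 : ℝ) ^ (n + 1) • LinearMap.mulLeft ℝ (ExteriorAlgebra.ι ℝ (S x i x)) ∘ₗ
        LinearMap.proj x ∘ₗ D ∘ₗ contract (T x i))) -
      LinearMap.mulLeft ℝ ((δ₀ (h x)).1 x) ∘ₗ (eval x).toLinearMap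
  refine ⟨S, T, h, Nat.rec ((LinearMap.pi fun x => (eval x).toLinearMap) ∘ₗ δ₀ ∘ₗ g) step,
    hST, hx, mem, eq_zero, mem_one, mul, smul, fun f x => ?_, fun k s x => ?_⟩
  · have : g (ofFunHom f) = f := LinearMap.congr_fun hg f
    change (δ₀ (g (ofFunHom f))).1 x = _
    rw [this]
  · have hk : ((k : ℝ) + 1) ≠ 0 := by positivity
    generalize hD : (Nat.rec ((LinearMap.pi fun x => (eval x).toLinearMap) ∘ₗ δ₀ ∘ₗ g) step k :
      Multisection E F A →ₗ[ℝ] ∀ x, ExteriorAlgebra ℝ (A x)) = D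
    simp only [hD, step, LinearMap.pi_apply, LinearMap.sub_apply, LinearMap.smul_apply,
      LinearMap.sum_apply, LinearMap.add_apply, LinearMap.comp_apply, LinearMap.mulLeft_apply,
      LinearMap.proj_apply, AlgHom.toLinearMap_apply, eval_apply, sub_add_cancel]
    rw [smul_inv_smul₀ hk]

namespace IsFrameRecursion

variable {n : ℕ} {δ₀ : Fn E M →ₗ[ℝ] Multisection E F A} {δ₁ : Sec E F A →ₗ[ℝ] Multisection E F A}
  {S : M → Fin (Module.finrank ℝ F) → Sec E F A}
  {T : M → Fin (Module.finrank ℝ F) → DualSec E F A} {h : M → Fn E M}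
  {δ : ℕ → Multisection E F A →ₗ[ℝ] ∀ x, ExteriorAlgebra ℝ (A x)}
  (R : IsFrameRecursion n δ₀ δ₁ S T h δ)

include R

theorem apply_mem (k : ℕ) : ∀ s ∈ degree E F A k, ∀ x,
    (∀ q, k + n = q + 1 → δ k s x ∈ ⋀[ℝ]^q (A x)) ∧ (k + n = 0 → δ k s x = 0) := by
  induction k with
  | zero =>
    intro s hs x
    obtain ⟨f, rfl⟩ := mem_degree_zero.1 hs
    rw [R.zero]
    exact ⟨fun q hq => R.mem q (by omega) f x, fun hn => by rw [R.eq_zero (by omega)]; rfl⟩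
  | succ k ih =>
    intro s hs x
    refine ⟨fun q hq => ?_, fun hn => by omega⟩
    obtain rfl : q = k + n := by omega
    have h1 : (δ₀ (h x)).1 x * s.1 x ∈ ⋀[ℝ]^(k + n) (A x) := by
      rcases n with _ | n
      · rw [R.eq_zero rfl]
        simp
      · have := mul_mem_exteriorPower (R.mem n rfl (h x) x) (hs x)
        rwa [show n + (k + 1) = k + (n + 1) by ring] at this
    have h2 : ((k : ℝ) + 1) • (δ (k + 1) s x + (δ₀ (h x)).1 x * s.1 x) ∈ ⋀[ℝ]^(k + n) (A x) := by
      rw [← R.succ]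
      refine Submodule.sum_mem _ fun i _ => add_mem ?_ (Submodule.smul_mem _ _ ?_)
      · rw [add_comm]
        exact mul_mem_exteriorPower (R.mem_one _ x) (contract_mem (T x i) hs x)
      · obtain ⟨h3, h4⟩ := ih _ (contract_mem (T x i) hs) x
        rcases Nat.eq_zero_or_pos (k + n) with hkn | hkn
        · rw [h4 hkn, mul_zero]
          exact zero_mem _
        · obtain ⟨q, hq⟩ := Nat.exists_eq_succ_of_ne_zero hkn.ne'
          rw [hq]
          exact ι_mul_mem_exteriorPower (h3 q hq) _
    have h3 := Submodule.smul_mem _ ((k : ℝ) + 1)⁻¹ h2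
    rw [inv_smul_smul₀ (by positivity)] at h3
    exact (Submodule.add_mem_iff_left _ h1).1 h3

theorem ι_mul_comm {k : ℕ} {s : Multisection E F A} (hs : s ∈ degree E F A k) (x : M) (v : A x) :
    ((-1 : ℝ) ^ k * (-1 : ℝ) ^ (n + 1)) • (ExteriorAlgebra.ι ℝ v * δ k s x) =
      δ k s x * ExteriorAlgebra.ι ℝ v := by
  obtain ⟨h1, h2⟩ := R.apply_mem k s hs x
  rcases Nat.eq_zero_or_pos (k + n) with hkn | hkn
  · rw [h2 hkn]; simp
  · obtain ⟨q, hq⟩ := Nat.exists_eq_succ_of_ne_zero hkn.ne'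
    rw [ι_mul_comm_exteriorPower v (h1 q hq), smul_smul, ← pow_add, ← add_assoc, hq, ← pow_add,
      show q.succ + 1 + q = 2 * (q + 1) by omega, pow_mul]
    simp

theorem δ₀_mul_comm (f : Fn E M) {k : ℕ} {x : M} {a : ExteriorAlgebra ℝ (A x)}
    (ha : a ∈ ⋀[ℝ]^k (A x)) :
    (δ₀ f).1 x * a = (-1 : ℝ) ^ ((n + 1) * k) • (a * (δ₀ f).1 x) := by
  rcases n with _ | n
  · rw [R.eq_zero rfl]; simp
  · rw [mul_comm_exteriorPower (R.mem n rfl f x) ha, add_assoc, add_mul, pow_add,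
      mul_comm (1 + 1) k, pow_mul' _ k]
    simp

/-- Induction on the total degree m = p + q. Contracting ab produces terms of total degree m - 1, to
which the induction hypothesis applies, and `leibniz_step` recombines them into the recursions for a
and b. -/
theorem leibniz (m : ℕ) : ∀ p q, p + q = m → ∀ a ∈ degree E F A p, ∀ b ∈ degree E F A q, ∀ x,
    δ m (a * b) x = δ p a x * b.1 x + (-1 : ℝ) ^ ((n + 1) * p) • (a.1 x * δ q b x) := by
  induction m with
  | zero =>
    intro p q hpq a ha b hb x
    obtain ⟨rfl, rfl⟩ : p = 0 ∧ q = 0 := by omega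
    obtain ⟨f, rfl⟩ := mem_degree_zero.1 ha
    obtain ⟨g, rfl⟩ := mem_degree_zero.1 hb
    rw [← map_mul, R.zero, R.zero, R.zero, R.mul]
    simp
  | succ m ih =>
    intro p q hpq a ha b hb x
    have he : (-1 : ℝ) ^ (n + 1) * (-1 : ℝ) ^ (n + 1) = 1 := by
      rw [← mul_pow]; simp
    have euler : ∀ r, ∀ s ∈ degree E F A r,
        ∑ i, ExteriorAlgebra.ι ℝ (S x i x) * (contract (T x i) s).1 x = (r : ℝ) • s.1 x := by
      intro r s hs
      have := (R.frame x).sum_mul_contractMultivector (hs x)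
      rwa [R.apply_self, mul_one] at this
    have rec_ : ∀ r, ∀ s ∈ degree E F A r,
        ∑ i, ((δ₁ (S x i)).1 x * (contract (T x i) s).1 x + (-1 : ℝ) ^ (n + 1) •
          (ExteriorAlgebra.ι ℝ (S x i x) * δ (r - 1) (contract (T x i) s) x)) =
            (r : ℝ) • (δ r s x + (δ₀ (h x)).1 x * s.1 x) := by
      intro r s hs
      rcases r with _ | r
      · simp [contract_eq_zero _ hs]
      · rw [Nat.add_sub_cancel, R.succ]
        push_cast
        rfl
    have ih1 : ∀ i, δ m (contract (T x i) a * b) x = δ (p - 1) (contract (T x i) a) x * b.1 x +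
        ((-1 : ℝ) ^ ((n + 1) * p) * (-1 : ℝ) ^ (n + 1)) •
          ((contract (T x i) a).1 x * δ q b x) := by
      intro i
      rcases p with _ | p
      · simp [contract_eq_zero _ ha]
      · rw [ih p q (by omega) _ (contract_mem _ ha) b hb x, mul_add_one, pow_add, mul_assoc, he,
          mul_one, Nat.add_sub_cancel]
    have ih2 : ∀ i, δ m (a * contract (T x i) b) x = δ p a x * (contract (T x i) b).1 x +
        (-1 : ℝ) ^ ((n + 1) * p) • (a.1 x * δ (q - 1) (contract (T x i) b) x) := by
      intro i
      rcases q with _ | q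
      · simp [contract_eq_zero _ hb]
      · rw [ih p q (by omega) a ha _ (contract_mem _ hb) x, Nat.add_sub_cancel]
    have main := leibniz_step (R := ExteriorAlgebra ℝ (A x)) (s := (-1 : ℝ) ^ p)
      (euler p a ha) (euler q b hb) (rec_ p a ha) (rec_ q b hb)
      (fun i => by
        rw [mul_comm_exteriorPower (R.mem_one (S x i) x) (ha x), smul_smul, ← pow_add,
          show p + n * p = (n + 1) * p by ring])
      (fun i => by
        rw [ι_mul_comm_exteriorPower _ (ha x), smul_smul, ← mul_pow]
        simp)
      (fun i => R.ι_mul_comm ha x (S x i x)) (R.δ₀_mul_comm (h x) (ha x)) he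
    have succ := R.succ m (a * b) x
    simp only [contract_mul _ ha, map_add, map_smul, Pi.add_apply, Pi.smul_apply, ih1, ih2,
      add_val, mul_val, smul_val] at succ
    rw [main, ← Nat.cast_add, hpq, Nat.cast_succ] at succ
    exact (add_right_cancel (smul_right_injective _ (show ((m : ℝ) + 1) ≠ 0 by positivity)
      succ)).symm

/-- For k = 0 the left side of the recursion is δ₁ applied to ∑ ⟨X, T_i⟩ S_i = hX, and δ₁(hX) =
δ₀(h) X + δ₁(X) where h = 1. -/
theorem apply_section (X : Sec E F A) (x : M) : δ 1 (ofSectionHom X) x = (δ₁ X).1 x := by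
  have h1 := R.succ 0 (ofSectionHom X) x
  have h2 := congrArg (fun Y => (δ₁ Y).1 x) (R.frame x X)
  simp only [map_sum, R.smul, sum_val, add_val, mul_val, Finset.sum_add_distrib,
    ofSectionHom_val, ofFunHom_val, R.apply_self, map_one, one_mul] at h2
  simp only [contract_ofSectionHom, R.zero, Finset.sum_add_distrib, Nat.cast_zero, zero_add,
    one_smul, ofFunHom_val, ofSectionHom_val] at h1
  have h3 : ∀ i, (-1 : ℝ) ^ (n + 1) • (ExteriorAlgebra.ι ℝ (S x i x) *
      (δ₀ (pairing X (T x i))).1 x) = (δ₀ (pairing X (T x i))).1 x *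
        ExteriorAlgebra.ι ℝ (S x i x) := by
    intro i
    rw [R.δ₀_mul_comm _ (mem_exteriorPower_one.2 ⟨_, rfl⟩), mul_one]
  simp only [h3, ← Algebra.commutes (pairing X (T x _) x)] at h1
  rw [add_comm, h2, add_comm] at h1
  exact (add_right_cancel h1).symm

/-- The Leibniz rule holds at every point, so it may be applied to Euler's formula for the frame of
one fixed x₀. This writes h δ s through smooth multisections of lower degree. -/
theorem isSmooth (k : ℕ) : ∀ s ∈ degree E F A k, IsSmoothMultisection E F A (δ k s) := by
  induction k with
  | zero =>
    intro s hs
    obtain ⟨f, rfl⟩ := mem_degree_zero.1 hs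
    have := (δ₀ f).2
    rwa [show (δ₀ f).1 = δ 0 (ofFunHom f) from funext fun x => (R.zero f x).symm] at this
  | succ k ih =>
    intro s hs
    refine isSmoothMultisection_of_smul fun x₀ => ⟨h x₀, by simp [R.apply_self], ?_⟩
    let D : Fin (Module.finrank ℝ F) → Multisection E F A := fun i =>
      ⟨δ k (contract (T x₀ i) s), ih _ (contract_mem _ hs)⟩
    have hsm := (((k : ℝ) + 1)⁻¹ • ∑ i, (δ₁ (S x₀ i) * contract (T x₀ i) s +
      (-1 : ℝ) ^ (n + 1) • (ofSectionHom (S x₀ i) * D i)) - δ₀ (h x₀) * s).2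
    refine Eq.subst (motive := IsSmoothMultisection E F A) (funext fun x => ?_) hsm
    have h1 := congrArg (fun t => δ (k + 1) t x) ((R.frame x₀).sum_mul_contract hs)
    simp only [map_sum, map_smul, Finset.sum_apply, Pi.smul_apply] at h1
    rw [R.leibniz (k + 1) 0 (k + 1) (by omega) _ (ofFunHom_mem _) _ hs, R.zero,
      Finset.sum_congr rfl fun i _ => R.leibniz (k + 1) 1 k (by omega) _
        (ofSectionHom_mem (S x₀ i)) _ (contract_mem (T x₀ i) hs) x] at h1
    simp only [R.apply_section] at h1
    change ((k : ℝ) + 1)⁻¹ • (∑ i, (δ₁ (S x₀ i) * contract (T x₀ i) s +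
      (-1 : ℝ) ^ (n + 1) • (ofSectionHom (S x₀ i) * D i))).1 x - (δ₀ (h x₀)).1 x * s.1 x = _
    rw [sum_val]
    simp only [mul_one, mul_zero, pow_zero, one_smul, ofFunHom_val] at h1
    change ((k : ℝ) + 1)⁻¹ • (∑ i, ((δ₁ (S x₀ i)).1 x * (contract (T x₀ i) s).1 x +
      (-1 : ℝ) ^ (n + 1) • ((ofSectionHom (S x₀ i)).1 x * δ k (contract (T x₀ i) s) x))) -
        (δ₀ (h x₀)).1 x * s.1 x = _
    rw [h1, Nat.cast_succ, inv_smul_smul₀ (by positivity), add_sub_cancel_left,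
      ← Algebra.smul_def]

end IsFrameRecursion

theorem exists_isGradedDerivation (n : ℕ) (δ₀ : Fn E M →ₗ[ℝ] Multisection E F A)
    (δ₁ : Sec E F A →ₗ[ℝ] Multisection E F A)
    (mem : ∀ k, n = k + 1 → ∀ f, δ₀ f ∈ degree E F A k) (eq_zero : n = 0 → δ₀ = 0)
    (mem_one : ∀ X, δ₁ X ∈ degree E F A n)
    (mul : ∀ f g, δ₀ (f * g) = δ₀ f * ofFunHom g + ofFunHom f * δ₀ g)
    (smul : ∀ (f : Fn E M) X, δ₁ (f • X) = δ₀ f * ofSectionHom X + ofFunHom f * δ₁ X) :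
    ∃ δ, IsGradedDerivation (degree E F A) n δ ∧ (∀ f, δ (ofFunHom f) = δ₀ f) ∧
      ∀ X, δ (ofSectionHom X) = δ₁ X := by
  obtain ⟨S, T, h, D, R⟩ := exists_isFrameRecursion n δ₀ δ₁ mem eq_zero mem_one mul smul
  let δ : Multisection E F A →ₗ[ℝ] Multisection E F A :=
    ∑ k ∈ Finset.range (Module.finrank ℝ F + 1),
      { toFun := fun s => ⟨D k (proj k s).1, R.isSmooth k _ (proj k s).2⟩
        map_add' := fun s t => by
          ext x
          exact congrFun (((D k ∘ₗ (degree E F A k).subtype) ∘ₗ proj k).map_add s t) x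
        map_smul' := fun r s => by
          ext x
          exact congrFun (((D k ∘ₗ (degree E F A k).subtype) ∘ₗ proj k).map_smul r s) x }
  have hδ : ∀ k, ∀ s ∈ degree E F A k, ∀ x, (δ s).1 x = D k s x := by
    intro k s hs x
    have h1 : (δ s).1 x = ∑ i ∈ Finset.range (Module.finrank ℝ F + 1), D i (proj i s).1 x := by
      simp only [δ, LinearMap.sum_apply, sum_val]
      rfl
    rw [h1]
    have hne : ∀ i, i ≠ k → (proj i s).1 = 0 := fun i hi =>
      ext fun x => degreePart_of_mem_ne (hs x) hi.symm
    have heq : (proj k s).1 = s := ext fun x => degreePart_of_mem (hs x)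
    by_cases hk : k < Module.finrank ℝ F + 1
    · rw [Finset.sum_eq_single k (fun i _ hi => by rw [hne i hi, map_zero]; rfl)
        (fun h => absurd (Finset.mem_range.2 hk) h), heq]
    · rw [degree_eq_zero (by omega) hs]
      simp
  refine ⟨δ, ⟨fun i k hik a ha x => ?_, fun hn a ha => ext fun x => ?_, fun i a ha b => ?_⟩,
    fun f => ext fun x => ?_, fun X => ext fun x => ?_⟩
  · rw [hδ i a ha]
    exact (R.apply_mem i a ha x).1 k hik
  · rw [hδ 0 a ha]
    exact (R.apply_mem 0 a ha x).2 (by omega)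
  · refine LinearMap.congr_fun (f := δ ∘ₗ LinearMap.mulLeft ℝ a) (g := LinearMap.mulLeft ℝ (δ a) +
      (-1 : ℝ) ^ ((n + 1) * i) • LinearMap.mulLeft ℝ a ∘ₗ δ)
      (isGradedCommutativeAlgebra.linearMap_ext fun j b hb => ext fun x => ?_) b
    have hab := isGradedCommutativeAlgebra.mul_mem ha hb
    simp only [LinearMap.comp_apply, LinearMap.mulLeft_apply, LinearMap.add_apply,
      LinearMap.smul_apply, add_val, smul_val, mul_val, hδ _ _ hab, hδ _ _ ha, hδ _ _ hb]
    exact R.leibniz (i + j) i j rfl a ha b hb x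
  · rw [hδ 0 _ (ofFunHom_mem f), R.zero]
  · rw [hδ 1 _ (ofSectionHom_mem X), R.apply_section]

variable (E F A) in
/-- The calculus of multisections. -/
def calculus : ExteriorCalculus (Fn E M) (Sec E F A) (DualSec E F A) (Multisection E F A) where
  deg := degree E F A
  j := ofFunHom
  ι := ofSectionHom
  pair := pairing
  I := contract
  gca := isGradedCommutativeAlgebra
  j_injective := ofFunHom_injective
  ι_injective := ofSectionHom_injective
  mem_zero _ := mem_degree_zero
  mem_one _ := mem_degree_one
  ι_smul := ofSectionHom_smul
  pair_smul_left f X ξ := by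
    ext x
    exact map_smul (ξ x) (f x) (X x)
  pair_smul_right f X ξ := by
    ext x
    rfl
  pair_ext ξ η h := dualSection_ext fun X x => congrArg (fun g : Fn E M => g x) (h X)
  pair_rep Φ hΦ := exists_pairing_eq Φ hΦ
  I_der ξ :=
    { mem := fun i k hik a ha => contract_mem ξ (by rwa [← hik])
      zero := fun _ a ha => contract_eq_zero ξ ha
      leibniz := fun i a ha b => by
        rw [contract_mul ξ ha, zero_add, one_mul] }
  I_ι := contract_ofSectionHom
  I_smul := contract_smul
  I_I := contract_contract
  sep k s hs h := ext fun x => eq_zero_of_contractMultivector (E := E) (F := F) (hs x) fun ξ =>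
    congrArg (fun t : Multisection E F A => t.1 x) (h ξ)
  uniq := linearMap_eq_zero
  exists_ext := exists_isGradedDerivation
  exists_rep := exists_contract_eq

end Multisection

end Multisections

end HomBundles

namespace HomBundles

/-! ### The automorphism of multisections extending (ψ*, β) -/

noncomputable section Extension

variable {E : Type*} [NormedAddCommGroup E] [NormedSpace ℝ E]
  {M : Type*} [TopologicalSpace M] [ChartedSpace E M]
  {F : Type*} [NormedAddCommGroup F] [NormedSpace ℝ F]
  {A : M → Type*} [TopologicalSpace (TotalSpace F A)]
  [∀ x, AddCommGroup (A x)] [∀ x, Module ℝ (A x)] [∀ x, TopologicalSpace (A x)]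
  [FiberBundle F A] [VectorBundle ℝ F A] [FiniteDimensional ℝ F]
  [IsManifold 𝓘(ℝ, E) ∞ M] [ContMDiffVectorBundle ∞ F A 𝓘(ℝ, E)]
  [∀ x, IsTopologicalAddGroup (A x)] [∀ x, ContinuousSMul ℝ (A x)]
  [FiniteDimensional ℝ E] [T2Space M]

open Multisection

/-- Take Euler's formula for a frame around φ(x). At x the factor α(h) equals h(φ x) = 1, so α(s) is
expressed there by the images of sections and of elements of lower degree. -/
theorem algHom_ext {φ : M → M} {α α' : Multisection E F A →ₐ[ℝ] Multisection E F A}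
    (hφ : ∀ f x, (α (ofFunHom f)).1 x = algebraMap ℝ _ (f (φ x)))
    (h0 : ∀ f, α (ofFunHom f) = α' (ofFunHom f))
    (h1 : ∀ X, α (ofSectionHom X) = α' (ofSectionHom X)) : α = α' := by
  suffices α.toLinearMap = α'.toLinearMap from AlgHom.toLinearMap_injective this
  refine isGradedCommutativeAlgebra.linearMap_ext fun k => ?_
  induction k with
  | zero =>
    intro a ha
    obtain ⟨f, rfl⟩ := mem_degree_zero.1 ha
    exact h0 f
  | succ k ih =>
    intro s hs
    ext x
    obtain ⟨S, T, g, hg, hST⟩ := exists_dual_frame E F A (φ x)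
    have key : ∀ γ : Multisection E F A →ₐ[ℝ] Multisection E F A,
        (∀ f, γ (ofFunHom f) = α (ofFunHom f)) →
        ((k + 1 : ℕ) : ℝ) • (γ s).1 x =
          (∑ i, γ (ofSectionHom (S i)) * γ (contract (T i) s)).1 x := by
      intro γ hγ
      have h2 := congrArg (fun t => (γ t).1 x) (IsDualFrame.sum_mul_contract hST hs)
      simp only [map_sum, map_mul, map_smul, hγ, smul_val, mul_val, hφ, hg, map_one, one_mul] at h2
      exact h2.symm
    have h2 := key α fun _ => rfl
    have h3 := key α' fun f => (h0 f).symm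
    have h4 : ∀ i, α (contract (T i) s) = α' (contract (T i) s) := fun i =>
      ih _ (contract_mem _ hs)
    simp only [h1, h4] at h2
    exact smul_right_injective _ (show ((k + 1 : ℕ) : ℝ) ≠ 0 by positivity) (h2.trans h3.symm)

theorem algHom_mem_degree {φ : M → M} {α : Multisection E F A →ₐ[ℝ] Multisection E F A}
    (hφ : ∀ f x, (α (ofFunHom f)).1 x = algebraMap ℝ _ (f (φ x)))
    (h1 : ∀ X, α (ofSectionHom X) ∈ degree E F A 1) (k : ℕ) :
    ∀ s ∈ degree E F A k, α s ∈ degree E F A k := by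
  induction k with
  | zero =>
    intro a ha x
    obtain ⟨f, rfl⟩ := mem_degree_zero.1 ha
    rw [hφ]
    exact mem_exteriorPower_zero.2 ⟨_, rfl⟩
  | succ k ih =>
    intro s hs x
    obtain ⟨S, T, g, hg, hST⟩ := exists_dual_frame E F A (φ x)
    have h2 := congrArg (fun t => (α t).1 x) (IsDualFrame.sum_mul_contract hST hs)
    simp only [map_sum, map_mul, map_smul, smul_val, mul_val, hφ, hg, map_one, one_mul] at h2
    rw [← inv_smul_smul₀ (show ((k + 1 : ℕ) : ℝ) ≠ 0 by positivity) ((α s).1 x), ← h2, sum_val]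
    refine Submodule.smul_mem _ _ (Submodule.sum_mem _ fun i _ => ?_)
    have := mul_mem_exteriorPower (h1 (S i) x) (ih _ (contract_mem (T i) hs) x)
    rwa [add_comm] at this

namespace InvertibleHomBundle

variable (B : InvertibleHomBundle E F A)

/-- The pull-back of functions along the diffeomorphism of the base. -/
def pull (f : Fn E M) : Fn E M := f.comp (B.ψ : C^∞⟮𝓘(ℝ, E), M; 𝓘(ℝ, E), M⟯)

@[simp]
theorem pull_apply (f : Fn E M) (x : M) : B.pull f x = f (B.ψ x) := rfl

theorem β_smul (f : Fn E M) (X : Sec E F A) : B.β (f • X) = B.pull f • B.β X := B.map_fsmul f X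

theorem isExtension_iff {α : Multisection E F A →ₐ[ℝ] Multisection E F A} :
    B.IsExtension α ↔ (∀ f, α (ofFunHom f) = ofFunHom (B.pull f)) ∧
      ∀ X, α (ofSectionHom X) = ofSectionHom (B.β X) := Iff.rfl

theorem exists_fiber : ∀ x : M, ∃ G : A (B.ψ x) →ₗ[ℝ] A x, ∀ X : Sec E F A,
    G (X (B.ψ x)) = B.β X x := fun x =>
  exists_fiberMap (Φ := (LinearMap.mk ⟨fun X : Sec E F A => X x, fun _ _ => rfl⟩
    fun _ _ => rfl : Sec E F A →ₗ[ℝ] A x) ∘ₗ B.β.toLinearMap) fun f X =>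
      congrArg (fun Y : Sec E F A => Y x) (B.β_smul f X)

/-- β acts through linear maps A_{ψ x} → A_x, and exterior powers of these give the extension
pointwise. It is smooth by Euler's formula and induction on the degree. -/
theorem exists_isExtension : ∃ α, B.IsExtension α := by
  choose G hG using B.exists_fiber
  let Φ : Multisection E F A →ₐ[ℝ] ∀ x, ExteriorAlgebra ℝ (A x) :=
    AlgHom.pi fun x => (ExteriorAlgebra.map (G x)).comp (eval (B.ψ x))
  have hΦ : ∀ s x, Φ s x = ExteriorAlgebra.map (G x) (s.1 (B.ψ x)) := fun s x => rfl
  have hj : ∀ f x, Φ (ofFunHom f) x = algebraMap ℝ _ (f (B.ψ x)) := fun f x => by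
    rw [hΦ, ofFunHom_val, AlgHom.commutes]
  have hι : ∀ X x, Φ (ofSectionHom X) x = ExteriorAlgebra.ι ℝ (B.β X x) := fun X x => by
    rw [hΦ, ofSectionHom_val, ExteriorAlgebra.map_apply_ι, hG]
  have hk : ∀ k, ∀ s ∈ degree E F A k, IsSmoothMultisection E F A (Φ s) := by
    intro k
    induction k with
    | zero =>
      intro s hs
      obtain ⟨f, rfl⟩ := mem_degree_zero.1 hs
      have := (ofFunHom (B.pull f) : Multisection E F A).2
      rwa [show (ofFunHom (B.pull f) : Multisection E F A).1 = Φ (ofFunHom f) from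
        funext fun x => (hj f x).symm] at this
    | succ k ih =>
      intro s hs
      refine isSmoothMultisection_of_smul fun x₀ => ?_
      obtain ⟨S, T, g, hg, hST⟩ := exists_dual_frame E F A (B.ψ x₀)
      refine ⟨B.pull g, by simp [hg], ?_⟩
      let D : Fin (Module.finrank ℝ F) → Multisection E F A := fun i =>
        ⟨Φ (contract (T i) s), ih _ (contract_mem _ hs)⟩
      have hsm := (((k + 1 : ℕ) : ℝ)⁻¹ • ∑ i, ofSectionHom (B.β (S i)) * D i).2
      refine Eq.subst (motive := IsSmoothMultisection E F A) (funext fun x => ?_) hsm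
      have h1 := congrArg (fun t => Φ t x) (IsDualFrame.sum_mul_contract hST hs)
      simp only [map_sum, map_mul, map_smul, Finset.sum_apply, Pi.mul_apply, Pi.smul_apply,
        hι, hj, ← Algebra.smul_def] at h1
      change ((k + 1 : ℕ) : ℝ)⁻¹ • (∑ i, ofSectionHom (B.β (S i)) * D i).1 x = _
      rw [sum_val]
      change ((k + 1 : ℕ) : ℝ)⁻¹ • ∑ i, ExteriorAlgebra.ι ℝ (B.β (S i) x) * Φ (contract (T i) s) x
        = _
      rw [h1, inv_smul_smul₀ (by positivity)]
      rfl
  have hall : ∀ s, Φ s ∈ Multisection E F A := by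
    intro s
    rw [← sum_proj s, map_sum]
    exact sum_mem fun i _ => hk i _ (proj i s).2
  exact ⟨Φ.codRestrict _ hall, fun f => ext fun x => hj f x, fun X => ext fun x => hι X x⟩

variable {B}

theorem IsExtension.ofFunHom_val {α : Multisection E F A →ₐ[ℝ] Multisection E F A}
    (h : B.IsExtension α) (f : Fn E M) (x : M) :
    (α (ofFunHom f)).1 x = algebraMap ℝ _ (f (B.ψ x)) :=
  congrArg (fun t : Multisection E F A => t.1 x) (h.1 f)

theorem IsExtension.unique {α α' : Multisection E F A →ₐ[ℝ] Multisection E F A}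
    (h : B.IsExtension α) (h' : B.IsExtension α') : α = α' :=
  algHom_ext h.ofFunHom_val (fun f => (h.1 f).trans (h'.1 f).symm)
    fun X => (h.2 X).trans (h'.2 X).symm

theorem IsExtension.mem {α : Multisection E F A →ₐ[ℝ] Multisection E F A}
    (h : B.IsExtension α) (k : ℕ) : ∀ s ∈ degree E F A k, α s ∈ degree E F A k :=
  algHom_mem_degree h.ofFunHom_val (fun X => by
    rw [(B.isExtension_iff.1 h).2]
    exact ofSectionHom_mem _) k

variable (B)

/-- The inverse hom-bundle. -/
def symm : InvertibleHomBundle E F A where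
  ψ := B.ψ.symm
  β := B.β.symm
  map_fsmul f X := by
    ext x
    have := B.symm_fsmul f X (B.ψ.symm x)
    rw [B.ψ.apply_symm_apply] at this
    exact this

theorem symm_pull_pull (f : Fn E M) : B.symm.pull (B.pull f) = f := by
  ext x
  exact congrArg f (B.ψ.apply_symm_apply x)

theorem pull_symm_pull (f : Fn E M) : B.pull (B.symm.pull f) = f := by
  ext x
  exact congrArg f (B.ψ.symm_apply_apply x)

theorem exists_equiv : ∃ α : Multisection E F A ≃ₐ[ℝ] Multisection E F A,
    B.IsExtension α.toAlgHom ∧ B.symm.IsExtension α.symm.toAlgHom := by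
  obtain ⟨α, hα⟩ := B.exists_isExtension
  obtain ⟨α', hα'⟩ := B.symm.exists_isExtension
  refine ⟨AlgEquiv.ofAlgHom α α' ?_ ?_, hα, hα'⟩
  · rw [isExtension_iff] at hα hα'
    refine algHom_ext (φ := id) (fun f x => ?_) (fun f => ?_) (fun X => ?_)
    · rw [AlgHom.comp_apply, hα'.1, hα.1, pull_symm_pull]
      rfl
    · rw [AlgHom.comp_apply, hα'.1, hα.1, pull_symm_pull]
      rfl
    · rw [AlgHom.comp_apply, hα'.2, hα.2]
      exact congrArg ofSectionHom (B.β.apply_symm_apply X)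
  · rw [isExtension_iff] at hα hα'
    refine algHom_ext (φ := id) (fun f x => ?_) (fun f => ?_) (fun X => ?_)
    · rw [AlgHom.comp_apply, hα.1, hα'.1, symm_pull_pull]
      rfl
    · rw [AlgHom.comp_apply, hα.1, hα'.1, symm_pull_pull]
      rfl
    · rw [AlgHom.comp_apply, hα.2, hα'.2]
      exact congrArg ofSectionHom (B.β.symm_apply_apply X)

/-- The automorphism of the algebra of multisections which extends an invertible hom-bundle. -/
def ext : Multisection E F A ≃ₐ[ℝ] Multisection E F A := B.exists_equiv.choose

theorem ext_isExtension : B.IsExtension B.ext.toAlgHom := B.exists_equiv.choose_spec.1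

theorem ext_symm_isExtension : B.symm.IsExtension B.ext.symm.toAlgHom :=
  B.exists_equiv.choose_spec.2

theorem ext_ofFunHom (f : Fn E M) : B.ext (ofFunHom f) = ofFunHom (B.pull f) :=
  B.ext_isExtension.1 f

theorem ext_ofSectionHom (X : Sec E F A) : B.ext (ofSectionHom X) = ofSectionHom (B.β X) :=
  B.ext_isExtension.2 X

theorem pairing_β (X : Sec E F A) (ξ : DualSec E F A) :
    pairing (B.β X) (B.dual.β ξ) = B.pull (pairing X ξ) := by
  ext x
  rw [pairing_apply, dual_apply, LinearEquiv.symm_apply_apply]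
  rfl

/-- The automorphism of the calculus of multisections given by an invertible hom-bundle. -/
def automorphism : (calculus E F A).Automorphism where
  α := B.ext
  ψ := B.pull
  β := B.β
  β' := B.dual.β
  mem := B.ext_isExtension.mem
  symm_mem := B.ext_symm_isExtension.mem
  map_j := B.ext_ofFunHom
  map_ι := B.ext_ofSectionHom
  pair_map := B.pairing_β

end InvertibleHomBundle

end Extension

end HomBundles

namespace HomBundles

/-! ### Hadamard's lemma and derivations at a point -/

section Hadamard

variable {E : Type*} [NormedAddCommGroup E] [NormedSpace ℝ E] [FiniteDimensional ℝ E]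

theorem hasFDerivAt_intervalIntegral {f : E × ℝ → ℝ} (hf : ContDiff ℝ ∞ f) (x₀ : E) :
    HasFDerivAt (fun x => ∫ t in (0 : ℝ)..1, f (x, t))
      (∫ t in (0 : ℝ)..1, (fderiv ℝ f (x₀, t)).comp (ContinuousLinearMap.inl ℝ E ℝ)) x₀ := by
  have hf' : Continuous fun p : E × ℝ => (fderiv ℝ f p).comp (ContinuousLinearMap.inl ℝ E ℝ) :=
    ((hf.continuous_fderiv (by simp)).clm_comp continuous_const)
  -- The integrand's derivative is bounded on this compact set, and the constant bound dominates on
  -- [0, 1].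
  have hcpt : IsCompact (Metric.closedBall x₀ 1 ×ˢ Set.uIcc (0 : ℝ) 1) :=
    (isCompact_closedBall x₀ 1).prod isCompact_uIcc
  obtain ⟨K, hK⟩ := hcpt.exists_bound_of_continuousOn hf'.continuousOn
  refine intervalIntegral.hasFDerivAt_integral_of_dominated_of_fderiv_le
    (F := fun x t => f (x, t))
    (F' := fun x t => (fderiv ℝ f (x, t)).comp (ContinuousLinearMap.inl ℝ E ℝ))
    (s := Metric.ball x₀ 1) (bound := fun _ => K) (Metric.ball_mem_nhds _ one_pos) ?_ ?_ ?_ ?_ ?_ ?_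
  · exact Filter.Eventually.of_forall fun x =>
      (hf.continuous.comp (Continuous.prodMk_right x)).aestronglyMeasurable
  · exact (hf.continuous.comp (Continuous.prodMk_right x₀)).intervalIntegrable _ _
  · exact (hf'.comp (Continuous.prodMk_right x₀)).aestronglyMeasurable
  · refine Filter.Eventually.of_forall fun t ht x hx => hK (x, t) ⟨Metric.ball_subset_closedBall hx,
      Set.uIoc_subset_uIcc ht⟩
  · exact intervalIntegrable_const
  · refine Filter.Eventually.of_forall fun t _ x _ => ?_
    have h1 : HasFDerivAt f (fderiv ℝ f (x, t)) (x, t) :=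
      (hf.differentiable (by simp) (x, t)).hasFDerivAt
    exact h1.comp x (hasFDerivAt_prodMk_left x t)

/-- Induction on the order: each directional derivative is an integral of the same kind, of a
directional derivative of f. In finite dimension these control the full derivative. -/
theorem contDiff_intervalIntegral {f : E × ℝ → ℝ} (hf : ContDiff ℝ ∞ f) :
    ContDiff ℝ ∞ (fun x => ∫ t in (0 : ℝ)..1, f (x, t)) := by
  rw [contDiff_infty]
  intro n
  induction n generalizing f with
  | zero =>
    rw [Nat.cast_zero, contDiff_zero]
    exact continuous_iff_continuousAt.2 fun x => (hasFDerivAt_intervalIntegral hf x).continuousAt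
  | succ n ih =>
    rw [Nat.cast_succ, contDiff_succ_iff_fderiv_apply]
    refine ⟨fun x => (hasFDerivAt_intervalIntegral hf x).differentiableAt, fun h => by simp at h,
      fun y => ?_⟩
    have h1 : ContDiff ℝ ∞ (fun p : E × ℝ => fderiv ℝ f p (y, 0)) :=
      (hf.fderiv_right (m := ∞) (by simp)).clm_apply contDiff_const
    refine Eq.subst (motive := ContDiff ℝ n) (funext fun x => ?_) (ih h1)
    rw [(hasFDerivAt_intervalIntegral hf x).fderiv]
    rw [ContinuousLinearMap.intervalIntegral_apply]
    · simp
    · have hf' : Continuous fun p : E × ℝ => (fderiv ℝ f p).comp (ContinuousLinearMap.inl ℝ E ℝ) :=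
        ((hf.continuous_fderiv (by simp)).clm_comp continuous_const)
      exact (hf'.comp (Continuous.prodMk_right x)).intervalIntegrable _ _

/-- The functions are g_i(x) = ∫₀¹ ∂_i G(p + t(x - p)) dt, and the expansion is the fundamental
theorem of calculus along the segment from p to x. -/
theorem exists_hadamard {G : E → ℝ} (hG : ContDiff ℝ ∞ G) {κ : Type*} [Fintype κ]
    (b : Module.Basis κ ℝ E) (p : E) :
    ∃ g : κ → E → ℝ, (∀ i, ContDiff ℝ ∞ (g i)) ∧ (∀ x, G x = G p + ∑ i, b.coord i (x - p) * g i x) ∧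
      ∀ i, g i p = fderiv ℝ G p (b i) := by
  have hline : ContDiff ℝ ∞ (fun q : E × ℝ => p + q.2 • (q.1 - p)) := by fun_prop
  have hG' : ∀ i, ContDiff ℝ ∞ (fun q : E × ℝ => fderiv ℝ G (p + q.2 • (q.1 - p)) (b i)) := fun i =>
    ((hG.fderiv_right (m := ∞) (by simp)).comp hline).clm_apply contDiff_const
  refine ⟨fun i x => ∫ t in (0 : ℝ)..1, fderiv ℝ G (p + t • (x - p)) (b i),
    fun i => contDiff_intervalIntegral (hG' i), fun x => ?_, fun i => by simp⟩
  have hder : ∀ t ∈ Set.uIcc (0 : ℝ) 1, HasDerivAt (fun t : ℝ => G (p + t • (x - p)))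
      (fderiv ℝ G (p + t • (x - p)) (x - p)) t := by
    intro t _
    have h1 : HasDerivAt (fun t : ℝ => p + t • (x - p)) (x - p) t := by
      simpa using ((hasDerivAt_id t).smul_const (x - p)).const_add p
    exact (hG.differentiable (by simp) _).hasFDerivAt.comp_hasDerivAt t h1
  have hcont : ∀ v, Continuous fun t : ℝ => fderiv ℝ G (p + t • (x - p)) v := fun v =>
    ((hG.continuous_fderiv (by simp)).comp (by fun_prop)).clm_apply continuous_const
  have hftc := intervalIntegral.integral_eq_sub_of_hasDerivAt hder
    ((hcont (x - p)).intervalIntegrable _ _)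
  simp only [one_smul, zero_smul, add_zero, add_sub_cancel] at hftc
  rw [← sub_eq_iff_eq_add', ← hftc]
  simp only [← intervalIntegral.integral_const_mul]
  rw [← intervalIntegral.integral_finsetSum fun i _ =>
    ((hcont (b i)).const_mul _).intervalIntegrable _ _]
  refine intervalIntegral.integral_congr fun t _ => ?_
  change _ = ∑ i, b.coord i (x - p) * fderiv ℝ G (p + t • (x - p)) (b i)
  conv_lhs => rw [show fderiv ℝ G (p + t • (x - p)) (x - p) =
    fderiv ℝ G (p + t • (x - p)) (∑ i, b.repr (x - p) i • b i) by rw [b.sum_repr]]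
  simp

end Hadamard

noncomputable section Tangent

variable {E : Type*} [NormedAddCommGroup E] [NormedSpace ℝ E]
  {M : Type*} [TopologicalSpace M] [ChartedSpace E M] [IsManifold 𝓘(ℝ, E) ∞ M]

theorem mfderiv_eq_fderiv {f : M → ℝ} (hf : ContMDiff 𝓘(ℝ, E) 𝓘(ℝ, ℝ) ∞ f) (p : M) {G : E → ℝ}
    (hG : G =ᶠ[𝓝 (chartAt E p p)] f ∘ (chartAt E p).symm) (w : TangentSpace 𝓘(ℝ, E) p) :
    mfderiv 𝓘(ℝ, E) 𝓘(ℝ, ℝ) f p w = fderiv ℝ G (chartAt E p p) w := by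
  rw [((hf p).mdifferentiableAt (by simp)).mfderiv]
  have h1 : (extChartAt 𝓘(ℝ, E) p) p = chartAt E p p := by simp [mfld_simps]
  rw [show Set.range 𝓘(ℝ, E) = Set.univ by simp [mfld_simps], fderivWithin_univ, hG.fderiv_eq, h1]
  rfl

variable [FiniteDimensional ℝ E] [T2Space M]

/-- Cut-off of a function of the coordinates. -/
theorem exists_cutoff (p : M) {U : Set M} (hU : U ∈ 𝓝 p) :
    ∃ χ : Fn E M, χ =ᶠ[𝓝 p] 1 ∧ tsupport χ ⊆ (chartAt E p).source ∩ U ∧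
    ∀ g : E → ℝ, ContDiff ℝ ∞ g → ContMDiff 𝓘(ℝ, E) 𝓘(ℝ, ℝ) ∞ (fun x => χ x * g (chartAt E p x)) := by
  obtain ⟨χ, -, hχ⟩ := (SmoothBumpFunction.nhds_basis_tsupport (I := 𝓘(ℝ, E)) p).mem_iff.1
    (Filter.inter_mem ((chartAt E p).open_source.mem_nhds (mem_chart_source E p)) hU)
  have hχs : ContMDiff 𝓘(ℝ, E) 𝓘(ℝ, ℝ) ∞ χ := χ.contMDiff
  refine ⟨⟨χ, hχs⟩, χ.eventuallyEq_one, hχ, fun g hg => ?_⟩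
  refine contMDiff_of_tsupport fun x hx => ?_
  have hx' : x ∈ (chartAt E p).source := (hχ (closure_mono
    (Function.support_mul_subset_left (χ : M → ℝ) (fun x => g (chartAt E p x))) hx)).1
  have h1 : ContMDiffAt 𝓘(ℝ, E) 𝓘(ℝ, E) ∞ (chartAt E p) x :=
    contMDiffAt_of_mem_maximalAtlas (IsManifold.chart_mem_maximalAtlas p) hx'
  exact (hχs x).mul ((hg.contMDiff _).comp x h1)

/-- Derivations at a point are tangent vectors. -/
theorem exists_tangent (p : M) (v : Fn E M →ₗ[ℝ] ℝ)
    (hv : ∀ f g, v (f * g) = v f * g p + f p * v g) :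
    ∃ w : TangentSpace 𝓘(ℝ, E) p, ∀ f : Fn E M, v f = mfderiv 𝓘(ℝ, E) 𝓘(ℝ, ℝ) f p w := by
  set φ := chartAt E p with hφ
  have hp : p ∈ φ.source := mem_chart_source E p
  let b := Module.finBasis ℝ E
  obtain ⟨r, hr, hball⟩ := Metric.nhds_basis_closedBall.mem_iff.1
    (φ.open_target.mem_nhds (φ.map_source hp))
  let ρ : ContDiffBump (φ p) := ⟨r / 2, r, by positivity, by linarith⟩
  -- The support of χ lies where ρ = 1 in the chart (its inner radius is r/2), so f = G ∘ φ on that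
  -- support.
  obtain ⟨χ, hχ1, hχ₀, hcut⟩ := exists_cutoff (E := E) p ((φ.continuousAt hp)
    (Metric.ball_mem_nhds (φ p) (show 0 < r / 2 by positivity)))
  have hχp : χ p = 1 := hχ1.self_of_nhds
  let y : Fin (Module.finrank ℝ E) → Fn E M := fun i =>
    ⟨_, hcut (fun z => b.coord i (z - φ p))
      ((LinearMap.toContinuousLinearMap (b.coord i)).contDiff.comp (contDiff_id.sub contDiff_const))⟩
  refine ⟨∑ i, v (y i) • b i, fun f => ?_⟩
  let G : E → ℝ := fun z => ρ z * f (φ.symm z)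
  have hG : ContDiff ℝ ∞ G := by
    rw [← contMDiff_iff_contDiff]
    refine contMDiff_of_tsupport fun z hz => ?_
    have hz' : z ∈ φ.target := by
      have h1 := closure_mono (Function.support_mul_subset_left (ρ : E → ℝ)
        (fun z => f (φ.symm z))) hz
      have h2 : closure (Function.support (ρ : E → ℝ)) = Metric.closedBall (φ p) r := ρ.tsupport_eq
      rw [h2] at h1
      exact hball h1
    have h1 : ContMDiffAt 𝓘(ℝ, E) 𝓘(ℝ, E) ∞ φ.symm z :=
      contMDiffAt_symm_of_mem_maximalAtlas (IsManifold.chart_mem_maximalAtlas p) hz'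
    exact (ρ.contDiff.contMDiff z).mul ((f.contMDiff _).comp z h1)
  have hGf : G =ᶠ[𝓝 (φ p)] f ∘ φ.symm := by
    filter_upwards [ρ.eventuallyEq_one] with z hz
    change ρ z * f (φ.symm z) = _
    rw [hz, Pi.one_apply, one_mul]
    rfl
  obtain ⟨g, hg, hGg, hgp⟩ := exists_hadamard hG b (φ p)
  let g' : Fin (Module.finrank ℝ E) → Fn E M := fun i => ⟨_, hcut (g i) (hg i)⟩
  -- Hadamard's expansion times χ². Under v, the terms f(p) v(χ²) cancel on both sides and, as
  -- y_i(p) = 0, what remains is v(f) = ∑ v(y_i) ∂_i G(φ p).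
  have key : χ * χ * f = f p • (χ * χ) + ∑ i, y i * g' i := by
    ext x
    have hsum : (f p • (χ * χ) + ∑ i, y i * g' i) x = f p * (χ x * χ x) +
        ∑ i, (χ x * b.coord i (φ x - φ p)) * (χ x * g i (φ x)) := by
      change f p * (χ x * χ x) + (∑ i, y i * g' i) x = _
      rw [fn_sum_apply]
      rfl
    rw [hsum]
    change χ x * χ x * f x = _
    by_cases hx : x ∈ tsupport χ
    · obtain ⟨hx1, hx2⟩ := hχ₀ hx
      have h1 : f x = G (φ x) := by
        change f x = ρ (φ x) * f (φ.symm (φ x))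
        rw [ρ.one_of_mem_closedBall (Metric.ball_subset_closedBall hx2), one_mul, φ.left_inv hx1]
      have h2 : f p = G (φ p) := by
        change f p = ρ (φ p) * f (φ.symm (φ p))
        rw [ρ.one_of_mem_closedBall (Metric.mem_closedBall_self ρ.rIn_pos.le), one_mul,
          φ.left_inv hp]
      rw [h1, h2, hGg (φ x), mul_add, mul_comm (G (φ p)), Finset.mul_sum]
      congr 1
      exact Finset.sum_congr rfl fun i _ => by ring
    · have : χ x = 0 := image_eq_zero_of_notMem_tsupport hx
      simp [this]
  have hvk := congrArg v key
  have hy0 : ∀ i, y i p = 0 := fun i => by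
    change χ p * b.coord i (φ p - φ p) = 0
    simp
  have hg'p : ∀ i, g' i p = fderiv ℝ G (φ p) (b i) := fun i => by
    change χ p * g i (φ p) = _
    rw [hχp, one_mul, hgp]
  rw [hv, map_add, map_smul, map_sum] at hvk
  simp only [hv (y _), hy0, zero_mul, add_zero, hg'p] at hvk
  have hχχ : (χ * χ) p = 1 := by
    change χ p * χ p = 1
    rw [hχp, one_mul]
  rw [hχχ, one_mul, smul_eq_mul, mul_comm, add_right_inj] at hvk
  rw [hvk, mfderiv_eq_fderiv f.contMDiff p hGf]
  have : fderiv ℝ G (φ p) (∑ i, v (y i) • b i) = ∑ i, v (y i) * fderiv ℝ G (φ p) (b i) := by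
    simp
  exact this.symm

end Tangent

end HomBundles

namespace HomBundles

/-! ### Anchors from actions on functions -/

noncomputable section Anchor

variable {E : Type*} [NormedAddCommGroup E] [NormedSpace ℝ E]
  {M : Type*} [TopologicalSpace M] [ChartedSpace E M]
  {F : Type*} [NormedAddCommGroup F] [NormedSpace ℝ F]
  {A : M → Type*} [TopologicalSpace (TotalSpace F A)]
  [∀ x, AddCommGroup (A x)] [∀ x, Module ℝ (A x)] [∀ x, TopologicalSpace (A x)]
  [FiberBundle F A] [VectorBundle ℝ F A]
  [IsManifold 𝓘(ℝ, E) ∞ M] [ContMDiffVectorBundle ∞ F A 𝓘(ℝ, E)]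
  [∀ x, IsTopologicalAddGroup (A x)] [∀ x, ContinuousSMul ℝ (A x)]
  [FiniteDimensional ℝ E] [T2Space M] [FiniteDimensional ℝ F]

theorem exists_fn_chart (p : M) {g : E → ℝ} (hg : ContDiff ℝ ∞ g) :
    ∃ f : Fn E M, f =ᶠ[𝓝 p] g ∘ chartAt E p := by
  obtain ⟨χ, hχ, -, hcut⟩ := exists_cutoff (E := E) p Filter.univ_mem
  refine ⟨⟨_, hcut g hg⟩, ?_⟩
  filter_upwards [hχ] with x hx
  change χ x * g (chartAt E p x) = _
  rw [hx, Pi.one_apply, one_mul]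
  rfl

theorem mfderiv_eq_trivialization {p x : M} (hx : x ∈ (chartAt E p).source) {f : Fn E M}
    {l : E →L[ℝ] ℝ} (hf : f =ᶠ[𝓝 x] l ∘ chartAt E p) (w : TangentSpace 𝓘(ℝ, E) x) :
    mfderiv 𝓘(ℝ, E) 𝓘(ℝ, ℝ) f x w =
      l ((trivializationAt E (TangentSpace 𝓘(ℝ, E)) p (TotalSpace.mk' E x w)).2) := by
  have h1 : MDifferentiableAt 𝓘(ℝ, E) 𝓘(ℝ, E) (extChartAt 𝓘(ℝ, E) p) x :=
    (contMDiffAt_extChartAt' (n := ∞) hx).mdifferentiableAt (by simp)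
  have h2 : (f : M → ℝ) =ᶠ[𝓝 x] l ∘ extChartAt 𝓘(ℝ, E) p := by
    refine hf.trans (Filter.Eventually.of_forall fun y => ?_)
    simp [mfld_simps]
  have h3 := mfderiv_comp x (l.mdifferentiableAt (x := extChartAt 𝓘(ℝ, E) p x)) h1
  rw [ContinuousLinearMap.mfderiv_eq, ← TangentBundle.continuousLinearMapAt_trivializationAt hx]
    at h3
  rw [h2.mfderiv_eq, h3]
  change l ((trivializationAt E (TangentSpace 𝓘(ℝ, E)) p).continuousLinearMapAt ℝ x w) = _
  rw [Bundle.Trivialization.continuousLinearMapAt_apply,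
    Bundle.Trivialization.linearMapAt_apply, if_pos]
  exact hx

/-- Every linear functional of the chart coordinates is, near p, a globally defined smooth function;
such functions separate tangent vectors. -/
theorem tangent_eq_zero {p : M} {w : TangentSpace 𝓘(ℝ, E) p}
    (h : ∀ f : Fn E M, mfderiv 𝓘(ℝ, E) 𝓘(ℝ, ℝ) f p w = 0) : w = 0 := by
  have hp := mem_chart_source E p
  have key : ∀ l : E →L[ℝ] ℝ, l w = 0 := by
    intro l
    obtain ⟨f, hf⟩ := exists_fn_chart p l.contDiff
    have h2 := mfderiv_eq_fderiv f.contMDiff p (G := l) ?_ w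
    · rw [h f, l.fderiv] at h2
      exact h2.symm
    · have h1 := ((chartAt E p).tendsto_symm hp).eventually hf
      filter_upwards [h1, (chartAt E p).open_target.mem_nhds ((chartAt E p).map_source hp)]
        with y hy hy'
      rw [Function.comp_apply, hy, Function.comp_apply, (chartAt E p).right_inv hy']
  let b := Module.finBasis ℝ E
  refine b.ext_elem (x := (w : E)) (y := (0 : E)) fun i => ?_
  rw [map_zero]
  exact key (LinearMap.toContinuousLinearMap (b.coord i))

/-- The tangent vector field of a derivation which depends smoothly. -/
theorem contMDiff_of_mfderiv (W : ∀ x : M, TangentSpace 𝓘(ℝ, E) x)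
    (hW : ∀ f : Fn E M, ContMDiff 𝓘(ℝ, E) 𝓘(ℝ, ℝ) ∞
      (fun x => mfderiv 𝓘(ℝ, E) 𝓘(ℝ, ℝ) f x (W x))) :
    ContMDiff 𝓘(ℝ, E) (𝓘(ℝ, E).prod 𝓘(ℝ, E)) ∞
      (fun x => TotalSpace.mk' E (E := TangentSpace 𝓘(ℝ, E)) x (W x)) := by
  intro p
  rw [contMDiffAt_section]
  let b := Module.finBasis ℝ E
  -- Global functions that agree near p with the coordinates: their derivatives along W are its
  -- components in the tangent trivialization.
  choose y hy using fun i => exists_fn_chart p (LinearMap.toContinuousLinearMap (b.coord i)).contDiff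
  let d : Fin (Module.finrank ℝ E) → M → ℝ := fun i x => mfderiv 𝓘(ℝ, E) 𝓘(ℝ, ℝ) (y i) x (W x)
  have hsum : ContMDiffAt 𝓘(ℝ, E) 𝓘(ℝ, E) ∞ (fun x => ∑ i, d i x • b i) p :=
    contMDiffAt_finsetSum fun i _ => (hW (y i) p).smul contMDiffAt_const
  refine hsum.congr_of_eventuallyEq ?_
  filter_upwards [(chartAt E p).open_source.mem_nhds (mem_chart_source E p),
    Filter.eventually_all.2 fun i => (hy i).eventuallyEq_nhds] with x hx hyx
  have : ∀ i, d i x = b.repr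
      ((trivializationAt E (TangentSpace 𝓘(ℝ, E)) p (TotalSpace.mk' E x (W x))).2) i := fun i =>
    mfderiv_eq_trivialization hx (hyx i) _
  simp only [this]
  exact (b.sum_repr _).symm

/-- The anchor of an action of sections on functions. -/
theorem exists_anchor (D : Sec E F A →ₗ[ℝ] Fn E M →ₗ[ℝ] Fn E M)
    (hmul : ∀ X f g, D X (f * g) = D X f * g + f * D X g)
    (hsmul : ∀ (f : Fn E M) X g, D (f • X) g = f * D X g) :
    ∃ ρ : ∀ x, A x →L[ℝ] TangentSpace 𝓘(ℝ, E) x,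
      (ContMDiff 𝓘(ℝ, E) (𝓘(ℝ, E).prod 𝓘(ℝ, F →L[ℝ] E)) ∞ (fun x => TotalSpace.mk' (F →L[ℝ] E)
        (E := fun y : M => A y →L[ℝ] TangentSpace 𝓘(ℝ, E) y) x (ρ x))) ∧
      ∀ X (f : Fn E M) x, mfderiv 𝓘(ℝ, E) 𝓘(ℝ, ℝ) f x (ρ x (X x)) = D X f x := by
  have hfin : ∀ x, FiniteDimensional ℝ (A x) := fun x =>
    VectorBundle.finiteDimensional ℝ F A x
  have hT2 : ∀ x, T2Space (A x) := FiberBundle.t2Space F A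
  -- Evaluating D X at x gives a derivation at x, hence a tangent vector. Linearity over functions
  -- in X then lets it depend on X(x) alone.
  have hW : ∀ (x : M) (X : Sec E F A), ∃ w : TangentSpace 𝓘(ℝ, E) x, ∀ f : Fn E M,
      D X f x = mfderiv 𝓘(ℝ, E) 𝓘(ℝ, ℝ) f x w := by
    intro x X
    refine exists_tangent x ((LinearMap.mk ⟨fun f : Fn E M => f x, fun _ _ => rfl⟩
      fun _ _ => rfl : Fn E M →ₗ[ℝ] ℝ) ∘ₗ D X) fun f g => ?_
    exact congrArg (fun k : Fn E M => k x) (hmul X f g)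
  choose W hW using hW
  have hext : ∀ {x : M} {w w' : TangentSpace 𝓘(ℝ, E) x}, (∀ f : Fn E M,
      mfderiv 𝓘(ℝ, E) 𝓘(ℝ, ℝ) f x w = mfderiv 𝓘(ℝ, E) 𝓘(ℝ, ℝ) f x w') → w = w' := by
    intro x w w' h
    refine sub_eq_zero.1 (tangent_eq_zero fun f => ?_)
    rw [map_sub, h, sub_self]
  have hG : ∀ x : M, ∃ G : A x →ₗ[ℝ] TangentSpace 𝓘(ℝ, E) x, ∀ X, G (X x) = W x X := by
    intro x
    let Φ : Sec E F A →ₗ[ℝ] TangentSpace 𝓘(ℝ, E) x :=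
      { toFun := W x
        map_add' := fun X Y => hext fun f => by
          rw [map_add, ← hW, ← hW, ← hW, map_add]
          rfl
        map_smul' := fun r X => hext fun f => by
          rw [RingHom.id_apply, map_smul, ← hW, ← hW, map_smul]
          rfl }
    refine exists_fiberMap (Φ := Φ) fun g X => hext fun f => ?_
    refine Eq.trans ?_ (map_smul (mfderiv 𝓘(ℝ, E) 𝓘(ℝ, ℝ) f x) (g x) (W x X)).symm
    change mfderiv 𝓘(ℝ, E) 𝓘(ℝ, ℝ) f x (W x (g • X)) = g x • mfderiv 𝓘(ℝ, E) 𝓘(ℝ, ℝ) f x (W x X)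
    rw [← hW, ← hW, hsmul]
    rfl
  choose G hG using hG
  have hval : ∀ X (f : Fn E M) x, mfderiv 𝓘(ℝ, E) 𝓘(ℝ, ℝ) f x (G x (X x)) = D X f x :=
    fun X f x => by rw [hG, ← hW]
  refine ⟨fun x => LinearMap.toContinuousLinearMap (G x),
    contMDiff_hom_of_apply (V := TangentSpace 𝓘(ℝ, E)) contMDiff_id _ fun X => ?_, hval⟩
  exact contMDiff_of_mfderiv _ fun f => (D X f).contMDiff.congr fun x => hval X f x

/-- The function ρ(X)[f] is the fibre component of the tangent map of f along the smooth map x ↦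
ρ_x(X_{ψ x}). -/
theorem contMDiff_anchorDeriv {ψ : M → M} (hψ : ContMDiff 𝓘(ℝ, E) 𝓘(ℝ, E) ∞ ψ)
    {ρ : ∀ x, A (ψ x) →L[ℝ] TangentSpace 𝓘(ℝ, E) (ψ x)}
    (hρ : ContMDiff 𝓘(ℝ, E) (𝓘(ℝ, E).prod 𝓘(ℝ, F →L[ℝ] E)) ∞
      (fun x => TotalSpace.mk' (F →L[ℝ] E)
        (E := fun y : M => A y →L[ℝ] TangentSpace 𝓘(ℝ, E) y) (ψ x) (ρ x)))
    (X : Sec E F A) (f : Fn E M) : ContMDiff 𝓘(ℝ, E) 𝓘(ℝ, ℝ) ∞ (anchorDeriv ρ X f) := by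
  have h1 : ContMDiff 𝓘(ℝ, E) (𝓘(ℝ, E).prod 𝓘(ℝ, E)) ∞
      (fun x => TotalSpace.mk' E (E := TangentSpace 𝓘(ℝ, E)) (ψ x) (ρ x (X (ψ x)))) :=
    ContMDiff.clm_bundle_apply hρ (X.contMDiff.comp hψ)
  have h2 : ContMDiff 𝓘(ℝ, E).tangent 𝓘(ℝ, ℝ).tangent ∞ (tangentMap 𝓘(ℝ, E) 𝓘(ℝ, ℝ) f) :=
    f.contMDiff.contMDiff_tangentMap (by simp)
  exact (contMDiff_snd_tangentBundle_modelSpace ℝ 𝓘(ℝ, ℝ)).comp (h2.comp h1)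

end Anchor

end HomBundles

namespace HomBundles

/-! ### Hom-Lie algebroids as invariant Lie-Rinehart structures -/

noncomputable section Algebroid

variable {E : Type*} [NormedAddCommGroup E] [NormedSpace ℝ E]
  {M : Type*} [TopologicalSpace M] [ChartedSpace E M]
  {F : Type*} [NormedAddCommGroup F] [NormedSpace ℝ F]
  {A : M → Type*} [TopologicalSpace (TotalSpace F A)]
  [∀ x, AddCommGroup (A x)] [∀ x, Module ℝ (A x)] [∀ x, TopologicalSpace (A x)]
  [FiberBundle F A] [VectorBundle ℝ F A]
  [IsManifold 𝓘(ℝ, E) ∞ M] [ContMDiffVectorBundle ∞ F A 𝓘(ℝ, E)]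
  [∀ x, IsTopologicalAddGroup (A x)] [∀ x, ContinuousSMul ℝ (A x)]
  [FiniteDimensional ℝ E] [T2Space M] [FiniteDimensional ℝ F]
  {B : InvertibleHomBundle E F A}

namespace InvertibleHomBundle

variable (B)

theorem pull_injective : Function.Injective (B.pull : Fn E M → Fn E M) :=
  Function.LeftInverse.injective B.symm_pull_pull

theorem pull_mul (f g : Fn E M) : B.pull (f * g) = B.pull f * B.pull g := rfl

theorem pull_add (f g : Fn E M) : B.pull (f + g) = B.pull f + B.pull g := rfl

theorem pull_sub (f g : Fn E M) : B.pull (f - g) = B.pull f - B.pull g := rfl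

theorem pull_smul (r : ℝ) (f : Fn E M) : B.pull (r • f) = r • B.pull f := rfl

end InvertibleHomBundle

namespace HomLieAlgebroid

variable (L : HomLieAlgebroid B)

/-- The function `ρ(X)[f]`. -/
def anchorFn : Sec E F A →ₗ[ℝ] Fn E M →ₗ[ℝ] Fn E M :=
  LinearMap.mk₂ ℝ
    (fun X f => ⟨anchorDeriv L.anchor X f, contMDiff_anchorDeriv B.ψ.contMDiff L.anchor_smooth X f⟩)
    (fun X Y f => by
      ext x
      change mfderiv 𝓘(ℝ, E) 𝓘(ℝ, ℝ) f (B.ψ x) (L.anchor x (X (B.ψ x) + Y (B.ψ x))) = _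
      rw [map_add, map_add]
      rfl)
    (fun r X f => by
      ext x
      change mfderiv 𝓘(ℝ, E) 𝓘(ℝ, ℝ) f (B.ψ x) (L.anchor x (r • X (B.ψ x))) = _
      rw [map_smul, map_smul]
      rfl)
    (fun X f g => by
      ext x
      exact congrArg (fun T => T (L.anchor x (X (B.ψ x))))
        (mfderiv_add ((f.contMDiff (B.ψ x)).mdifferentiableAt (by simp))
          ((g.contMDiff (B.ψ x)).mdifferentiableAt (by simp))))
    (fun r X f => by
      ext x
      exact congrArg (fun T => T (L.anchor x (X (B.ψ x))))
        (const_smul_mfderiv ((f.contMDiff (B.ψ x)).mdifferentiableAt (by simp)) r))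

theorem coe_anchorFn (X : Sec E F A) (f : Fn E M) :
    ⇑(L.anchorFn X f) = anchorDeriv L.anchor X f := rfl

theorem anchorFn_mul (X : Sec E F A) (f g : Fn E M) :
    L.anchorFn X (f * g) = L.anchorFn X f * B.pull g + B.pull f * L.anchorFn X g := by
  ext x
  refine (congrArg (fun T => T (L.anchor x (X (B.ψ x))))
    (HasMFDerivAt.mul ((f.contMDiff (B.ψ x)).mdifferentiableAt (by simp)).hasMFDerivAt
      ((g.contMDiff (B.ψ x)).mdifferentiableAt (by simp)).hasMFDerivAt).mfderiv).trans ?_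
  change f (B.ψ x) * (L.anchorFn X g x) + g (B.ψ x) * (L.anchorFn X f x) =
    L.anchorFn X f x * g (B.ψ x) + f (B.ψ x) * L.anchorFn X g x
  ring

theorem anchorFn_smul (f : Fn E M) (X : Sec E F A) (g : Fn E M) :
    L.anchorFn (f • X) g = B.pull f * L.anchorFn X g := by
  ext x
  change mfderiv 𝓘(ℝ, E) 𝓘(ℝ, ℝ) g (B.ψ x) (L.anchor x (f (B.ψ x) • X (B.ψ x))) = _
  rw [map_smul, map_smul]
  rfl

theorem anchorFn_map (X : Sec E F A) (f : Fn E M) :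
    L.anchorFn (B.β X) (B.pull f) = B.pull (L.anchorFn X f) := by
  ext x
  exact congrFun (L.anchor_map X f) x

theorem anchorFn_bracket (X Y : Sec E F A) (f : Fn E M) :
    L.anchorFn (L.bracket X Y) (B.pull f) =
      L.anchorFn (B.β X) (L.anchorFn Y f) - L.anchorFn (B.β Y) (L.anchorFn X f) := by
  ext x
  exact congrFun (L.anchor_bracket X Y f) x

theorem bracket_smul (X : Sec E F A) (f : Fn E M) (Y : Sec E F A) :
    L.bracket X (f • Y) = B.pull f • L.bracket X Y + L.anchorFn X f • B.β Y := by
  ext x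
  exact L.leibniz X f Y x

/-- The Lie-Rinehart structure of a hom-Lie algebroid. -/
def lieRinehart : LieRinehart (Fn E M) (Sec E F A) where
  br := L.bracket.compr₂ B.β.symm.toLinearMap
  D := L.anchorFn.compr₂ ⟨⟨B.symm.pull, B.symm.pull_add⟩, B.symm.pull_smul⟩
  skew X Y := by
    simp only [LinearMap.compr₂_apply, LinearEquiv.coe_coe]
    rw [L.bracket_skew, map_neg]
  jacobi X Y Z := by
    -- Applying β² turns β⁻¹[X, β⁻¹[Y, Z]] into [βX, [Y, Z]], the term of the hom-Jacobi identity.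
    refine B.β.injective (B.β.injective ?_)
    simp only [LinearMap.compr₂_apply, LinearEquiv.coe_coe, map_add, LinearEquiv.apply_symm_apply,
      L.map_bracket, map_zero]
    exact L.jacobi X Y Z
  leibniz X f Y := by
    refine B.β.injective ?_
    simp only [LinearMap.compr₂_apply, LinearEquiv.coe_coe, map_add, LinearEquiv.apply_symm_apply,
      B.β_smul, L.bracket_smul]
    exact congrArg (fun g => B.pull f • L.bracket X Y + g • B.β Y) (B.pull_symm_pull _).symm
  D_mul X f g := by
    simp only [LinearMap.compr₂_apply, LinearMap.coe_mk, AddHom.coe_mk, L.anchorFn_mul,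
      B.symm.pull_add, B.symm.pull_mul, B.symm_pull_pull]
  D_smul f X g := by
    simp only [LinearMap.compr₂_apply, LinearMap.coe_mk, AddHom.coe_mk, L.anchorFn_smul,
      B.symm.pull_mul, B.symm_pull_pull]
  D_br X Y f := by
    refine B.pull_injective (B.pull_injective ?_)
    simp only [LinearMap.compr₂_apply, LinearMap.coe_mk, AddHom.coe_mk, B.pull_symm_pull,
      B.pull_sub, LinearEquiv.coe_coe, ← L.anchorFn_map, LinearEquiv.apply_symm_apply,
      L.anchorFn_bracket]

theorem β_lieRinehart_br (X Y : Sec E F A) : B.β (L.lieRinehart.br X Y) = L.bracket X Y :=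
  B.β.apply_symm_apply _

theorem pull_lieRinehart_D (X : Sec E F A) (f : Fn E M) :
    B.pull (L.lieRinehart.D X f) = L.anchorFn X f := B.pull_symm_pull _

theorem lieRinehart_isInvariant : L.lieRinehart.IsInvariant B.pull B.β where
  br X Y := B.β.injective (by
    rw [L.β_lieRinehart_br, L.β_lieRinehart_br, L.map_bracket])
  D X f := B.pull_injective (by
    rw [L.pull_lieRinehart_D, L.pull_lieRinehart_D, L.anchorFn_map])

/-- The anchor is determined by the functions ρ(X)[f]: sections attain every fibre vector, and
functions separate tangent vectors. -/
theorem lieRinehart_injective :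
    Function.Injective (lieRinehart : HomLieAlgebroid B → LieRinehart (Fn E M) (Sec E F A)) := by
  intro L L' h
  have hbr : L.bracket = L'.bracket := by
    ext1 X
    ext1 Y
    rw [← L.β_lieRinehart_br, ← L'.β_lieRinehart_br, h]
  have hD : ∀ X f, L.anchorFn X f = L'.anchorFn X f := fun X f => by
    rw [← L.pull_lieRinehart_D, ← L'.pull_lieRinehart_D, h]
  refine HomLieAlgebroid.ext hbr (funext fun x => ContinuousLinearMap.ext fun v => ?_)
  obtain ⟨X, rfl⟩ := exists_section (E := E) (F := F) (B.ψ x) v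
  refine sub_eq_zero.1 (tangent_eq_zero fun f => ?_)
  rw [map_sub, sub_eq_zero]
  exact congrArg (fun g : Fn E M => g x) (hD X f)

/-- The action on functions comes from a bundle map A → TM, whose pull-back along ψ is the anchor.
The hom-axioms follow from the ordinary ones on composing with β or ψ*, by invariance. -/
theorem exists_of_lieRinehart (ℓ : LieRinehart (Fn E M) (Sec E F A))
    (hℓ : ℓ.IsInvariant B.pull B.β) : ∃ L : HomLieAlgebroid B, L.lieRinehart = ℓ := by
  obtain ⟨ρ, hρ, hD⟩ := exists_anchor ℓ.D ℓ.D_mul ℓ.D_smul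
  have ha : ∀ X (f : Fn E M), anchorDeriv (ψ := B.ψ) (fun x => ρ (B.ψ x)) X f =
      B.pull (ℓ.D X f) := fun X f => funext fun x => hD X f (B.ψ x)
  have hpull : ∀ f : Fn E M, f ∘ B.ψ = B.pull f := fun f => rfl
  let L : HomLieAlgebroid B :=
    { bracket := ℓ.br.compr₂ B.β.toLinearMap
      anchor := fun x => ρ (B.ψ x)
      anchor_smooth := hρ.comp B.ψ.contMDiff
      bracket_skew := fun X Y => by
        simp only [LinearMap.compr₂_apply, LinearEquiv.coe_coe]
        rw [ℓ.skew, map_neg]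
      map_bracket := fun X Y => by
        simp only [LinearMap.compr₂_apply, LinearEquiv.coe_coe, hℓ.br]
      jacobi := fun X Y Z => by
        simp only [LinearMap.compr₂_apply, LinearEquiv.coe_coe, hℓ.br, ← map_add, ℓ.jacobi,
          map_zero]
      leibniz := fun X f Y x => by
        rw [ha]
        simp only [LinearMap.compr₂_apply, LinearEquiv.coe_coe, fsmul_eq_smul, ℓ.leibniz, map_add,
          B.β_smul]
        rfl
      anchor_map := fun X f => by
        rw [hpull, ha, ha, hpull, hℓ.D]
      anchor_bracket := fun X Y f => by
        rw [hpull, ha, ha, ha, ha, ha]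
        simp only [LinearMap.compr₂_apply, LinearEquiv.coe_coe, hℓ.D, ℓ.D_br, B.pull_sub]
        rfl }
  refine ⟨L, LieRinehart.ext ?_ ?_⟩
  · ext1 X
    ext1 Y
    exact B.β.symm_apply_apply _
  · ext1 X
    ext1 f
    refine B.pull_injective ?_
    rw [L.pull_lieRinehart_D]
    ext x
    exact congrFun (ha X f) x

end HomLieAlgebroid

end Algebroid

end HomBundles

namespace HomBundles

/-! ### Evaluation on covectors and the coboundary operator -/

section LinearAlgebra

variable {V : Type*} [AddCommGroup V] [Module ℝ V]

theorem contractMultivector_ιMulti (φ : Module.Dual ℝ V) : ∀ (n : ℕ) (v : Fin (n + 1) → V),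
    contractMultivector φ (ExteriorAlgebra.ιMulti ℝ (n + 1) v) =
      ∑ i : Fin (n + 1), ((-1 : ℝ) ^ (i : ℕ) * φ (v i)) •
        ExteriorAlgebra.ιMulti ℝ n (i.removeNth v)
  | 0, v => by
    have h := contractMultivector_algebraMap φ 1
    rw [map_one] at h
    rw [ExteriorAlgebra.ιMulti_succ_apply, contractMultivector_ι_mul,
      ExteriorAlgebra.ιMulti_zero_apply, h]
    simp
  | n + 1, v => by
    rw [ExteriorAlgebra.ιMulti_succ_apply, contractMultivector_ι_mul,
      contractMultivector_ιMulti φ n, Fin.sum_univ_succ (n := n + 1), Finset.mul_sum,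
      sub_eq_add_neg, ← Finset.sum_neg_distrib]
    congr 1
    · simp only [Fin.val_zero, pow_zero, one_mul, Fin.removeNth_zero]
      rfl
    · refine Finset.sum_congr rfl fun i _ => ?_
      have h1 : Matrix.vecTail (i.succ.removeNth v) = i.removeNth (Matrix.vecTail v) := by
        ext j
        simp [Matrix.vecTail, Fin.removeNth]
      rw [ExteriorAlgebra.ιMulti_succ_apply (i.succ.removeNth v), h1, mul_smul_comm, Fin.val_succ,
        pow_succ, mul_neg_one, neg_mul, neg_smul]
      rfl

theorem evalMultivector_ιMulti {k : ℕ} (ξ : Fin k → Module.Dual ℝ V) (v : Fin k → V) :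
    evalMultivector ξ (ExteriorAlgebra.ιMulti ℝ k v) =
      Matrix.det (.of fun i j => ξ j (v i)) := by
  rw [evalMultivector, ExteriorAlgebra.liftAlternating_apply_ιMulti, Pi.single_eq_same]
  exact exteriorPower.alternatingMapToDual_apply_ιMulti ξ v

theorem evalMultivector_ιMulti_of_ne {k n : ℕ} (h : n ≠ k) (ξ : Fin k → Module.Dual ℝ V)
    (v : Fin n → V) : evalMultivector ξ (ExteriorAlgebra.ιMulti ℝ n v) = 0 := by
  rw [evalMultivector, ExteriorAlgebra.liftAlternating_apply_ιMulti, Pi.single_eq_of_ne h]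
  rfl

theorem evalMultivector_algebraMap (ξ : Fin 0 → Module.Dual ℝ V) (r : ℝ) :
    evalMultivector ξ (algebraMap ℝ _ r) = r := by
  have h := evalMultivector_ιMulti ξ Fin.elim0
  rw [ExteriorAlgebra.ιMulti_zero_apply, Matrix.det_fin_zero] at h
  rw [Algebra.algebraMap_eq_smul_one, map_smul, h, smul_eq_mul, mul_one]

/-- Contraction with the first covector is the Laplace expansion of the determinant along its first
column. It links evaluation to iterated contraction. -/
theorem evalMultivector_succ {k : ℕ} (ξ : Fin (k + 1) → Module.Dual ℝ V)
    (w : ExteriorAlgebra ℝ V) :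
    evalMultivector ξ w = evalMultivector (Fin.tail ξ) (contractMultivector (ξ 0) w) := by
  suffices evalMultivector ξ = evalMultivector (Fin.tail ξ) ∘ₗ contractMultivector (ξ 0) from
    LinearMap.congr_fun this w
  refine ExteriorAlgebra.lhom_ext fun n => ?_
  ext v
  change evalMultivector ξ (ExteriorAlgebra.ιMulti ℝ n v) =
    evalMultivector (Fin.tail ξ) (contractMultivector (ξ 0) (ExteriorAlgebra.ιMulti ℝ n v))
  rcases n with _ | n
  · have h := contractMultivector_algebraMap (ξ 0) 1
    rw [map_one] at h
    rw [evalMultivector_ιMulti_of_ne (by omega), ExteriorAlgebra.ιMulti_zero_apply, h, map_zero]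
  · rw [contractMultivector_ιMulti, map_sum]
    by_cases hn : n = k
    · subst hn
      rw [evalMultivector_ιMulti, Matrix.det_succ_column_zero]
      refine Finset.sum_congr rfl fun i _ => ?_
      rw [map_smul, evalMultivector_ιMulti]
      rfl
    · rw [evalMultivector_ιMulti_of_ne (by omega)]
      refine (Finset.sum_eq_zero fun i _ => ?_).symm
      rw [map_smul, evalMultivector_ιMulti_of_ne hn, smul_zero]

end LinearAlgebra

noncomputable section Coboundary

variable {E : Type*} [NormedAddCommGroup E] [NormedSpace ℝ E]
  {M : Type*} [TopologicalSpace M] [ChartedSpace E M]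
  {F : Type*} [NormedAddCommGroup F] [NormedSpace ℝ F]
  {A : M → Type*} [TopologicalSpace (TotalSpace F A)]
  [∀ x, AddCommGroup (A x)] [∀ x, Module ℝ (A x)] [∀ x, TopologicalSpace (A x)]
  [FiberBundle F A] [VectorBundle ℝ F A] [FiniteDimensional ℝ F]
  [IsManifold 𝓘(ℝ, E) ∞ M] [ContMDiffVectorBundle ∞ F A 𝓘(ℝ, E)]
  [∀ x, IsTopologicalAddGroup (A x)] [∀ x, ContinuousSMul ℝ (A x)]
  [FiniteDimensional ℝ E] [T2Space M]

open Multisection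

/-- The value of the component of degree `0`. -/
def valueAt (x : M) : Multisection E F A →ₗ[ℝ] ℝ :=
  evalMultivector Fin.elim0 ∘ₗ (eval x).toLinearMap

theorem valueAt_ofFunHom (x : M) (f : Fn E M) :
    valueAt x (ofFunHom f : Multisection E F A) = f x :=
  evalMultivector_algebraMap _ _

theorem valueAt_contr (x : M) {k : ℕ} (ξ : Fin k → DualSec E F A) (s : Multisection E F A) :
    valueAt x ((calculus E F A).contr k ξ s) = evalSections s ξ x := by
  induction k generalizing s with
  | zero => exact congrArg (fun η => evalMultivector η (s.1 x)) (Subsingleton.elim _ _)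
  | succ k ih =>
    rw [ExteriorCalculus.contr_succ, ih]
    exact (evalMultivector_succ (fun i => (ξ i x : A x →ₗ[ℝ] ℝ)) (s.1 x)).symm

theorem contr_mem {k : ℕ} (ξ : Fin k → DualSec E F A) {s : Multisection E F A}
    (hs : s ∈ degree E F A k) : (calculus E F A).contr k ξ s ∈ degree E F A 0 := by
  induction k generalizing s with
  | zero => exact hs
  | succ k ih =>
    rw [ExteriorCalculus.contr_succ]
    exact ih _ (contract_mem _ hs)

theorem contr_eq_zero {k : ℕ} (ξ : Fin (k + 1) → DualSec E F A) {s : Multisection E F A}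
    (hs : s ∈ degree E F A k) : (calculus E F A).contr (k + 1) ξ s = 0 := by
  induction k generalizing s with
  | zero => exact contract_eq_zero _ hs
  | succ k ih =>
    rw [ExteriorCalculus.contr_succ]
    exact ih _ (contract_mem _ hs)

theorem exists_contr_eq {k : ℕ} (ξ : Fin k → DualSec E F A) {s : Multisection E F A}
    (hs : s ∈ degree E F A k) :
    ∃ f : Fn E M, (calculus E F A).contr k ξ s = ofFunHom f ∧ evalSections s ξ = f := by
  obtain ⟨f, hf⟩ := mem_degree_zero.1 (contr_mem ξ hs)
  refine ⟨f, hf.symm, funext fun x => ?_⟩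
  rw [← valueAt_contr, ← hf, valueAt_ofFunHom]

theorem ext_of_evalSections {k : ℕ} {s t : Multisection E F A} (hs : s ∈ degree E F A k)
    (ht : t ∈ degree E F A k)
    (h : ∀ ξ : Fin k → DualSec E F A, evalSections s ξ = evalSections t ξ) : s = t := by
  have h' : ∀ ξ : Fin k → DualSec E F A,
      (calculus E F A).contr k ξ s = (calculus E F A).contr k ξ t := fun ξ => by
    obtain ⟨f, hf, hf'⟩ := exists_contr_eq ξ hs
    obtain ⟨g, hg, hg'⟩ := exists_contr_eq ξ ht
    rw [hf, hg, DFunLike.coe_injective (hf'.symm.trans ((h ξ).trans hg'))]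
  clear h
  induction k generalizing s t with
  | zero => exact h' Fin.elim0
  | succ k ih =>
    refine (calculus E F A).ext_of_I hs ht fun ξ => ?_
    refine ih (contract_mem ξ hs) (contract_mem ξ ht) fun η => ?_
    have := h' (Fin.cons ξ η)
    rwa [ExteriorCalculus.contr_cons, ExteriorCalculus.contr_cons] at this

namespace HomLieAlgebroid

variable {B : InvertibleHomBundle E F A} (L : HomLieAlgebroid B.dual)

/-- A homogeneous multisection is determined by its values on sections of the dual, so the formula
leaves no choice. -/
theorem IsCoboundary.unique {L : HomLieAlgebroid B.dual}
    {d d' : Multisection E F A →ₗ[ℝ] Multisection E F A} (h : L.IsCoboundary d)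
    (h' : L.IsCoboundary d') : d = d' := by
  refine isGradedCommutativeAlgebra.linearMap_ext fun k s hs => ?_
  refine ext_of_evalSections (h.map_mem k s hs) (h'.map_mem k s hs) fun ξ => ?_
  rcases k with _ | k
  · rw [h.eval_zero s hs, h'.eval_zero s hs]
  · ext x
    rw [h.eval_succ k s hs ξ _ (fun _ => rfl), h'.eval_succ k s hs ξ _ fun _ => rfl]

/-- This is the Chevalley-Eilenberg formula for the untwisted d, followed by α. With ξ_i = β† η_i,
evaluating α(ds) on the ξ_i gives ψ* of ds on the η_i. Moreover ψ* composed with the action is the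
anchor, and β†⁻²[ξ_i, ξ_j] = β†⁻¹[η_i, η_j] is the untwisted bracket. -/
theorem isCoboundary {d : Multisection E F A →ₗ[ℝ] Multisection E F A}
    (h : (calculus E F A).IsDifferential L.lieRinehart d) :
    L.IsCoboundary (B.ext.toLinearMap ∘ₗ d) where
  map_mem k s hs := B.automorphism.mem _ _ (h.der.mem k (k + 1) (by omega) s hs)
  eval_zero s hs ξ := by
    obtain ⟨f, rfl⟩ := mem_degree_zero.1 hs
    obtain ⟨η, hη⟩ : ∃ η, ξ 0 = B.dual.β η := ⟨_, (B.dual.β.apply_symm_apply (ξ 0)).symm⟩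
    have hf : evalSections (ofFunHom f : Multisection E F A) Fin.elim0 = f := funext fun x =>
      valueAt_ofFunHom (E := E) (F := F) (A := A) x f
    rw [hf, hη, LinearEquiv.symm_apply_apply, ← L.coe_anchorFn, ← L.pull_lieRinehart_D]
    ext x
    refine (valueAt_contr x ξ _).symm.trans
      (Eq.trans (congrArg (valueAt x) ?_) (valueAt_ofFunHom (F := F) (A := A) x _))
    have h1 := B.automorphism.I_map η (d (ofFunHom f))
    have h2 := h.I_d_j η f
    change (calculus E F A).I (ξ 0) (B.ext (d (ofFunHom f))) = _
    rw [hη]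
    refine h1.trans ((congrArg B.ext h2).trans ?_)
    exact B.ext_ofFunHom _
  eval_succ k s hs ξ η hη x := by
    have hξ : ξ = fun i => B.dual.β (η i) := funext fun i => by
      rw [hη, LinearEquiv.apply_symm_apply]
    have h1 := B.automorphism.contr_map (k + 2) η (d s)
    have h2 := (calculus E F A).contr_d h.der h.I_d_j h.I_I_d_ι k η s
    -- As s has degree k + 1, its k + 2 contractions vanish, which removes the extra summand of
    -- `contr_d`.
    rw [contr_eq_zero η hs, map_zero, smul_zero, add_zero] at h2
    have hval : ∀ t : Multisection E F A, t ∈ degree E F A 0 →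
        valueAt x (B.ext t) = valueAt (B.ψ x) t := fun t ht => by
      obtain ⟨f, rfl⟩ := mem_degree_zero.1 ht
      rw [B.ext_ofFunHom, valueAt_ofFunHom, valueAt_ofFunHom, B.pull_apply]
    have h3 : evalSections ((B.ext.toLinearMap ∘ₗ d) s) ξ x =
        valueAt (B.ψ x) ((calculus E F A).contr (k + 2) η (d s)) := by
      rw [← valueAt_contr, hξ, ← hval _ (contr_mem η (h.der.mem (k + 1) (k + 2) (by omega) s hs))]
      exact congrArg (valueAt x) h1
    rw [h3, h2, map_add, map_sum, map_sum]
    congr 1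
    · refine Finset.sum_congr rfl fun i _ => ?_
      obtain ⟨f, hf, hf'⟩ := exists_contr_eq (i.removeNth η) hs
      rw [map_smul, hf, hf', smul_eq_mul, ← L.coe_anchorFn, ← L.pull_lieRinehart_D]
      congr 1
      have := ExteriorCalculus.lieDer_j (S := calculus E F A)
        (D := fun ξ f => L.lieRinehart.D ξ f) h.I_d_j (η i) f
      exact (congrArg (valueAt (B.ψ x)) this).trans (valueAt_ofFunHom _ _)
    · refine Finset.sum_congr rfl fun j _ => ?_
      rw [map_sum]
      refine Finset.sum_congr rfl fun i _ => ?_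
      split_ifs
      · rw [map_smul, valueAt_contr, smul_eq_mul, hξ]
        simp only
        rw [← L.map_bracket, LinearEquiv.symm_apply_apply]
        rfl
      · exact map_zero _

/-- The choice operator yields a solution because one exists, and uniqueness identifies it. -/
theorem IsCoboundary.coboundary_eq {L : HomLieAlgebroid B.dual}
    {d : Multisection E F A →ₗ[ℝ] Multisection E F A} (h : L.IsCoboundary d) :
    L.coboundary = d :=
  IsCoboundary.unique (Classical.epsilon_spec ⟨d, h⟩) h

end HomLieAlgebroid

end Coboundary

end HomBundles

namespace HomBundles

/-! ### Induced brackets and differentials as twists -/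

section Abstract

variable {C Γ Γ' B : Type*} [CommRing C] [Algebra ℝ C]
  [AddCommGroup Γ] [Module ℝ Γ] [Module C Γ] [AddCommGroup Γ'] [Module ℝ Γ'] [Module C Γ']
  [Ring B] [Algebra ℝ B]

namespace ExteriorCalculus

variable {S : ExteriorCalculus C Γ Γ' B}

theorem IsSchouten.lieRinehart_unique {ℓ ℓ' : LieRinehart C Γ} {br : B →ₗ[ℝ] B →ₗ[ℝ] B}
    (h : S.IsSchouten ℓ br) (h' : S.IsSchouten ℓ' br) : ℓ = ℓ' := by
  refine LieRinehart.ext (LinearMap.ext₂ fun X Y => S.ι_injective ?_)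
    (LinearMap.ext₂ fun X f => S.j_injective ?_)
  · rw [← h.ι_ι, h'.ι_ι]
  · rw [← h.ι_j, h'.ι_j]

theorem IsDifferential.lieRinehart_unique {ℓ ℓ' : LieRinehart C Γ'} {d : B →ₗ[ℝ] B}
    (h : S.IsDifferential ℓ d) (h' : S.IsDifferential ℓ' d) : ℓ = ℓ' := by
  have hD : ∀ ξ f, ℓ.D ξ f = ℓ'.D ξ f := fun ξ f => S.j_injective (by
    rw [← h.I_d_j, h'.I_d_j])
  refine LieRinehart.ext (LinearMap.ext₂ fun ξ η => S.pair_ext _ _ fun X => ?_)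
    (LinearMap.ext₂ hD)
  have h1 := S.j_injective ((h.I_I_d_ι ξ η X).symm.trans (h'.I_I_d_ι ξ η X))
  rw [hD, hD] at h1
  exact sub_right_inj.1 h1

end ExteriorCalculus

end Abstract

section LinearAlgebra

variable {V : Type*} [AddCommGroup V] [Module ℝ V]

/-- If φ(v) ≠ 0, contracting v ∧ w = 0 with φ shows that every w is a multiple of v, so the
dimension is at most one. -/
theorem eq_zero_of_ι_mul_ι (hV : 1 < Module.finrank ℝ V) {v : V}
    (h : ∀ w, ExteriorAlgebra.ι ℝ v * ExteriorAlgebra.ι ℝ w = 0) : v = 0 := by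
  by_contra hv
  obtain ⟨φ, hφ⟩ : ∃ φ : Module.Dual ℝ V, φ v ≠ 0 := by
    by_contra! hφ
    exact hv ((Module.forall_dual_apply_eq_zero_iff ℝ v).1 hφ)
  refine hV.not_ge (finrank_le_one v fun w => ⟨(φ v)⁻¹ * φ w, ?_⟩)
  have h1 := congrArg (contractMultivector φ) (h w)
  rw [contractMultivector_ι_mul, contractMultivector_ι, map_zero, ← Algebra.commutes,
    ← Algebra.smul_def, ← map_smul, ← map_smul, ← map_sub] at h1
  have h2 : φ v • w - φ w • v = 0 :=
    ExteriorAlgebra.ι_leftInverse.injective (h1.trans (map_zero _).symm)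
  rw [mul_smul, ← sub_eq_zero.1 h2, inv_smul_smul₀ hφ]

end LinearAlgebra

noncomputable section Induced

variable {E : Type*} [NormedAddCommGroup E] [NormedSpace ℝ E]
  {M : Type*} [TopologicalSpace M] [ChartedSpace E M]
  {F : Type*} [NormedAddCommGroup F] [NormedSpace ℝ F]
  {A : M → Type*} [TopologicalSpace (TotalSpace F A)]
  [∀ x, AddCommGroup (A x)] [∀ x, Module ℝ (A x)] [∀ x, TopologicalSpace (A x)]
  [FiberBundle F A] [VectorBundle ℝ F A] [FiniteDimensional ℝ F]
  [IsManifold 𝓘(ℝ, E) ∞ M] [ContMDiffVectorBundle ∞ F A 𝓘(ℝ, E)]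
  [∀ x, IsTopologicalAddGroup (A x)] [∀ x, ContinuousSMul ℝ (A x)]
  [FiniteDimensional ℝ E] [T2Space M]

namespace Multisection

/-- Here rank one has to be excluded: there all products of two sections vanish. In rank zero the
statement is empty because degree 1 is trivial. -/
theorem eq_zero_of_mul_ofSectionHom_one (hF : Module.finrank ℝ F ≠ 1) {v : Multisection E F A}
    (hv : v ∈ degree E F A 1) (h : ∀ X, v * ofSectionHom X = 0) : v = 0 := by
  rcases Nat.lt_or_ge 1 (Module.finrank ℝ F) with hF' | hF'
  · obtain ⟨X, rfl⟩ := mem_degree_one.1 hv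
    refine ext fun x => ?_
    have : X x = 0 := eq_zero_of_ι_mul_ι (by rwa [finrank_fiber (F := F)]) fun w => by
      obtain ⟨Y, rfl⟩ := exists_section (E := E) (F := F) x w
      exact congrArg (fun t : Multisection E F A => t.1 x) (h Y)
    rw [ofSectionHom_val, this, map_zero]
    rfl
  · exact degree_eq_zero (by omega) hv

theorem eq_zero_of_mul_ofSectionHom_zero (hF : 0 < Module.finrank ℝ F) {v : Multisection E F A}
    (hv : v ∈ degree E F A 0) (h : ∀ X, v * ofSectionHom X = 0) : v = 0 := by
  obtain ⟨f, rfl⟩ := mem_degree_zero.1 hv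
  have hf : f = 0 := by
    ext x
    have : Nontrivial (A x) :=
      Module.nontrivial_of_finrank_pos (R := ℝ) (by rwa [finrank_fiber (F := F)])
    obtain ⟨w, hw⟩ := exists_ne (0 : A x)
    obtain ⟨Y, rfl⟩ := exists_section (E := E) (F := F) x w
    have h1 := h Y
    rw [← ofSectionHom_smul] at h1
    have h2 : f • Y = 0 := ofSectionHom_injective (h1.trans (map_zero _).symm)
    exact (smul_eq_zero.1 (congrArg (fun Z : Sec E F A => Z x) h2)).resolve_right hw
  rw [hf, map_zero]

end Multisection

open Multisection

variable {B : InvertibleHomBundle E F A}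

theorem InvertibleHomBundle.IsExtension.eq_ext {α : Multisection E F A →ₐ[ℝ] Multisection E F A}
    (h : B.IsExtension α) : α = B.ext.toAlgHom := h.unique B.ext_isExtension

variable (B) in
theorem InvertibleHomBundle.ext_symm_comp_ext :
    B.ext.symm.toAlgHom.comp B.ext.toAlgHom = AlgHom.id ℝ (Multisection E F A) :=
  AlgHom.ext B.ext.symm_apply_apply

variable (B) in
theorem InvertibleHomBundle.ext_bijective :
    Function.Bijective (B.ext.toAlgHom : Multisection E F A →ₐ[ℝ] Multisection E F A) :=
  B.ext.bijective

namespace HomLieAlgebroid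

theorem isInducedBracket {L : HomLieAlgebroid B}
    {br : Multisection E F A →ₗ[ℝ] Multisection E F A →ₗ[ℝ] Multisection E F A}
    (h : (calculus E F A).IsSchouten L.lieRinehart br) :
    L.IsInducedBracket (twistBracket br B.ext.toAlgHom) B.ext.toAlgHom where
  isExtension := B.ext_isExtension
  isHomGerstenhaber := h.gerstenhaber.twist (α := B.ext.toAlgHom) B.automorphism.mem
    (fun _ => rfl) (B.automorphism.bracket_map L.lieRinehart_isInvariant h)
  section_section X Y := by
    refine (congrArg B.ext (h.ι_ι X Y)).trans ((B.ext_ofSectionHom _).trans ?_)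
    rw [L.β_lieRinehart_br]
    rfl
  section_fun X f x := by
    have h1 := (congrArg B.ext (h.ι_j X f)).trans (B.ext_ofFunHom _)
    rw [L.pull_lieRinehart_D] at h1
    exact congrArg (fun t : Multisection E F A => t.1 x) h1

/-- An induced bracket is a twisted Schouten bracket. -/
theorem IsInducedBracket.isSchouten {L : HomLieAlgebroid B}
    {br : Multisection E F A →ₗ[ℝ] Multisection E F A →ₗ[ℝ] Multisection E F A}
    {α : Multisection E F A →ₐ[ℝ] Multisection E F A} (h : L.IsInducedBracket br α) :
    (calculus E F A).IsSchouten L.lieRinehart (twistBracket br B.ext.symm.toAlgHom) := by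
  obtain rfl := h.isExtension.eq_ext
  have hg := h.isHomGerstenhaber.twist (α := B.ext.symm.toAlgHom) B.automorphism.symm_mem
    (fun a => (B.ext.symm_apply_apply a).trans (B.ext.apply_symm_apply a).symm) fun a b => ?_
  · refine ⟨?_, fun X Y => ?_, fun X f => ?_⟩
    · rwa [B.ext_symm_comp_ext] at hg
    · refine B.ext.injective ((B.ext.apply_symm_apply _).trans ((h.section_section X Y).trans ?_))
      refine Eq.trans ?_ (B.ext_ofSectionHom _).symm
      rw [L.β_lieRinehart_br]
      rfl
    · refine B.ext.injective ((B.ext.apply_symm_apply _).trans ?_)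
      refine Eq.trans ?_ (B.ext_ofFunHom _).symm
      rw [L.pull_lieRinehart_D]
      exact ext fun x => h.section_fun X f x
  · refine B.ext.injective ((B.ext.apply_symm_apply _).trans
      (Eq.trans ?_ (h.isHomGerstenhaber.map_bracket _ _).symm))
    exact congrArg₂ (fun a b => br a b) (B.ext.apply_symm_apply a).symm
      (B.ext.apply_symm_apply b).symm

theorem IsInducedBracket.eq_twist {L : HomLieAlgebroid B}
    {br br' : Multisection E F A →ₗ[ℝ] Multisection E F A →ₗ[ℝ] Multisection E F A}
    {α : Multisection E F A →ₐ[ℝ] Multisection E F A} (h : L.IsInducedBracket br α)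
    (h' : (calculus E F A).IsSchouten L.lieRinehart br') :
    br = twistBracket br' B.ext.toAlgHom := by
  rw [h'.unique (calculus E F A) h.isSchouten]
  exact LinearMap.ext₂ fun a b => (B.ext.apply_symm_apply _).symm

/-- Some induced bracket exists, and all of them are the twist of the Schouten bracket, so the
chosen one is too. -/
theorem IsInducedBracket.gerstenhaberBracket_eq {L : HomLieAlgebroid B}
    {br : Multisection E F A →ₗ[ℝ] Multisection E F A →ₗ[ℝ] Multisection E F A}
    (h : (calculus E F A).IsSchouten L.lieRinehart br) :
    L.gerstenhaberBracket = twistBracket br B.ext.toAlgHom := by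
  obtain ⟨α, hα⟩ := Classical.epsilon_spec (p := fun br => ∃ α, L.IsInducedBracket br α)
    ⟨_, _, isInducedBracket h⟩
  exact hα.eq_twist h

theorem IsCoboundary.eq_twist {L : HomLieAlgebroid B.dual}
    {d d' : Multisection E F A →ₗ[ℝ] Multisection E F A} (h : L.IsCoboundary d)
    (h' : (calculus E F A).IsDifferential L.lieRinehart d') :
    d = B.ext.toLinearMap ∘ₗ d' := h.unique (L.isCoboundary h')

/-- The operations on both sides are twisted and the untwisted ones commute with α. Each side is
therefore α² of its untwisted counterpart, and α is injective. -/
theorem compat_iff {L : HomLieAlgebroid B} {L' : HomLieAlgebroid B.dual}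
    {br : Multisection E F A →ₗ[ℝ] Multisection E F A →ₗ[ℝ] Multisection E F A}
    {d : Multisection E F A →ₗ[ℝ] Multisection E F A}
    (h : (calculus E F A).IsSchouten L.lieRinehart br)
    (h' : (calculus E F A).IsDifferential L'.lieRinehart d) (X Y : Sec E F A) :
    L'.coboundary (ofSection (L.bracket X Y)) =
      L.gerstenhaberBracket (L'.coboundary (ofSection X)) (ofSection (B.β Y)) +
        L.gerstenhaberBracket (ofSection (B.β X)) (L'.coboundary (ofSection Y)) ↔
      strongDefect br d 1 (ofSectionHom X) (ofSectionHom Y) = 0 := by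
  have hbr : ∀ a b, B.ext (br a b) = br (B.ext a) (B.ext b) :=
    B.automorphism.bracket_map L.lieRinehart_isInvariant h
  have hd : ∀ a, B.ext (d a) = d (B.ext a) :=
    B.automorphism.d_map L'.lieRinehart_isInvariant h' B.pull_sub
  rw [IsInducedBracket.gerstenhaberBracket_eq h, (L'.isCoboundary h').coboundary_eq]
  have h1 : ofSection (L.bracket X Y) = B.ext (br (ofSectionHom X) (ofSectionHom Y)) := by
    refine Eq.trans ?_ (congrArg B.ext (h.ι_ι X Y)).symm
    rw [← L.β_lieRinehart_br]
    exact (B.ext_ofSectionHom _).symm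
  have h2 : ∀ X, ofSection (B.β X) = B.ext (ofSectionHom X) := fun X =>
    (B.ext_ofSectionHom X).symm
  rw [h1, h2, h2]
  change B.ext (d (B.ext (br (ofSectionHom X) (ofSectionHom Y)))) =
    B.ext (br (B.ext (d (ofSectionHom X))) (B.ext (ofSectionHom Y))) +
      B.ext (br (B.ext (ofSectionHom X)) (B.ext (d (ofSectionHom Y)))) ↔ _
  rw [← hd, ← hbr, ← hbr, ← map_add, ← map_add, strongDefect_apply, sub_eq_zero,
    B.ext.injective.eq_iff, B.ext.injective.eq_iff]
  simp

end HomLieAlgebroid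

end Induced

end HomBundles

namespace HomBundles

/-! ### The correspondence between tuples and bialgebroids -/

noncomputable section Correspondence

variable {E : Type*} [NormedAddCommGroup E] [NormedSpace ℝ E]
  {M : Type*} [TopologicalSpace M] [ChartedSpace E M]
  {F : Type*} [NormedAddCommGroup F] [NormedSpace ℝ F]
  {A : M → Type*} [TopologicalSpace (TotalSpace F A)]
  [∀ x, AddCommGroup (A x)] [∀ x, Module ℝ (A x)] [∀ x, TopologicalSpace (A x)]
  [FiberBundle F A] [VectorBundle ℝ F A] [FiniteDimensional ℝ F]
  [IsManifold 𝓘(ℝ, E) ∞ M] [ContMDiffVectorBundle ∞ F A 𝓘(ℝ, E)]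
  [∀ x, IsTopologicalAddGroup (A x)] [∀ x, ContinuousSMul ℝ (A x)]
  [FiniteDimensional ℝ E] [T2Space M]

open Multisection

variable {B : InvertibleHomBundle E F A}

namespace Tuple

/-- The tuple obtained by twisting a bracket and a differential. -/
def twist (B : InvertibleHomBundle E F A)
    (br : Multisection E F A →ₗ[ℝ] Multisection E F A →ₗ[ℝ] Multisection E F A)
    (d : Multisection E F A →ₗ[ℝ] Multisection E F A) : Tuple E F A where
  bracket := twistBracket br B.ext.toAlgHom
  α := B.ext.toAlgHom
  d := B.ext.toLinearMap ∘ₗ d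

/-- Being induced becomes an equation with one explicit tuple, which settles existence and
uniqueness of the induced tuple together. -/
theorem isInducedBy_iff {T : Tuple E F A} {L : HomLieBialgebroid B}
    {br : Multisection E F A →ₗ[ℝ] Multisection E F A →ₗ[ℝ] Multisection E F A}
    {d : Multisection E F A →ₗ[ℝ] Multisection E F A}
    (h : (calculus E F A).IsSchouten L.primal.lieRinehart br)
    (h' : (calculus E F A).IsDifferential L.dual.lieRinehart d) :
    T.IsInducedBy L ↔ T = twist B br d := by
  constructor
  · rintro ⟨hT, hT'⟩
    exact Tuple.ext (hT.eq_twist h) hT.isExtension.eq_ext (hT'.eq_twist h')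
  · rintro rfl
    exact ⟨HomLieAlgebroid.isInducedBracket h, L.dual.isCoboundary h'⟩

end Tuple

namespace HomLieBialgebroid

theorem exists_data (L : HomLieBialgebroid B) : ∃ br d,
    (calculus E F A).IsSchouten L.primal.lieRinehart br ∧
      (calculus E F A).IsDifferential L.dual.lieRinehart d := by
  obtain ⟨br, h⟩ := (calculus E F A).exists_isSchouten L.primal.lieRinehart
  obtain ⟨d, h'⟩ := (calculus E F A).exists_isDifferential L.dual.lieRinehart
  exact ⟨br, d, h, h'⟩

theorem existsUnique_isInducedBy (L : HomLieBialgebroid B) :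
    ∃! T : Tuple E F A, T.IsInducedBy L := by
  obtain ⟨br, d, h, h'⟩ := L.exists_data
  simp only [Tuple.isInducedBy_iff h h']
  exact existsUnique_eq

theorem isDifferentialRegular {L : HomLieBialgebroid B} {T : Tuple E F A}
    (hT : T.IsInducedBy L) : T.IsDifferentialRegular := by
  obtain ⟨br, d, h, h'⟩ := L.exists_data
  obtain rfl := (Tuple.isInducedBy_iff h h').1 hT
  exact ⟨(ExteriorCalculus.isDifferentialHomGerstenhaber h.gerstenhaber h'.der h'.d_d).twist
    (α := B.ext.toAlgHom) B.automorphism.mem (fun _ => rfl)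
    (B.automorphism.bracket_map L.primal.lieRinehart_isInvariant h)
    (B.automorphism.d_map L.dual.lieRinehart_isInvariant h' B.pull_sub), B.ext_bijective⟩

theorem isStrongDifferentialRegular (hF : Module.finrank ℝ F ≠ 1) {L : HomLieBialgebroid B}
    {T : Tuple E F A} (hT : T.IsInducedBy L) : T.IsStrongDifferentialRegular := by
  obtain ⟨br, d, h, h'⟩ := L.exists_data
  obtain rfl := (Tuple.isInducedBy_iff h h').1 hT
  have hs : IsStrongDifferentialHomGerstenhaber (degree E F A) br
      (AlgHom.id ℝ (Multisection E F A)) d :=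
    { toIsDifferentialHomGerstenhaber :=
        ExteriorCalculus.isDifferentialHomGerstenhaber h.gerstenhaber h'.der h'.d_d
      d_bracket := fun i j a ha b _ => by
        have := LinearMap.congr_fun (ExteriorCalculus.strongDefect_eq_zero h.gerstenhaber h'.der
          (fun v hv => eq_zero_of_mul_ofSectionHom_one hF hv)
          -- In positive rank sections separate functions; in rank zero the alternative holds, as
          -- degree 1 is trivial.
          ((Nat.eq_zero_or_pos (Module.finrank ℝ F)).symm.imp
            (fun hF' v hv => eq_zero_of_mul_ofSectionHom_zero hF' hv)
            fun hF' v hv => degree_eq_zero (by omega) hv)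
          (fun X Y => (HomLieAlgebroid.compat_iff h h' X Y).1 (L.compat X Y)) ha) b
        rw [strongDefect_apply] at this
        exact sub_eq_zero.1 this }
  exact ⟨hs.twist (α := B.ext.toAlgHom) B.automorphism.mem (fun _ => rfl)
    (B.automorphism.bracket_map L.primal.lieRinehart_isInvariant h)
    (B.automorphism.d_map L.dual.lieRinehart_isInvariant h' B.pull_sub), B.ext_bijective⟩

end HomLieBialgebroid

theorem Tuple.twist_injective
    {br br' : Multisection E F A →ₗ[ℝ] Multisection E F A →ₗ[ℝ] Multisection E F A}
    {d d' : Multisection E F A →ₗ[ℝ] Multisection E F A}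
    (h : Tuple.twist B br d = Tuple.twist B br' d') : br = br' ∧ d = d' :=
  ⟨LinearMap.ext₂ fun a b => B.ext.injective
    (LinearMap.congr_fun₂ (congrArg Tuple.bracket h) a b),
  LinearMap.ext fun a => B.ext.injective (LinearMap.congr_fun (congrArg Tuple.d h) a)⟩

/-- Untwisting recovers the Schouten bracket and the differential. These determine the two
Lie-Rinehart structures, which in turn determine the hom-Lie algebroids. -/
theorem HomLieBialgebroid.eq_of_isInducedBy {L L' : HomLieBialgebroid B} {T : Tuple E F A}
    (h : T.IsInducedBy L) (h' : T.IsInducedBy L') : L = L' := by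
  obtain ⟨br, d, h₁, h₂⟩ := L.exists_data
  obtain ⟨br', d', h₁', h₂'⟩ := L'.exists_data
  obtain ⟨rfl, rfl⟩ := Tuple.twist_injective
    (((Tuple.isInducedBy_iff h₁ h₂).1 h).symm.trans ((Tuple.isInducedBy_iff h₁' h₂').1 h'))
  exact HomLieBialgebroid.ext
    (HomLieAlgebroid.lieRinehart_injective (h₁.lieRinehart_unique h₁'))
    (HomLieAlgebroid.lieRinehart_injective (h₂.lieRinehart_unique h₂'))

/-- A strong differential regular hom-Gerstenhaber algebra is the twist of one with `α = id`. -/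
theorem Tuple.IsStrongDifferentialRegular.exists_eq_twist {T : Tuple E F A}
    (hα : B.IsExtension T.α) (hT : T.IsStrongDifferentialRegular) :
    ∃ br d, T = Tuple.twist B br d ∧ IsStrongDifferentialHomGerstenhaber (degree E F A) br
      (AlgHom.id ℝ (Multisection E F A)) d ∧ (∀ a b, B.ext (br a b) = br (B.ext a) (B.ext b)) ∧
      ∀ a, B.ext (d a) = d (B.ext a) := by
  obtain ⟨bT, α, dT⟩ := T
  obtain rfl : α = B.ext.toAlgHom := hα.eq_ext
  have hs : IsStrongDifferentialHomGerstenhaber (degree E F A) bT B.ext.toAlgHom dT := hT.1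
  have hbT : ∀ a b, B.ext (bT a b) = bT (B.ext a) (B.ext b) := hs.map_bracket
  have hdT : ∀ a, dT (B.ext a) = B.ext (dT a) := hs.d_map
  have hbr : ∀ a b, B.ext.symm (bT a b) = bT (B.ext.symm a) (B.ext.symm b) := fun a b => by
    rw [AlgEquiv.symm_apply_eq, hbT, AlgEquiv.apply_symm_apply, AlgEquiv.apply_symm_apply]
  have hd : ∀ a, B.ext.symm (dT a) = dT (B.ext.symm a) := fun a => by
    rw [AlgEquiv.symm_apply_eq, ← hdT, AlgEquiv.apply_symm_apply]
  have hs' := hs.twist (α := B.ext.symm.toAlgHom) B.automorphism.symm_mem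
    (fun a => (B.ext.symm_apply_apply a).trans (B.ext.apply_symm_apply a).symm) hbr hd
  rw [B.ext_symm_comp_ext] at hs'
  refine ⟨_, _, Tuple.ext (LinearMap.ext₂ fun a b => (B.ext.apply_symm_apply _).symm) rfl
    (LinearMap.ext fun a => (B.ext.apply_symm_apply _).symm), hs', fun a b => ?_, fun a => ?_⟩
  · change B.ext (B.ext.symm (bT a b)) = B.ext.symm (bT (B.ext a) (B.ext b))
    rw [← hbT, AlgEquiv.apply_symm_apply, AlgEquiv.symm_apply_apply]
  · change B.ext (B.ext.symm (dT a)) = B.ext.symm (dT (B.ext a))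
    rw [hdT, AlgEquiv.apply_symm_apply, AlgEquiv.symm_apply_apply]

/-- No rank assumption is needed in this direction: compatibility is the derivation rule for two
elements of degree 1. Commutation with α supplies the invariance needed to twist back. -/
theorem HomLieBialgebroid.exists_of_isStrong
    {br : Multisection E F A →ₗ[ℝ] Multisection E F A →ₗ[ℝ] Multisection E F A}
    {d : Multisection E F A →ₗ[ℝ] Multisection E F A}
    (hs : IsStrongDifferentialHomGerstenhaber (degree E F A) br
      (AlgHom.id ℝ (Multisection E F A)) d)
    (hbr : ∀ a b, B.ext (br a b) = br (B.ext a) (B.ext b)) (hd : ∀ a, B.ext (d a) = d (B.ext a)) :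
    ∃ L : HomLieBialgebroid B, (calculus E F A).IsSchouten L.primal.lieRinehart br ∧
      (calculus E F A).IsDifferential L.dual.lieRinehart d := by
  obtain ⟨ℓ, hℓ⟩ := (calculus E F A).exists_lieRinehart hs.toIsHomGerstenhaber
  obtain ⟨ℓ', hℓ'⟩ := (calculus E F A).exists_lieRinehart_dual
    hs.toIsDifferentialHomGerstenhaber.isGradedDerivation hs.d_d
  obtain ⟨L, rfl⟩ := HomLieAlgebroid.exists_of_lieRinehart ℓ
    (B.automorphism.isInvariant_of_bracket hℓ hbr)
  obtain ⟨L', rfl⟩ := HomLieAlgebroid.exists_of_lieRinehart (B := B.dual) ℓ'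
    (B.automorphism.isInvariant_of_d hℓ' B.pull_sub B.β.surjective hd)
  have hcompat : ∀ X Y, strongDefect br d 1 (ofSectionHom X) (ofSectionHom Y) = 0 := fun X Y => by
    rw [strongDefect_apply, hs.d_bracket 1 1 _ (ofSectionHom_mem X) _ (ofSectionHom_mem Y)]
    exact sub_self _
  exact ⟨⟨L, L', fun X Y => (HomLieAlgebroid.compat_iff hℓ hℓ' X Y).2 (hcompat X Y)⟩, hℓ, hℓ'⟩

theorem Tuple.IsStrongDifferentialRegular.existsUnique {T : Tuple E F A}
    (hα : B.IsExtension T.α) (hT : T.IsStrongDifferentialRegular) :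
    ∃! L : HomLieBialgebroid B, T.IsInducedBy L := by
  obtain ⟨br, d, rfl, hs, hbr, hd⟩ := hT.exists_eq_twist hα
  obtain ⟨L, h, h'⟩ := HomLieBialgebroid.exists_of_isStrong hs hbr hd
  have hL := (Tuple.isInducedBy_iff h h').2 rfl
  exact ⟨L, hL, fun L' hL' => HomLieBialgebroid.eq_of_isInducedBy hL' hL⟩

end Correspondence

end HomBundles


theorem mainTheorem6
    {E : Type*} [NormedAddCommGroup E] [NormedSpace ℝ E] [FiniteDimensional ℝ E]
    {M : Type*} [TopologicalSpace M] [ChartedSpace E M] [IsManifold 𝓘(ℝ, E) ∞ M]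
    [T2Space M] [SecondCountableTopology M]
    {F : Type*} [NormedAddCommGroup F] [NormedSpace ℝ F] [FiniteDimensional ℝ F]
    {A : M → Type*} [TopologicalSpace (TotalSpace F A)]
    [∀ x, AddCommGroup (A x)] [∀ x, Module ℝ (A x)] [∀ x, TopologicalSpace (A x)]
    [∀ x, IsTopologicalAddGroup (A x)] [∀ x, ContinuousSMul ℝ (A x)]
    [FiberBundle F A] [VectorBundle ℝ F A] [ContMDiffVectorBundle ∞ F A 𝓘(ℝ, E)]
    (B : HomBundles.InvertibleHomBundle E F A) :
    (Module.finrank ℝ F ≠ 1 → ∀ T : HomBundles.Tuple E F A, B.IsExtension T.α →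
      (T.IsStrongDifferentialRegular ↔
        ∃ L : HomBundles.HomLieBialgebroid B, T.IsInducedBy L)) ∧
    (∀ T : HomBundles.Tuple E F A, B.IsExtension T.α → T.IsStrongDifferentialRegular →
      ∃! L : HomBundles.HomLieBialgebroid B, T.IsInducedBy L) ∧
    (∀ L : HomBundles.HomLieBialgebroid B, ∃! T : HomBundles.Tuple E F A, T.IsInducedBy L) ∧
    (∀ (L : HomBundles.HomLieBialgebroid B) (T : HomBundles.Tuple E F A), T.IsInducedBy L →
      T.IsDifferentialRegular) := by
  exact ⟨fun hF T hα => ⟨fun hT => (hT.existsUnique hα).exists,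
    fun ⟨_, hL⟩ => HomBundles.HomLieBialgebroid.isStrongDifferentialRegular hF hL⟩,
    fun _ hα hT => hT.existsUnique hα,
    fun L => L.existsUnique_isInducedBy,
    fun _ _ hL => HomBundles.HomLieBialgebroid.isDifferentialRegular hL⟩
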